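/- **Main Theorem.** Fix a finite graph $H$ and let $\mathcal G$ be the class of finite simple graphs that do not contain $H$ as a topological minor. Let $\Pi \subseteq \mathcal G \times \mathbb N$ be a parameterized graph problem on $\mathcal G$ (a set of pairs closed under graph isomorphism; the pairs in $\Pi$ are the yes-instances). Suppose that: 1. $\Pi$ has finite integer index in $\mathcal G$: for every $t \in \mathbb N$, the following equivalence relation on the $t$-boundaried graphs in $\mathcal G$ (graphs in $\mathcal G$ with $t$ distinct vertices labeled $1,\dots,t$) has only finitely many classes. Here $G_1 \equiv_{\Pi,t} G_2$ if there is $c \in \mathbb Z$ such that for all $t$-boundaried graphs $G_3$ and all $k \in \mathbb Z$ we have $G_1 \oplus G_3 \in \mathcal G \iff G_2 \oplus G_3 \in \mathcal G$, and $(G_1 \oplus G_3, k) \in \Pi \iff (G_2 \oplus G_3, k + c) \in \Pi$. The graph $G_i \oplus G_3$ is obtained from the disjoint union by identifying vertices with equal labels, and pairs with a negative parameter are not in $\Pi$. 2. $\Pi$ is treewidth-bounding: there are constants $c, t \in \mathbb N$ such that for every $(G,k) \in \Pi$ there is a set $X \subseteq V(G)$ with $|X| \le ck$ and $\mathrm{tw}(G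 - X) \le t$. Then $\Pi$ admits a linear kernel: there are constants $a, b \in \mathbb N$ and an algorithm which, given $G \in \mathcal G$ and $k \in \mathbb N$, computes in time polynomial in $|V(G)| + k$ a graph $G' \in \mathcal G$ and $k' \in \mathbb N$ such that $(G,k) \in \Pi \iff (G',k') \in \Pi$, $|V(G')| + |E(G')| \le ak + b$ and $k' \le ak + b$. -/

import Mathlib

/-! ## Finite graphs, topological minors, treewidth -/

/-- A finite simple graph on an arbitrary vertex type. -/
structure FinGraph where
  V : Type
  [finite : Finite V]
  graph : SimpleGraph V

attribute [instance] FinGraph.finite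

/-- `H` is a topological minor of `G`: some subdivision of `H` is a subgraph of `G`. The vertices of
`H` are mapped injectively to branch vertices of `G`, the edges of `H` to paths between the
corresponding branch vertices. No path has a branch vertex in its interior, and paths of different
edges meet only in branch vertices. -/
def IsTopologicalMinor {W V : Type*} (H : SimpleGraph W) (G : SimpleGraph V) : Prop :=
  ∃ (f : W ↪ V) (P : ∀ u v : W, H.Adj u v → G.Walk (f u) (f v)),
    (∀ u v (h : H.Adj u v), (P u v h).IsPath) ∧
    (∀ u v (h : H.Adj u v) (w : W), f w ∈ (P u v h).support → w = u ∨ w = v) ∧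
    (∀ u v (h : H.Adj u v) u' v' (h' : H.Adj u' v'), s(u, v) ≠ s(u', v') →
      ∀ x, x ∈ (P u v h).support → x ∈ (P u' v' h').support → ∃ w, x = f w)

/-- The class of (finite) `H`-topological-minor-free graphs. -/
def topologicalMinorFree {W : Type*} (H : SimpleGraph W) : Set FinGraph :=
  {G | ¬ IsTopologicalMinor H G.graph}

/-- A tree-decomposition of `G`. -/
structure TreeDecomposition {V : Type*} (G : SimpleGraph V) where
  /-- the nodes of the tree -/
  Node : Type
  [finite : Finite Node]
  tree : SimpleGraph Node
  isTree : tree.IsTree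
  bag : Node → Set V
  cover : ∀ v, ∃ i, v ∈ bag i
  cover_edge : ∀ u v, G.Adj u v → ∃ i, u ∈ bag i ∧ v ∈ bag i
  /-- the nodes whose bags contain `v` induce a subtree -/
  subtree : ∀ v, (tree.induce {i | v ∈ bag i}).Connected

/-- `tw(G) ≤ t` (for a finite graph `G`): there is a tree-decomposition all of whose bags have at
most `t + 1` vertices. -/
def TreewidthLE {V : Type*} (G : SimpleGraph V) (t : ℕ) : Prop :=
  ∃ D : TreeDecomposition G, ∀ i, (D.bag i).ncard ≤ t + 1

/-! ## Boundaried graphs and gluing -/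

/-- A `t`-boundaried graph: a finite graph with `t` distinct vertices labeled by `Fin t`. -/
structure BoundariedGraph (t : ℕ) extends FinGraph where
  label : Fin t ↪ V

namespace BoundariedGraph

variable {t : ℕ}

/-- The pairs of vertices of the disjoint union that are identified by gluing. -/
def glueRel (A B : BoundariedGraph t) (x y : A.V ⊕ B.V) : Prop :=
  ∃ i : Fin t, x = Sum.inl (A.label i) ∧ y = Sum.inr (B.label i)

/-- The gluing `A ⊕ B`: take the disjoint union, and identify vertices with the same label. -/
def glue (A B : BoundariedGraph t) : FinGraph where
  V := Quot (glueRel A B)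
  graph :=
    { Adj := fun x y => x ≠ y ∧ ∃ a b : A.V ⊕ B.V,
        Quot.mk _ a = x ∧ Quot.mk _ b = y ∧ (A.graph.sum B.graph).Adj a b
      symm := ⟨fun _ _ ⟨hne, a, b, ha, hb, hab⟩ => ⟨hne.symm, b, a, hb, ha, hab.symm⟩⟩
      loopless := ⟨fun _ h => h.1 rfl⟩ }

end BoundariedGraph

/-! ## Parameterized graph problems -/

/-- A parameterized graph problem on a graph class `𝒢`: a set of pairs `(G, k)` (the yes-instances)
with `G ∈ 𝒢` and `k : ℕ` that is closed under graph isomorphism. -/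
structure ParamGraphProblem (𝒢 : Set FinGraph) where
  Yes : FinGraph → ℕ → Prop
  mem_class : ∀ {G k}, Yes G k → G ∈ 𝒢
  iso : ∀ {G G' : FinGraph} {k}, Nonempty (G.graph ≃g G'.graph) → Yes G k → Yes G' k

namespace ParamGraphProblem

variable {𝒢 : Set FinGraph}

/-- `(G, k) ∈ Q` for an integer `k`; no pair with a negative parameter belongs to `Q`. -/
def YesInt (Q : ParamGraphProblem 𝒢) (G : FinGraph) (k : ℤ) : Prop :=
  ∃ m : ℕ, (m : ℤ) = k ∧ Q.Yes G m

/-- The equivalence of `t`-boundaried graphs in `𝒢` with respect to `Q`. -/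
def Equiv (Q : ParamGraphProblem 𝒢) {t : ℕ} (A B : BoundariedGraph t) : Prop :=
  ∃ c : ℤ, ∀ (C : BoundariedGraph t) (k : ℤ),
    (A.glue C ∈ 𝒢 ↔ B.glue C ∈ 𝒢) ∧ (Q.YesInt (A.glue C) k ↔ Q.YesInt (B.glue C) (k + c))

/-- `Q.Equiv` as an equivalence relation on the `t`-boundaried graphs in `𝒢`. -/
def equivSetoid (Q : ParamGraphProblem 𝒢) (t : ℕ) :
    Setoid {A : BoundariedGraph t // A.toFinGraph ∈ 𝒢} where
  r A B := Q.Equiv A.1 B.1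
  iseqv :=
    { refl := fun _ => ⟨0, fun _ _ => by simp⟩
      symm := fun ⟨c, h⟩ => ⟨-c, fun C k =>
        ⟨(h C k).1.symm, by simpa using (h C (k + -c)).2.symm⟩⟩
      trans := fun ⟨c, h⟩ ⟨d, h'⟩ => ⟨c + d, fun C k =>
        ⟨(h C k).1.trans (h' C k).1, by
          simpa [add_assoc] using (h C k).2.trans (h' C (k + c)).2⟩⟩ }

/-- `Q` has finite integer index in `𝒢`: for every `t`, the equivalence of `t`-boundaried graphs
in `𝒢` has finitely many classes. -/
def HasFiniteIntegerIndex (Q : ParamGraphProblem 𝒢) : Prop :=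
  ∀ t : ℕ, Finite (Quotient (Q.equivSetoid t))

/-- `Q` is treewidth-bounding (on `𝒢`). -/
def TreewidthBounding (Q : ParamGraphProblem 𝒢) : Prop :=
  ∃ c t : ℕ, ∀ (G : FinGraph) (k : ℕ), Q.Yes G k →
    ∃ X : Set G.V, X.ncard ≤ c * k ∧ TreewidthLE (G.graph.induce Xᶜ) t

end ParamGraphProblem

/-! ## Random access machines

The machine model for running times: structured programs for a random access machine whose only
arithmetic is addition and truncated subtraction, at unit cost. -/

namespace RAM

/-- Registers and memory cells, all holding natural numbers. -/
structure State where
  reg : ℕ → ℕ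
  mem : ℕ → ℕ

/-- Programs. A program mentions only finitely many registers; the memory is accessed indirectly. -/
inductive Prog where
  /-- do nothing -/
  | skip
  /-- `reg x := c` -/
  | const (x c : ℕ)
  /-- `reg x := reg y` -/
  | copy (x y : ℕ)
  /-- `reg x := reg y + reg z` -/
  | add (x y z : ℕ)
  /-- `reg x := max (reg y - reg z) 0` -/
  | sub (x y z : ℕ)
  /-- `reg x := mem (reg y)` -/
  | load (x y : ℕ)
  /-- `mem (reg x) := reg y` -/
  | store (x y : ℕ)
  /-- first `P`, then `Q` -/
  | seq (P Q : Prog)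
  /-- if `reg x ≠ 0` then `P` else `Q` -/
  | cond (x : ℕ) (P Q : Prog)
  /-- while `reg x ≠ 0` do `P` -/
  | loop (x : ℕ) (P : Prog)

/-- `reg x := a` -/
def State.setReg (s : State) (x a : ℕ) : State := { s with reg := Function.update s.reg x a }

/-- `mem x := a` -/
def State.setMem (s : State) (x a : ℕ) : State := { s with mem := Function.update s.mem x a }

/-- `Run P s m s'`: started in state `s`, the program `P` halts in state `s'` after exactly `m`
steps. Every elementary instruction and every test takes one step. -/
inductive Run : Prog → State → ℕ → State → Prop where
  | skip (s) : Run .skip s 1 s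
  | const (x c s) : Run (.const x c) s 1 (s.setReg x c)
  | copy (x y s) : Run (.copy x y) s 1 (s.setReg x (s.reg y))
  | add (x y z s) : Run (.add x y z) s 1 (s.setReg x (s.reg y + s.reg z))
  | sub (x y z s) : Run (.sub x y z) s 1 (s.setReg x (s.reg y - s.reg z))
  | load (x y s) : Run (.load x y) s 1 (s.setReg x (s.mem (s.reg y)))
  | store (x y s) : Run (.store x y) s 1 (s.setMem (s.reg x) (s.reg y))
  | seq {P Q s s' s'' m m'} : Run P s m s' → Run Q s' m' s'' → Run (.seq P Q) s (m + m') s''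
  | condPos {x P Q s s' m} : s.reg x ≠ 0 → Run P s m s' → Run (.cond x P Q) s (m + 1) s'
  | condZero {x P Q s s' m} : s.reg x = 0 → Run Q s m s' → Run (.cond x P Q) s (m + 1) s'
  | loopPos {x P s s' s'' m m'} : s.reg x ≠ 0 → Run P s m s' → Run (.loop x P) s' m' s'' →
      Run (.loop x P) s (m + m' + 1) s''
  | loopZero {x P s} : s.reg x = 0 → Run (.loop x P) s 1 s

/-- The instance `(G, k)` with `G` a graph on `{0, …, n - 1}` is written in the state `s`: register
`0` holds `n`, register `1` holds `k`, and the memory starts with the adjacency matrix of `G`, row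
by row. -/
def State.Holds (s : State) {n : ℕ} (G : SimpleGraph (Fin n)) (k : ℕ) : Prop :=
  s.reg 0 = n ∧ s.reg 1 = k ∧
    ∀ i j : Fin n, (G.Adj i j → s.mem (i * n + j) = 1) ∧ (¬ G.Adj i j → s.mem (i * n + j) = 0)

/-- The initial state for the input `(G, k)`: registers and memory hold nothing but `(G, k)`. -/
def State.IsInput (s : State) {n : ℕ} (G : SimpleGraph (Fin n)) (k : ℕ) : Prop :=
  s.Holds G k ∧ (∀ x, 2 ≤ x → s.reg x = 0) ∧ (∀ a, n * n ≤ a → s.mem a = 0)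

end RAM

/-! ## Kernels -/

/-- A graph on `{0, …, n - 1}` as a finite graph. -/
def FinGraph.ofFin {n : ℕ} (G : SimpleGraph (Fin n)) : FinGraph := ⟨Fin n, G⟩

namespace ParamGraphProblem

variable {𝒢 : Set FinGraph}

/-- `Q` has a kernel of size `g`: there is an algorithm that for all `(G, k)` with `G ∈ 𝒢` computes,
in time polynomial in `|V(G)| + k`, an equivalent instance `(G', k')` of the problem (so `G' ∈ 𝒢`)
with `|V(G')| + |E(G')| ≤ g k` and `k' ≤ g k`. -/
def HasKernel (Q : ParamGraphProblem 𝒢) (g : ℕ → ℕ) : Prop :=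
  ∃ (P : RAM.Prog) (p : Polynomial ℕ),
    ∀ (n : ℕ) (G : SimpleGraph (Fin n)) (k : ℕ), FinGraph.ofFin G ∈ 𝒢 →
    ∀ s : RAM.State, s.IsInput G k →
    ∃ (m : ℕ) (s' : RAM.State) (n' : ℕ) (G' : SimpleGraph (Fin n')) (k' : ℕ),
      RAM.Run P s m s' ∧ m ≤ p.eval (n + k) ∧ s'.Holds G' k' ∧
      FinGraph.ofFin G' ∈ 𝒢 ∧
      (Q.Yes (FinGraph.ofFin G) k ↔ Q.Yes (FinGraph.ofFin G') k') ∧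
      n' + G'.edgeSet.ncard ≤ g k ∧ k' ≤ g k

/-- `Q` has a kernel of size `a * k + b` for some constants `a` and `b`. -/
def HasLinearKernel (Q : ParamGraphProblem 𝒢) : Prop :=
  ∃ a b : ℕ, Q.HasKernel fun k => a * k + b

end ParamGraphProblem

/-! The kernel comes from replacing protrusions. A large vertex set attached to the rest of the
graph at boundedly many vertices can, by finite integer index, be exchanged for an equivalent set of
bounded size; `exists_least_representative` picks representatives that never increase the parameter.
Only patterns with at most `N` vertices are replaced, so finitely many rules suffice
(`exists_rules`). Each rule is tried on all tuples of vertices, in polynomial time, and every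
application deletes a vertex (`Spec.reduce`).

The combinatorial core is that a yes-instance to which no rule applies has O(k) vertices. It has a
set X with |X| ≤ ck and tw(G - X) ≤ t, and `exists_card_le_of_noProtrusion` bounds |V| linearly in
|X|. A tree-decomposition of G - X is cut at few bags, with union Y, such that all components of G -
Z, where Z = X ∪ Y, have bounded size and few neighbours in Y (`exists_fragmentation_compl`). The
excluded topological minor enters through `exists_packing`: as many components as possible realise
distinct missing edges between vertices of Z. The resulting graph R on Z is a topological minor of
G, hence sparse by Mader's contraction argument (`exists_hasModel_of_dense`). So only linearly many
components are used up. The neighbourhoods of the others are cliques of R, which are small and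
linearly many, and all components with the same small neighbourhood together form one protrusion,
hence have few vertices. Packing relative to X handles the components with many neighbours in X,
packing relative to Z the others. This gives |V| ≤ β|Z| + O(|X|) + O(1), and Y is so small that β|Y|
≤ |V|/2.

The constants are chosen in the order r, s, N: the boundary size r depends on H and t only, the size
s of representatives on r, and the pattern size N on s. A reduced instance that violates the linear
bound, or whose parameter has become negative, is a no-instance and is exchanged for a fixed one.
Otherwise the adjacency matrix is compacted and returned; sparsity (`exists_arcs_le`) bounds its
edges. -/

set_option autoImplicit false

/-! ## Connections inside vertex sets -/

section Structure

open scoped Classical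

variable {V W : Type*}

/-- `x` and `y` are joined by a walk of `G` inside `T`. -/
def ConnIn (G : SimpleGraph V) (T : Set V) (x y : V) : Prop :=
  ∃ p : G.Walk x y, ∀ z ∈ p.support, z ∈ T

namespace ConnIn

variable {G G' : SimpleGraph V} {T T' : Set V} {x y z : V}

theorem refl (hx : x ∈ T) : ConnIn G T x x := ⟨.nil, by simpa using hx⟩

theorem symm (h : ConnIn G T x y) : ConnIn G T y x := by
  obtain ⟨p, hp⟩ := h
  exact ⟨p.reverse, by simpa using hp⟩

theorem trans (h : ConnIn G T x y) (h' : ConnIn G T y z) : ConnIn G T x z := by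
  obtain ⟨p, hp⟩ := h
  obtain ⟨q, hq⟩ := h'
  refine ⟨p.append q, fun w hw => ?_⟩
  rcases (SimpleGraph.Walk.mem_support_append_iff p q).1 hw with h | h
  exacts [hp w h, hq w h]

theorem mono (h : ConnIn G T x y) (hT : T ⊆ T') : ConnIn G T' x y := by
  obtain ⟨p, hp⟩ := h
  exact ⟨p, fun z hz => hT (hp z hz)⟩

theorem of_adj (h : G.Adj x y) (hx : x ∈ T) (hy : y ∈ T) : ConnIn G T x y :=
  ⟨h.toWalk, by simp [hx, hy]⟩

theorem left_mem (h : ConnIn G T x y) : x ∈ T := by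
  obtain ⟨p, hp⟩ := h
  exact hp _ p.start_mem_support

theorem right_mem (h : ConnIn G T x y) : y ∈ T := h.symm.left_mem

/-- A property that spreads along the edges inside `T` spreads along connections inside `T`. -/
theorem induct {P : V → Prop} (h : ConnIn G T x y) (hx : P x)
    (hstep : ∀ a b, a ∈ T → b ∈ T → G.Adj a b → P a → P b) : P y := by
  obtain ⟨p, hp⟩ := h
  induction p with
  | nil => exact hx
  | cons hab p ih =>
    refine ih (hstep _ _ (hp _ (by simp)) (hp _ (by simp)) hab hx) fun z hz => hp z (by simp [hz])

/-- Replacing the edges of a connection by connections. -/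
theorem bind (h : ConnIn G T x y) (hx : x ∈ T')
    (hstep : ∀ a b, a ∈ T → b ∈ T → G.Adj a b → a ∈ T' → ConnIn G' T' a b) : ConnIn G' T' x y :=
  h.induct (P := fun z => ConnIn G' T' x z) (refl hx)
    fun a b ha hb hab h => h.trans (hstep a b ha hb hab h.right_mem)

theorem of_induce {S : Set V} {a b : S} (h : (G.induce S).Reachable a b) : ConnIn G S a b := by
  obtain ⟨p⟩ := h
  induction p with
  | nil => exact refl (Subtype.property _)
  | cons hab p ih => exact (of_adj (by simpa using hab) (Subtype.property _) (Subtype.property _)).trans ih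

end ConnIn

/-! ## Models of graphs as topological minors -/

/-- A topological model in `G`, inside the vertex set `S`, of the graph on `W` with edge set `E`:
branch vertices `f w`, and disjoint sets `I e` of inner vertices through which the ends of `e` are
connected. -/
def HasModel (E : Set (Sym2 W)) (G : SimpleGraph V) (S : Set V) : Prop :=
  ∃ (f : W ↪ V) (I : Sym2 W → Set V), (∀ w, f w ∈ S) ∧ (∀ e, I e ⊆ S) ∧ (∀ e w, f w ∉ I e) ∧
    (∀ e e', e ≠ e' → Disjoint (I e) (I e')) ∧
    -- Diagonal elements of `E` impose nothing, so `Set.univ` stands for the complete graph.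
    ∀ u v, u ≠ v → s(u, v) ∈ E → ConnIn G ({f u, f v} ∪ I s(u, v)) (f u) (f v)

theorem HasModel.mono {E : Set (Sym2 W)} {G : SimpleGraph V} {S S' : Set V}
    (h : HasModel E G S) (hS : S ⊆ S') : HasModel E G S' := by
  obtain ⟨f, I, hf, hI, h⟩ := h
  exact ⟨f, I, fun w => hS (hf w), fun e => (hI e).trans hS, h⟩

/-- A topological model of the complete graph on `W` contains every graph on `W`. -/
theorem HasModel.isTopologicalMinor {G : SimpleGraph V} (H : SimpleGraph W)
    (h : HasModel (Set.univ : Set (Sym2 W)) G Set.univ) : IsTopologicalMinor H G := by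
  obtain ⟨f, I, -, -, hfI, hdisj, hconn⟩ := h
  have key : ∀ u v, H.Adj u v →
      ∃ p : G.Walk (f u) (f v), p.IsPath ∧ ∀ x ∈ p.support, x ∈ {f u, f v} ∪ I s(u, v) := by
    intro u v huv
    obtain ⟨p, hp⟩ := hconn u v huv.ne (Set.mem_univ _)
    exact ⟨p.bypass, p.bypass_isPath, fun x hx => hp x (p.support_bypass_subset_support hx)⟩
  choose P hP hPs using key
  refine ⟨f, P, hP, ?_, ?_⟩
  · intro u v h w hw
    rcases hPs u v h _ hw with h' | h'
    · simpa using h'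
    · exact absurd h' (hfI _ _)
  · intro u v h u' v' h' hne x hx hx'
    rcases hPs u v h _ hx with h1 | h1
    · rcases h1 with h1 | h1
      exacts [⟨u, h1⟩, ⟨v, h1⟩]
    rcases hPs u' v' h' _ hx' with h2 | h2
    · rcases h2 with h2 | h2
      exacts [⟨u', h2⟩, ⟨v', h2⟩]
    exact absurd h2 (Set.disjoint_left.1 (hdisj _ _ hne) h1)

/-- Topological minors of a subgraph are topological minors. -/
theorem IsTopologicalMinor.map {V' : Type*} {H : SimpleGraph W} {G : SimpleGraph V}
    {G' : SimpleGraph V'} (φ : G →g G') (hφ : Function.Injective φ)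
    (h : IsTopologicalMinor H G) : IsTopologicalMinor H G' := by
  obtain ⟨f, P, hP, hb, hd⟩ := h
  have hs : ∀ {a b : V} (p : G.Walk a b) (x : V'), x ∈ (p.map φ).support →
      ∃ c ∈ p.support, φ c = x := fun p x hx => by
    rwa [SimpleGraph.Walk.support_map, List.mem_map] at hx
  refine ⟨f.trans ⟨φ, hφ⟩, fun u v h => (P u v h).map φ, fun u v h => ?_, ?_, ?_⟩
  · exact (hP u v h).map hφ
  · intro u v h w hw
    obtain ⟨a, ha, ha'⟩ := hs (P u v h) _ hw
    rw [hφ ha'] at ha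
    exact hb u v h w ha
  · intro u v h u' v' h' hne x hx hx'
    obtain ⟨a, ha, rfl⟩ := hs (P u v h) _ hx
    obtain ⟨b, hb', hab⟩ := hs (P u' v' h') _ hx'
    rw [hφ hab] at hb'
    obtain ⟨w, rfl⟩ := hd u v h u' v' h' hne a ha hb'
    exact ⟨w, rfl⟩

/-! ## Dense graphs contain complete topological minors -/

/-- The number of ordered pairs of adjacent vertices in `S`. -/
noncomputable def arcs (G : SimpleGraph V) (S : Finset V) : ℕ :=
  ∑ x ∈ S, (S.filter (G.Adj x)).card

/-- Arcs from `v` and arcs to `v` both disappear, hence the factor two. -/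
theorem arcs_erase (G : SimpleGraph V) {S : Finset V} {v : V} (hv : v ∈ S) :
    arcs G S = arcs G (S.erase v) + 2 * (S.filter (G.Adj v)).card := by
  have h1 : ∀ x ∈ S.erase v, (S.filter (G.Adj x)).card =
      ((S.erase v).filter (G.Adj x)).card + if G.Adj x v then 1 else 0 := by
    intro x hx
    rw [Finset.filter_erase]
    split_ifs with h
    · rw [Finset.card_erase_add_one (by simp [hv, h])]
    · rw [Finset.erase_eq_of_notMem (by simp [h])]; rfl
  have h2 : ∑ x ∈ S.erase v, (if G.Adj x v then 1 else 0) = (S.filter (G.Adj v)).card := by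
    rw [← Finset.card_filter]
    congr 1
    ext x
    simp only [Finset.mem_filter, Finset.mem_erase, G.adj_comm x v]
    exact ⟨fun h => ⟨h.1.2, h.2⟩, fun h => ⟨⟨h.2.ne', h.1⟩, h.2⟩⟩
  rw [arcs, ← Finset.sum_erase_add _ _ hv, Finset.sum_congr rfl h1, Finset.sum_add_distrib, h2,
    arcs]
  ring

/-- The neighbours of `U` in `S` outside `U`. -/
noncomputable def nbrs (G : SimpleGraph V) (S U : Finset V) : Finset V :=
  (S \ U).filter fun y => ∃ x ∈ U, G.Adj x y

/-- The edge `e` is routed through the connected set `U`, in which both of its ends have neighbours;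
all other edges are routed inside `N`, away from `U`. -/
theorem HasModel.insert_edge {E : Set (Sym2 W)} {e : Sym2 W} {G : SimpleGraph V} {S U N : Set V}
    (hm : HasModel E G N) (hN : N ⊆ S) (hU : U ⊆ S) (hNU : Disjoint N U)
    (hconn : ∀ x ∈ U, ∀ y ∈ U, ConnIn G U x y) (hadj : ∀ y ∈ N, ∃ x ∈ U, G.Adj x y) :
    HasModel (insert e E) G S := by
  obtain ⟨f, I, hf, hI, hfI, hd, hc⟩ := hm
  refine ⟨f, Function.update I e U, fun w => hN (hf w), fun e' => ?_, fun e' w => ?_, ?_, ?_⟩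
  · by_cases h : e' = e
    · subst h; simpa using hU
    · rw [Function.update_of_ne h]; exact (hI e').trans hN
  · by_cases h : e' = e
    · subst h; simpa using Set.disjoint_left.1 hNU (hf w)
    · rw [Function.update_of_ne h]; exact hfI e' w
  · intro e1 e2 hne
    by_cases h1 : e1 = e
    · subst h1
      rw [Function.update_self, Function.update_of_ne hne.symm]
      exact (hNU.mono_left (hI e2)).symm
    · rw [Function.update_of_ne h1]
      by_cases h2 : e2 = e
      · subst h2
        rw [Function.update_self]
        exact hNU.mono_left (hI e1)
      · rw [Function.update_of_ne h2]
        exact hd _ _ hne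
  · intro u v huv he
    by_cases h : s(u, v) = e
    · rw [h, Function.update_self]
      obtain ⟨a, ha, hau⟩ := hadj _ (hf u)
      obtain ⟨b, hb, hbv⟩ := hadj _ (hf v)
      exact (ConnIn.of_adj hau.symm (by simp) (by simp [ha])).trans
        (((hconn a ha b hb).mono (by simp)).trans (ConnIn.of_adj hbv (by simp [hb]) (by simp)))
    · rw [Function.update_of_ne h]
      exact hc u v huv (he.resolve_left h)

theorem card_le_arcs_of_degree {G : SimpleGraph V} {N : Finset V} {d : ℕ}
    (h : ∀ v ∈ N, d ≤ (N.filter (G.Adj v)).card) : d * N.card ≤ arcs G N := by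
  rw [arcs, mul_comm, ← smul_eq_mul]
  exact Finset.card_nsmul_le_sum _ _ _ h

/-- Graphs of large average degree contain a topological model of every graph on `W`. -/
theorem exists_hasModel_of_dense [Finite W] (E : Finset (Sym2 W)) :
    ∃ d : ℕ, ∀ (V : Type) (G : SimpleGraph V) (S : Finset V), S.Nonempty →
      d * S.card ≤ arcs G S → HasModel (E : Set (Sym2 W)) G S := by
  induction E using Finset.induction_on with
  | empty =>
    have := Fintype.ofFinite W
    -- Without edges to route, any injection of `W` into `S` is a model. Since `arcs G S` is at most
    -- the square of `S.card`, this density provides enough vertices.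
    refine ⟨Fintype.card W, fun V G S hS hd => ?_⟩
    have hcard : Fintype.card W ≤ S.card := by
      by_contra hlt
      have : arcs G S ≤ S.card * S.card := by
        rw [arcs, ← smul_eq_mul]
        exact Finset.sum_le_card_nsmul _ _ _ fun x _ => Finset.card_filter_le _ _
      have h3 := Nat.mul_lt_mul_of_pos_right (not_le.1 hlt) hS.card_pos
      omega
    obtain ⟨g⟩ : Nonempty (W ↪ S) := Function.Embedding.nonempty_of_card_le (by simpa using hcard)
    exact ⟨g.trans (Function.Embedding.subtype _), fun _ => ∅, fun w => (g w).2, by simp, by simp,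
      by simp, by simp⟩
  | insert e E _ ih =>
    obtain ⟨d, hd⟩ := ih
    refine ⟨2 * d + 2, fun V G S => ?_⟩
    induction hn : S.card using Nat.strong_induction_on generalizing S with
    | _ n ihn =>
    intro hS hdS
    -- `S` may be assumed minimal among the dense sets.
    by_cases hsub : ∃ S' ⊂ S, S'.Nonempty ∧ (2 * d + 2) * S'.card ≤ arcs G S'
    · obtain ⟨S', hS', hne, h⟩ := hsub
      exact (ihn _ (hn ▸ Finset.card_lt_card hS') S' rfl hne h).mono (by exact_mod_cast hS'.1)
    push Not at hsub
    -- The last condition says that contracting the connected set `U` to one vertex preserves the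
    -- density `2 * d + 2`. A maximal such `U` will carry the edge `e`, and its neighbourhood the
    -- rest of the model.
    let good : Finset V → Prop := fun U => U.Nonempty ∧
      (∀ x ∈ U, ∀ y ∈ U, ConnIn G (U : Set V) x y) ∧
      (2 * d + 2) * ((S \ U).card + 1) ≤ arcs G (S \ U) + 2 * (nbrs G S U).card
    obtain ⟨v, hv⟩ := hS
    have hgood : good {v} := by
      refine ⟨by simp, ?_, ?_⟩
      · simp only [Finset.mem_singleton, forall_eq]
        exact ConnIn.refl (by simp)
      · have h1 : nbrs G S {v} = S.filter (G.Adj v) := by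
          ext y
          simp only [nbrs, Finset.mem_filter, Finset.mem_sdiff, Finset.mem_singleton,
            exists_eq_left]
          exact ⟨fun h => ⟨h.1.1, h.2⟩, fun h => ⟨⟨h.1, h.2.ne'⟩, h.2⟩⟩
        rw [h1, Finset.sdiff_singleton_eq_erase, ← arcs_erase G hv, Finset.card_erase_add_one hv, hn]
        exact hdS
    obtain ⟨U, hU, hmax⟩ := (S.powerset.filter good).exists_max_image Finset.card
      ⟨{v}, by simp [hgood, hv]⟩
    simp only [Finset.mem_filter, Finset.mem_powerset] at hU hmax
    obtain ⟨hUS, hUne, hUconn, hUd⟩ := hU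
    have hNS : nbrs G S U ⊆ S \ U := Finset.filter_subset _ _
    -- Without neighbours of `U`, the set `S \ U` would itself be dense, against minimality, or
    -- empty.
    have hNne : (nbrs G S U).Nonempty := by
      by_contra hemp
      rw [Finset.not_nonempty_iff_eq_empty] at hemp
      rw [hemp, Finset.card_empty] at hUd
      rcases (S \ U).eq_empty_or_nonempty with h | h
      · rw [h] at hUd
        simp [arcs] at hUd
      · have := hsub (S \ U) (Finset.sdiff_ssubset hUS hUne) h
        nlinarith
    -- Contracting `v` into `U` as well destroys the density, by maximality of `U`, so more than `2
    -- * d + 2` arcs are lost. Two of them join `v` to the contracted vertex; the others come in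
    -- pairs from the neighbours of `v` in `nbrs G S U`.
    have hdeg : ∀ v ∈ nbrs G S U, d ≤ ((nbrs G S U).filter (G.Adj v)).card := by
      intro v hv
      have hvT : v ∈ S \ U := hNS hv
      obtain ⟨hvS, hvU⟩ := Finset.mem_sdiff.1 hvT
      obtain ⟨u, huU, huv⟩ := (Finset.mem_filter.1 hv).2
      have hT : S \ insert v U = (S \ U).erase v := by
        ext y; simp only [Finset.mem_sdiff, Finset.mem_insert, Finset.mem_erase]; tauto
      have hconn' : ∀ x ∈ insert v U, ConnIn G (insert v U : Finset V) x u := by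
        intro x hx
        rcases Finset.mem_insert.1 hx with rfl | hx
        · exact ConnIn.of_adj huv.symm (by simp) (by simp [huU])
        · exact (hUconn x hx u huU).mono (by simp)
      have hnot : ¬ good (insert v U) := by
        intro hg
        have := hmax (insert v U) ⟨Finset.insert_subset hvS hUS, hg⟩
        rw [Finset.card_insert_of_notMem hvU] at this
        omega
      have hlt : arcs G ((S \ U).erase v) + 2 * (nbrs G S (insert v U)).card <
          (2 * d + 2) * (((S \ U).erase v).card + 1) := by
        by_contra hle
        refine hnot ⟨by simp, fun x hx y hy => (hconn' x hx).trans (hconn' y hy).symm, ?_⟩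
        rw [hT]
        exact not_lt.1 hle
      rw [Finset.card_erase_add_one hvT] at hlt
      rw [arcs_erase G hvT] at hUd
      have hsup : (nbrs G S U).erase v ∪ ((S \ U).filter (G.Adj v) \ nbrs G S U) ⊆
          nbrs G S (insert v U) := by
        intro y hy
        rw [Finset.mem_union, Finset.mem_erase, Finset.mem_sdiff, Finset.mem_filter] at hy
        rw [nbrs, hT, Finset.mem_filter, Finset.mem_erase]
        rcases hy with ⟨hyv, hy⟩ | ⟨⟨hy, hvy⟩, -⟩
        · obtain ⟨x, hx, hxy⟩ := (Finset.mem_filter.1 hy).2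
          exact ⟨⟨hyv, hNS hy⟩, x, by simp [hx], hxy⟩
        · exact ⟨⟨hvy.ne', hy⟩, v, by simp, hvy⟩
      have hdis : Disjoint ((nbrs G S U).erase v) ((S \ U).filter (G.Adj v) \ nbrs G S U) :=
        Finset.disjoint_left.2 fun y hy hy' =>
          (Finset.mem_sdiff.1 hy').2 (Finset.mem_of_mem_erase hy)
      have h1 := Finset.card_le_card hsup
      rw [Finset.card_union_of_disjoint hdis] at h1
      have h2 := Finset.card_erase_add_one hv
      have h3 := Finset.card_sdiff_add_card_inter ((S \ U).filter (G.Adj v)) (nbrs G S U)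
      have h4 : (S \ U).filter (G.Adj v) ∩ nbrs G S U = (nbrs G S U).filter (G.Adj v) := by
        ext y
        simp only [Finset.mem_inter, Finset.mem_filter]
        exact ⟨fun h => ⟨h.2, h.1.2⟩, fun h => ⟨⟨hNS h.1, h.2⟩, h.1⟩⟩
      rw [h4] at h3
      nlinarith
    have hm := hd V G _ hNne (card_le_arcs_of_degree hdeg)
    rw [Finset.coe_insert]
    refine hm.insert_edge (U := (U : Set V)) (fun x hx => ?_) (by exact_mod_cast hUS) ?_ hUconn ?_
    · exact (Finset.mem_sdiff.1 (hNS hx)).1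
    · exact Set.disjoint_left.2 fun x hx hxU => (Finset.mem_sdiff.1 (hNS hx)).2 hxU
    · intro y hy
      exact (Finset.mem_filter.1 hy).2

end Structure

section Structure

open scoped Classical

variable {V W : Type*}

/-! ## Routing through disjoint connected sets -/

/-- Through disjoint connected sets off `Z`, as many missing edges between vertices of `Z` are
routed as possible. The graph `R` on `Z` obtained in this way is a topological minor of `G`, and
the neighbourhoods of the sets that were not used are cliques of `R`. -/
theorem exists_routing {G : SimpleGraph V} (hG : ¬ HasModel (Set.univ : Set (Sym2 W)) G Set.univ)
    (Z : Finset V) (𝒞 : Finset (Finset V)) (hZ : ∀ C ∈ 𝒞, Disjoint C Z)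
    (hdisj : ∀ C ∈ 𝒞, ∀ C' ∈ 𝒞, C ≠ C' → Disjoint C C')
    (hconn : ∀ C ∈ 𝒞, ∀ x ∈ C, ∀ y ∈ C, ConnIn G (C : Set V) x y) :
    ∃ (R : SimpleGraph V) (𝒰 : Finset (Finset V)), 𝒰 ⊆ 𝒞 ∧
      ¬ HasModel (Set.univ : Set (Sym2 W)) R (Z : Set V) ∧ 𝒰.card ≤ arcs R Z ∧
      ∀ C ∈ 𝒞, C ∉ 𝒰 → ∀ x ∈ nbrs G Z C, ∀ y ∈ nbrs G Z C, x ≠ y → R.Adj x y := by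
  -- A vertex is needed only to supply irrelevant values of `π` for the empty packing.
  rcases isEmpty_or_nonempty V with hV | hV
  · exact ⟨G, ∅, by simp, fun h => hG (h.mono (Set.subset_univ _)), by simp,
      fun C _ _ x => isEmptyElim x⟩
  -- Every used set is assigned a missing edge between two of its neighbours, and different sets get
  -- different edges.
  let valid : Finset (Finset V) → (Finset V → Sym2 V) → Prop := fun 𝒰 π =>
    (∀ C ∈ 𝒰, ∃ x y, π C = s(x, y) ∧ x ≠ y ∧ x ∈ nbrs G Z C ∧ y ∈ nbrs G Z C ∧ ¬ G.Adj x y) ∧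
    ∀ C ∈ 𝒰, ∀ C' ∈ 𝒰, π C = π C' → C = C'
  have hmax : ∃ 𝒰 ⊆ 𝒞, (∃ π, valid 𝒰 π) ∧ ∀ 𝒰' ⊆ 𝒞, (∃ π, valid 𝒰' π) → 𝒰'.card ≤ 𝒰.card := by
    obtain ⟨𝒰, h𝒰, hmax⟩ := (𝒞.powerset.filter fun 𝒰 => ∃ π, valid 𝒰 π).exists_max_image
      Finset.card ⟨∅, by simpa [valid] using hV.map fun v => s(v, v)⟩
    simp only [Finset.mem_filter, Finset.mem_powerset] at h𝒰 hmax
    exact ⟨𝒰, h𝒰.1, h𝒰.2, fun 𝒰' h h' => hmax 𝒰' ⟨h, h'⟩⟩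
  obtain ⟨𝒰, h𝒰, ⟨π, hπ, hinj⟩, hmax⟩ := hmax
  have hnbr : ∀ C x, x ∈ nbrs G Z C → x ∈ Z ∧ ∃ c ∈ C, G.Adj c x := fun C x hx =>
    ⟨(Finset.mem_sdiff.1 (Finset.mem_filter.1 hx).1).1, (Finset.mem_filter.1 hx).2⟩
  let R : SimpleGraph V :=
    { Adj := fun x y => x ∈ Z ∧ y ∈ Z ∧ (G.Adj x y ∨ x ≠ y ∧ ∃ C ∈ 𝒰, π C = s(x, y))
      symm := ⟨fun x y ⟨hx, hy, h⟩ => ⟨hy, hx, h.imp (fun h => h.symm)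
        fun ⟨h, C, hC, hCe⟩ => ⟨h.symm, C, hC, hCe.trans Sym2.eq_swap⟩⟩⟩
      loopless := ⟨fun x ⟨_, _, h⟩ => h.elim (fun h => h.ne rfl) fun h => h.1 rfl⟩ }
  refine ⟨R, 𝒰, h𝒰, ?_, ?_, ?_⟩
  · rintro ⟨f, I, hf, hI, hfI, hd, hc⟩
    refine hG ?_
    -- An edge `e` of the model in `R` takes over every set `C` whose assigned pair lies in the
    -- region `cl e`, that is, among its ends and inner vertices.
    let cl : Sym2 W → Set V := fun e => {z | z ∈ I e ∨ ∃ w ∈ e, z = f w}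
    let J : Sym2 W → Set V := fun e =>
      I e ∪ {z | ∃ C ∈ 𝒰, z ∈ C ∧ ∀ x ∈ π C, x ∈ cl e}
    have hCZ : ∀ C ∈ 𝒰, ∀ z ∈ C, z ∉ Z := fun C hC z hz =>
      Finset.disjoint_left.1 (hZ C (h𝒰 hC)) hz
    have hcl : ∀ e e' x, e ≠ e' → x ∈ cl e → x ∈ cl e' → ∃ w, w ∈ e ∧ w ∈ e' ∧ x = f w := by
      rintro e e' x hne (hx | ⟨w, hw, rfl⟩) (hx' | ⟨w', hw', h⟩)
      · exact absurd hx' (Set.disjoint_left.1 (hd e e' hne) hx)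
      · exact absurd (h ▸ hx) (hfI e w')
      · exact absurd hx' (hfI _ _)
      · exact ⟨w, hw, f.injective h ▸ hw', rfl⟩
    refine ⟨f, J, fun _ => Set.mem_univ _, fun _ => Set.subset_univ _, ?_, ?_, ?_⟩
    · rintro e w (h | ⟨C, hC, h, -⟩)
      · exact hfI e w h
      · exact hCZ C hC _ h (by exact_mod_cast hf w)
    · intro e e' hne
      rw [Set.disjoint_left]
      rintro z (h | ⟨C, hC, h, hCe⟩) (h' | ⟨C', hC', h', hCe'⟩)
      · exact Set.disjoint_left.1 (hd e e' hne) h h'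
      · exact hCZ C' hC' z h' (by exact_mod_cast hI e h)
      · exact hCZ C hC z h (by exact_mod_cast hI e' h')
      · have hCC : C = C' := by
          by_contra hCC
          exact Finset.disjoint_left.1 (hdisj C (h𝒰 hC) C' (h𝒰 hC') hCC) h h'
        subst hCC
        -- The regions of two edges share only branch vertices of common ends. A pair inside both
        -- regions would give two common ends and force the edges to coincide.
        obtain ⟨x, y, hxy, hne', -⟩ := hπ C hC
        rw [hxy] at hCe hCe'
        obtain ⟨a, ha, ha', rfl⟩ := hcl e e' x hne (hCe x (by simp)) (hCe' x (by simp))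
        obtain ⟨b, hb, hb', rfl⟩ := hcl e e' y hne (hCe y (by simp)) (hCe' y (by simp))
        have hab : a ≠ b := fun h => hne' (h ▸ rfl)
        exact hne (((Sym2.mem_and_mem_iff hab).1 ⟨ha, hb⟩).trans
          ((Sym2.mem_and_mem_iff hab).1 ⟨ha', hb'⟩).symm)
    · intro u v huv _
      have hclJ : ({f u, f v} ∪ I s(u, v) : Set V) ⊆ {f u, f v} ∪ J s(u, v) :=
        Set.union_subset_union_right _ Set.subset_union_left
      have hsub : ({f u, f v} ∪ I s(u, v) : Set V) ⊆ cl s(u, v) := by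
        rintro z ((rfl | rfl) | h)
        · exact Or.inr ⟨u, by simp, rfl⟩
        · exact Or.inr ⟨v, by simp, rfl⟩
        · exact Or.inl h
      refine (hc u v huv (Set.mem_univ _)).bind (by simp) ?_
      rintro a b ha hb ⟨-, -, hab | ⟨hne, C, hC, hCe⟩⟩ -
      · exact ConnIn.of_adj hab (hclJ ha) (hclJ hb)
      · have hCJ : (C : Set V) ⊆ {f u, f v} ∪ J s(u, v) := by
          intro z hz
          refine Or.inr (Or.inr ⟨C, hC, hz, fun x hx => ?_⟩)
          rw [hCe, Sym2.mem_iff] at hx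
          rcases hx with rfl | rfl
          exacts [hsub ha, hsub hb]
        obtain ⟨x, y, hxy, -, hx, hy, -⟩ := hπ C hC
        have hmem : ∀ z ∈ s(a, b), ∃ c ∈ C, G.Adj c z := by
          rw [← hCe, hxy]
          intro z hz
          rcases Sym2.mem_iff.1 hz with rfl | rfl
          exacts [(hnbr _ _ hx).2, (hnbr _ _ hy).2]
        obtain ⟨c, hc, hca⟩ := hmem a (by simp)
        obtain ⟨c', hc', hcb⟩ := hmem b (by simp)
        exact (ConnIn.of_adj hca.symm (hclJ ha) (hCJ hc)).trans
          (((hconn C (h𝒰 hC) c hc c' hc').mono hCJ).trans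
            (ConnIn.of_adj hcb (hCJ hc') (hclJ hb)))
  · choose! p q hpq hne hp hq _ using hπ
    have harcs : arcs R Z = ((Z ×ˢ Z).filter fun e => R.Adj e.1 e.2).card := by
      simp only [Finset.card_filter, Finset.sum_product, arcs]
      exact Finset.sum_congr rfl fun _ _ => Finset.sum_congr rfl fun _ _ => by congr
    rw [harcs]
    refine Finset.card_le_card_of_injOn (fun C => (p C, q C)) (fun C hC => ?_) ?_
    · simp only [Finset.coe_filter, Finset.mem_product, Set.mem_ofPred_eq]
      have h1 := (hnbr _ _ (hp C hC)).1
      have h2 := (hnbr _ _ (hq C hC)).1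
      exact ⟨⟨h1, h2⟩, h1, h2, Or.inr ⟨hne C hC, C, hC, hpq C hC⟩⟩
    · intro C hC C' hC' h
      simp only [Prod.mk.injEq] at h
      exact hinj C hC C' hC' (by rw [hpq C hC, hpq C' hC', h.1, h.2])
  · intro C hC hCU x hx y hy hxy
    refine ⟨(hnbr _ _ hx).1, (hnbr _ _ hy).1, ?_⟩
    -- Otherwise `C` could be added to `𝒰` with the pair `s(x, y)`, which is neither an edge of `G`
    -- nor assigned to another set.
    by_contra hcon
    push Not at hcon
    have := hmax (insert C 𝒰) (Finset.insert_subset hC h𝒰)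
      ⟨Function.update π C s(x, y), ?_, ?_⟩
    · rw [Finset.card_insert_of_notMem hCU] at this
      omega
    · intro D hD
      rcases Finset.mem_insert.1 hD with rfl | hD
      · exact ⟨x, y, by simp, hxy, hx, hy, hcon.1⟩
      · rw [Function.update_of_ne (ne_of_mem_of_not_mem hD hCU)]
        exact hπ D hD
    · intro D hD D' hD' h
      rcases Finset.mem_insert.1 hD with rfl | hDU <;> rcases Finset.mem_insert.1 hD' with rfl | hDU'
      · rfl
      · rw [Function.update_self, Function.update_of_ne (ne_of_mem_of_not_mem hDU' hCU)] at h
        exact absurd h.symm (hcon.2 hxy D' hDU')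
      · rw [Function.update_self, Function.update_of_ne (ne_of_mem_of_not_mem hDU hCU)] at h
        exact absurd h (hcon.2 hxy D hDU)
      · rw [Function.update_of_ne (ne_of_mem_of_not_mem hDU hCU),
          Function.update_of_ne (ne_of_mem_of_not_mem hDU' hCU)] at h
        exact hinj D hDU D' hDU' h

/-- The vertices in `K` are pairwise adjacent. -/
def Complete (R : SimpleGraph V) (K : Finset V) : Prop :=
  ∀ x ∈ K, ∀ y ∈ K, x ≠ y → R.Adj x y

/-- Sparse graphs have linearly many cliques. -/
theorem card_cliques_le {R : SimpleGraph V} {α : ℕ} (Z : Finset V)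
    (h : ∀ S ⊆ Z, arcs R S ≤ α * S.card) :
    (Z.powerset.filter (Complete R)).card ≤
      2 ^ α * Z.card + 1 := by
  induction hn : Z.card generalizing Z with
  | zero =>
    rw [Finset.card_eq_zero] at hn
    subst hn
    exact (Finset.card_filter_le _ _).trans (by simp)
  | succ n ih =>
    have hne : Z.Nonempty := Finset.card_pos.1 (by omega)
    -- Averaging gives a vertex of degree at most `α`. The cliques avoiding it are counted by
    -- induction, and a clique through it is determined by a set of its neighbours.
    obtain ⟨v, hv, hdeg⟩ : ∃ v ∈ Z, (Z.filter (R.Adj v)).card ≤ α := by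
      refine Finset.exists_le_of_sum_le hne (g := fun _ => α) ?_
      rw [Finset.sum_const, smul_eq_mul, mul_comm]
      exact h Z subset_rfl
    have h1 := ih (Z.erase v) (fun S hS => h S (hS.trans (Finset.erase_subset _ _)))
      (by rw [Finset.card_erase_of_mem hv]; omega)
    have hsub : (Z.powerset.filter (Complete R)) ⊆
        ((Z.erase v).powerset.filter (Complete R)) ∪
          ((Z.filter (R.Adj v)).powerset.image (insert v)) := by
      intro K hK
      rw [Finset.mem_filter, Finset.mem_powerset] at hK
      rw [Finset.mem_union]
      by_cases hvK : v ∈ K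
      · refine Or.inr (Finset.mem_image.2 ⟨K.erase v, ?_, Finset.insert_erase hvK⟩)
        rw [Finset.mem_powerset]
        intro x hx
        obtain ⟨hxv, hx⟩ := Finset.mem_erase.1 hx
        exact Finset.mem_filter.2 ⟨hK.1 hx, hK.2 v hvK x hx hxv.symm⟩
      · refine Or.inl (Finset.mem_filter.2 ⟨?_, hK.2⟩)
        rw [Finset.mem_powerset]
        exact fun x hx => Finset.mem_erase.2 ⟨fun h => hvK (h ▸ hx), hK.1 hx⟩
    have h2 : ((Z.filter (R.Adj v)).powerset.image (insert v)).card ≤ 2 ^ α :=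
      Finset.card_image_le.trans (by
        rw [Finset.card_powerset]; exact Nat.pow_le_pow_right (by norm_num) hdeg)
    have h3 := (Finset.card_le_card hsub).trans (Finset.card_union_le _ _)
    rw [mul_add, mul_one]
    omega

theorem nbrs_subset (G : SimpleGraph V) (Z C : Finset V) : nbrs G Z C ⊆ Z :=
  (Finset.filter_subset _ _).trans Finset.sdiff_subset

/-- In a graph without a topological model of the complete graph on `W`, all but linearly many of
disjoint connected sets have small neighbourhoods in `Z`, and these are only linearly many. -/
theorem exists_packing [Fintype W] {α : ℕ} {G : SimpleGraph V}
    (hα : ∀ (R : SimpleGraph V) (S : Finset V), S.Nonempty → α * S.card ≤ arcs R S →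
      HasModel (Set.univ : Set (Sym2 W)) R S)
    (hG : ¬ HasModel (Set.univ : Set (Sym2 W)) G Set.univ)
    (Z : Finset V) (𝒞 : Finset (Finset V)) (hZ : ∀ C ∈ 𝒞, Disjoint C Z)
    (hdisj : ∀ C ∈ 𝒞, ∀ C' ∈ 𝒞, C ≠ C' → Disjoint C C')
    (hconn : ∀ C ∈ 𝒞, ∀ x ∈ C, ∀ y ∈ C, ConnIn G (C : Set V) x y) :
    ∃ 𝒰 ⊆ 𝒞, 𝒰.card ≤ α * Z.card ∧
      (∀ C ∈ 𝒞 \ 𝒰, (nbrs G Z C).card < Fintype.card W) ∧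
      ((𝒞 \ 𝒰).image (nbrs G Z)).card ≤ 2 ^ α * Z.card + 1 := by
  obtain ⟨R, 𝒰, h𝒰, hR, hcard, hclique⟩ := exists_routing hG Z 𝒞 hZ hdisj hconn
  have hsparse : ∀ S ⊆ Z, arcs R S ≤ α * S.card := by
    intro S hS
    rcases S.eq_empty_or_nonempty with rfl | hne
    · simp [arcs]
    · by_contra hlt
      exact hR ((hα R S hne (by omega)).mono (by exact_mod_cast hS))
  refine ⟨𝒰, h𝒰, hcard.trans (hsparse Z subset_rfl), fun C hC => ?_,
    le_trans (Finset.card_le_card ?_) (card_cliques_le Z hsparse)⟩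
  · obtain ⟨hC, hCU⟩ := Finset.mem_sdiff.1 hC
    by_contra hle
    -- The neighbours of an unused set are pairwise adjacent in `R`, so `Fintype.card W` of them
    -- form a model without inner vertices.
    obtain ⟨g⟩ : Nonempty (W ↪ nbrs G Z C) :=
      Function.Embedding.nonempty_of_card_le (by simpa using hle)
    refine hR ⟨g.trans (Function.Embedding.subtype _), fun _ => ∅, fun w => nbrs_subset _ _ _ (g w).2,
      by simp, by simp, by simp, fun u v huv _ => ConnIn.of_adj ?_ (by simp) (by simp)⟩
    exact hclique C hC hCU _ (g u).2 _ (g v).2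
      fun h => huv (g.injective (Subtype.ext h))
  · intro K hK
    obtain ⟨C, hC, rfl⟩ := Finset.mem_image.1 hK
    obtain ⟨hC, hCU⟩ := Finset.mem_sdiff.1 hC
    exact Finset.mem_filter.2 ⟨Finset.mem_powerset.2 (nbrs_subset _ _ _), hclique C hC hCU⟩

end Structure

section Structure

open scoped Classical

variable {V : Type*}

/-! ## Tree-decompositions, inductively -/

/-- `S` is the union of the bags of a rooted tree-decomposition with root bag `B`, all of whose
bags have at most `w` vertices, of the subgraph of `G` induced by `S`. -/
inductive Decomp (G : SimpleGraph V) (w : ℕ) : Finset V → Finset V → Prop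
  | leaf (B : Finset V) : B.card ≤ w → Decomp G w B B
  | attach (S₁ B₁ S₂ B₂ : Finset V) : Decomp G w S₁ B₁ → Decomp G w S₂ B₂ →
      S₁ ∩ S₂ ⊆ B₁ → S₁ ∩ S₂ ⊆ B₂ → (∀ u ∈ S₁, u ∉ S₂ → ∀ v ∈ S₂, v ∉ S₁ → ¬ G.Adj u v) →
      Decomp G w (S₁ ∪ S₂) B₁

theorem Decomp.card_le {G : SimpleGraph V} {w : ℕ} {S B : Finset V} (h : Decomp G w S B) :
    B.card ≤ w := by
  induction h with
  | leaf B h => exact h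
  | attach _ _ _ _ _ _ _ _ _ ih _ => exact ih

/-- For a bridge between `x` and `z`, a connected set of nodes that meets both sides contains both
ends. It is applied to the nodes whose bags contain a given vertex. -/
theorem ConnIn.crossing {N : Type*} {T : SimpleGraph N} {I : Set N} {side : N → Prop} {x z i j : N}
    (hside : ∀ a b, T.Adj a b → side a → ¬ side b → a = x ∧ b = z)
    (h : ConnIn T I i j) (hi : side i) (hj : ¬ side j) : x ∈ I ∧ z ∈ I := by
  by_contra hcon
  refine hj (h.induct hi fun a b ha hb hab hsa => ?_)
  by_contra hsb
  obtain ⟨rfl, rfl⟩ := hside a b hab hsa hsb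
  exact hcon ⟨ha, hb⟩

/-- From a connection to `x`, the part on the side of `x` of a bridge at `x`. -/
theorem ConnIn.restrict {N : Type*} {T : SimpleGraph N} {I : Set N} {side : N → Prop} {x i y : N}
    (hside : ∀ a b, T.Adj a b → side a → ¬ side b → a = x)
    (h : ConnIn T I i y) (hi : side i) (hy : side y → y = x) : ConnIn T (I ∩ {a | side a}) i x := by
  obtain ⟨p, hp⟩ := h
  induction p with
  | nil =>
    obtain rfl := hy hi
    exact ConnIn.refl ⟨hp _ (by simp), hi⟩
  | @cons a b c hab p ih =>
    have ha : a ∈ I := hp _ (by simp)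
    by_cases hb : side b
    · exact ConnIn.trans (ConnIn.of_adj hab ⟨ha, hi⟩ ⟨hp _ (by simp), hb⟩)
        (ih hb hy fun z hz => hp z (by simp [hz]))
    · obtain rfl := hside a b hab hi hb
      exact ConnIn.refl ⟨ha, hi⟩

/-- A tree edge from the root `x` to some `z` in `T` is a bridge and splits `T` into two smaller
subtrees, rooted at `x` and `z`. A vertex in bags on both sides lies in `D.bag x` and `D.bag z`, as
`Decomp.attach` demands. -/
theorem TreeDecomposition.decomp_subtree {G : SimpleGraph V} [Fintype V] (D : TreeDecomposition G)
    {w : ℕ} (hw : ∀ i, (D.bag i).ncard ≤ w) (T : Finset D.Node) (x : D.Node) (hx : x ∈ T)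
    (hT : ∀ i ∈ T, ConnIn D.tree (T : Set D.Node) i x) :
    Decomp G w (T.biUnion fun i => (D.bag i).toFinset) (D.bag x).toFinset := by
  induction hn : T.card using Nat.strong_induction_on generalizing T x with
  | _ n ih =>
  subst hn
  by_cases hone : T = {x}
  · subst hone
    rw [Finset.singleton_biUnion]
    exact .leaf _ (by rw [← Set.ncard_eq_toFinset_card']; exact hw x)
  obtain ⟨i, hi, hix⟩ : ∃ i ∈ T, i ≠ x := by
    by_contra hcon
    push Not at hcon
    exact hone (Finset.eq_singleton_iff_unique_mem.2 ⟨hx, hcon⟩)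
  obtain ⟨z, hz, hxz⟩ : ∃ z ∈ T, D.tree.Adj x z := by
    obtain ⟨p, hp⟩ := (hT i hi).symm
    cases p with
    | nil => exact absurd rfl hix
    | @cons _ z _ hxz p => exact ⟨z, hp z (by simp), hxz⟩
  let side : D.Node → Prop := fun i => (D.tree.deleteEdges {s(x, z)}).Reachable x i
  have hsx : side x := SimpleGraph.Reachable.refl _
  have hsz : ¬ side z :=
    SimpleGraph.isBridge_iff.1 (SimpleGraph.isAcyclic_iff_forall_adj_isBridge.1 D.isTree.2 hxz)
  have hcross : ∀ a b, D.tree.Adj a b → side a → ¬ side b → a = x ∧ b = z := by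
    intro a b hab ha hb
    have : s(a, b) = s(x, z) := by
      by_contra hne
      exact hb (ha.trans (SimpleGraph.Adj.reachable (by simp [hab, hne])))
    rcases Sym2.eq_iff.1 this with h | ⟨rfl, rfl⟩
    · exact h
    · exact absurd ha hsz
  have hcross' : ∀ a b, D.tree.Adj a b → ¬ side a → ¬ ¬ side b → a = z := fun a b hab ha hb =>
    (hcross b a hab.symm (not_not.1 hb) ha).2
  have hnode : ∀ v i j, v ∈ D.bag i → v ∈ D.bag j → side i → ¬ side j →
      v ∈ D.bag x ∧ v ∈ D.bag z := fun v i j hi hj hsi hsj =>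
    ConnIn.crossing hcross (ConnIn.of_induce ((D.subtree v).preconnected ⟨i, hi⟩ ⟨j, hj⟩)) hsi hsj
  have hT1 : x ∈ T.filter side := Finset.mem_filter.2 ⟨hx, hsx⟩
  have hT2 : z ∈ T.filter fun i => ¬ side i := Finset.mem_filter.2 ⟨hz, hsz⟩
  have hsplit : T = T.filter side ∪ T.filter fun i => ¬ side i :=
    (Finset.filter_union_filter_not_eq _ _).symm
  have hcard := Finset.card_filter_add_card_filter_not (s := T) side
  have hpos1 := Finset.card_pos.2 ⟨x, hT1⟩
  have hpos2 := Finset.card_pos.2 ⟨z, hT2⟩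
  have h1 := ih _ (by omega) (T.filter side) x hT1 (fun i hi => by
    obtain ⟨hi, hsi⟩ := Finset.mem_filter.1 hi
    have := ConnIn.restrict (fun a b h h1 h2 => (hcross a b h h1 h2).1) (hT i hi) hsi
      (fun _ => rfl)
    simpa [Set.inter_def] using this) rfl
  have h2 := ih _ (by omega) (T.filter fun i => ¬ side i) z hT2 (fun i hi => by
    obtain ⟨hi, hsi⟩ := Finset.mem_filter.1 hi
    -- A connection to `x` leaves the far side through the bridge, so its initial part ends in `z`.
    have := ConnIn.restrict (side := fun i => ¬ side i) hcross' (hT i hi) hsi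
      (fun h => absurd hsx h)
    simpa [Set.inter_def] using this) rfl
  rw [hsplit, Finset.union_biUnion]
  have hmem1 : ∀ v, v ∈ (T.filter side).biUnion (fun i => (D.bag i).toFinset) ↔
      ∃ i ∈ T, side i ∧ v ∈ D.bag i := by
    intro v; simp [and_assoc]
  have hmem2 : ∀ v, v ∈ (T.filter fun i => ¬ side i).biUnion (fun i => (D.bag i).toFinset) ↔
      ∃ i ∈ T, ¬ side i ∧ v ∈ D.bag i := by
    intro v; simp [and_assoc]
  have hint : ∀ v, v ∈ (T.filter side).biUnion (fun i => (D.bag i).toFinset) ∩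
      (T.filter fun i => ¬ side i).biUnion (fun i => (D.bag i).toFinset) →
      v ∈ D.bag x ∧ v ∈ D.bag z := by
    intro v hv
    rw [Finset.mem_inter, hmem1, hmem2] at hv
    obtain ⟨⟨i, -, hsi, hvi⟩, j, -, hsj, hvj⟩ := hv
    exact hnode v i j hvi hvj hsi hsj
  refine .attach _ _ _ _ h1 h2 (fun v hv => by simpa using (hint v hv).1)
    (fun v hv => by simpa using (hint v hv).2) ?_
  intro u hu hu2 v hv hv1 huv
  rw [hmem1] at hu hv1
  rw [hmem2] at hv hu2
  obtain ⟨i, -, hsi, hui⟩ := hu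
  obtain ⟨j, -, hsj, hvj⟩ := hv
  obtain ⟨k, huk, hvk⟩ := D.cover_edge u v huv
  by_cases hk : side k
  · exact hv1 ⟨x, hx, hsx, (hnode v k j hvk hvj hk hsj).1⟩
  · exact hu2 ⟨z, hz, hsz, (hnode u i k hui huk hsi hk).2⟩

theorem TreewidthLE.decomp {G : SimpleGraph V} [Fintype V] {t : ℕ} (h : TreewidthLE G t) :
    ∃ B, Decomp G (t + 1) Finset.univ B := by
  obtain ⟨D, hD⟩ := h
  have := D.finite
  have := Fintype.ofFinite D.Node
  obtain ⟨x⟩ := D.isTree.1.nonempty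
  refine ⟨(D.bag x).toFinset, ?_⟩
  have := D.decomp_subtree hD Finset.univ x (by simp) fun i _ => by
    obtain ⟨p⟩ := D.isTree.1.preconnected i x
    exact ⟨p, by simp⟩
  convert this
  ext v
  simpa using D.cover v

/-! ## Fragmentation -/

/-- A fragmentation in progress: `Y` is the set of removed vertices, `O` is the current open piece,
attached to `D ⊆ Y`; the other vertices are in closed pieces. -/
structure Frag (G : SimpleGraph V) (w K J : ℕ) (S B Y O D : Finset V) (m : ℕ) : Prop where
  Y_sub : Y ⊆ S
  O_sub : O ⊆ S
  disj : Disjoint O Y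
  D_sub : D ⊆ Y
  D_card : D.card ≤ w
  O_card : O.card ≤ K
  B_sub : B ⊆ O ∪ D
  O_adj : ∀ v ∈ O, ∀ u ∈ S, G.Adj v u → u ∈ O ∪ D
  closed : ∀ v ∈ S, v ∉ O → v ∉ Y → ∃ C N : Finset V, v ∈ C ∧ C ⊆ S ∧ Disjoint C Y ∧
    Disjoint C O ∧ C.card ≤ K ∧ N ⊆ Y ∧ N.card ≤ 2 * w ∧
    ∀ c ∈ C, ∀ u ∈ S, G.Adj c u → u ∈ C ∪ N
  Y_card : Y.card ≤ w * m
  -- An amortised count: each of the `m` marked bags costs `J`, another `J` is in reserve while the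
  -- open piece is attached to a marked bag, and every closed vertex contributes two.
  charge : (m + if D = ∅ then 0 else 1) * J ≤ 2 * (S \ (O ∪ Y)).card

/-- Closed vertices of either part avoid the other part and remain closed. This and the next two
lemmas supply the cardinalities for `charge`. -/
theorem closed_subset_keep {S₁ S₂ O₁ O₂ Y₁ Y₂ : Finset V}
    (h₁ : ∀ v ∈ S₁, v ∉ O₁ → v ∉ Y₁ → v ∉ S₂) (h₂ : ∀ v ∈ S₂, v ∉ O₂ → v ∉ Y₂ → v ∉ S₁)
    (hY₁ : Y₁ ⊆ S₁) (hY₂ : Y₂ ⊆ S₂) (hO₁ : O₁ ⊆ S₁) (hO₂ : O₂ ⊆ S₂) :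
    (S₁ \ (O₁ ∪ Y₁)) ∪ (S₂ \ (O₂ ∪ Y₂)) ⊆
      (S₁ ∪ S₂) \ ((O₁ ∪ O₂) \ (Y₁ ∪ Y₂) ∪ (Y₁ ∪ Y₂)) := by
  intro v hv
  have := h₁ v; have := h₂ v; have := @hY₁ v; have := @hY₂ v; have := @hO₁ v; have := @hO₂ v
  simp only [Finset.mem_union, Finset.mem_sdiff] at hv ⊢
  grind

/-- When `B` is marked, the open vertices outside `B` become closed and add to the count. -/
theorem closed_subset_mark {S₁ S₂ O₁ O₂ Y₁ Y₂ B : Finset V}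
    (h₁ : ∀ v ∈ S₁, v ∉ O₁ → v ∉ Y₁ → v ∉ S₂) (h₂ : ∀ v ∈ S₂, v ∉ O₂ → v ∉ Y₂ → v ∉ S₁)
    (hY₁ : Y₁ ⊆ S₁) (hY₂ : Y₂ ⊆ S₂) (hO₁ : O₁ ⊆ S₁) (hO₂ : O₂ ⊆ S₂)
    (hB : ∀ v ∈ B, v ∈ S₁) (hB' : ∀ v ∈ B, v ∈ O₁ ∨ v ∈ Y₁) :
    (S₁ \ (O₁ ∪ Y₁)) ∪ (S₂ \ (O₂ ∪ Y₂)) ∪ (((O₁ ∪ O₂) \ (Y₁ ∪ Y₂)) \ B) ⊆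
      (S₁ ∪ S₂) \ (∅ ∪ (Y₁ ∪ Y₂ ∪ B)) := by
  intro v hv
  have := h₁ v; have := h₂ v; have := @hY₁ v; have := @hY₂ v; have := @hO₁ v; have := @hO₂ v
  have := hB v; have := hB' v
  simp only [Finset.mem_union, Finset.mem_sdiff, Finset.notMem_empty, false_or] at hv ⊢
  grind

theorem closed_disjoint_open {S₁ S₂ O₁ O₂ Y₁ Y₂ B : Finset V}
    (h₁ : ∀ v ∈ S₁, v ∉ O₁ → v ∉ Y₁ → v ∉ S₂) (h₂ : ∀ v ∈ S₂, v ∉ O₂ → v ∉ Y₂ → v ∉ S₁)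
    (hO₁ : O₁ ⊆ S₁) (hO₂ : O₂ ⊆ S₂) :
    Disjoint ((S₁ \ (O₁ ∪ Y₁)) ∪ (S₂ \ (O₂ ∪ Y₂))) (((O₁ ∪ O₂) \ (Y₁ ∪ Y₂)) \ B) := by
  refine Finset.disjoint_left.2 fun v hv hv' => ?_
  have := h₁ v; have := h₂ v; have := @hO₁ v; have := @hO₂ v
  simp only [Finset.mem_union, Finset.mem_sdiff] at hv hv'
  grind

/-- The open piece with its attachments, after two open pieces have been joined. -/
theorem open_subset_keep {O O' D D' Y Y' : Finset V} (hO : ∀ v ∈ O, v ∉ Y)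
    (hO' : ∀ v ∈ O, v ∈ Y' → v ∈ O' ∨ v ∈ D') (hdis : ∀ v ∈ O', v ∉ Y') (v : V)
    (hv : v ∈ O ∪ D) : (v ∈ O ∨ v ∈ O') ∧ ¬ (v ∈ Y ∨ v ∈ Y') ∨ v ∈ D ∨ v ∈ D' := by
  have := hO v; have := hO' v; have := hdis v
  rw [Finset.mem_union] at hv
  tauto

-- Two open pieces that meet are merged, unless the result exceeds `K` vertices or both are attached
-- to marked bags already. In these cases the root bag `B₁` is marked and both pieces are closed. So
-- an open piece is attached to at most one marked bag and a closed one to at most two, whence the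
-- bound `2 * w`. Marking needs `2 * J`, for the bag and for the reserve of the new, empty open
-- piece: either two attached pieces have it in reserve, or at least `J` open vertices become closed
-- and contribute two each.
set_option maxHeartbeats 1000000 in
theorem Decomp.exists_frag {G : SimpleGraph V} {w K J : ℕ} (hwK : w ≤ K) (hJ : J + w ≤ K + 1)
    {S B : Finset V} (h : Decomp G w S B) : ∃ Y O D m, Frag G w K J S B Y O D m := by
  induction h with
  | leaf B hB =>
    exact ⟨∅, B, ∅, 0, by simp, by simp, by simp, by simp, by simp, hB.trans hwK, by simp,
      fun v _ u hu _ => by simp [hu], fun v hv hv' => absurd hv hv', by simp, by simp⟩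
  | attach S₁ B₁ S₂ B₂ hd₁ hd₂ hB₁ hB₂ hadj ih₁ ih₂ =>
    obtain ⟨Y₁, O₁, D₁, m₁, F₁⟩ := ih₁
    obtain ⟨Y₂, O₂, D₂, m₂, F₂⟩ := ih₂
    have hB₁' : ∀ v ∈ S₁, v ∈ S₂ → v ∈ B₁ := fun v h h' => hB₁ (Finset.mem_inter.2 ⟨h, h'⟩)
    have hB₂' : ∀ v ∈ S₁, v ∈ S₂ → v ∈ B₂ := fun v h h' => hB₂ (Finset.mem_inter.2 ⟨h, h'⟩)
    have hBOY₁ : ∀ v ∈ B₁, v ∈ O₁ ∨ v ∈ D₁ := fun v h => Finset.mem_union.1 (F₁.B_sub h)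
    have hBOY₂ : ∀ v ∈ B₂, v ∈ O₂ ∨ v ∈ D₂ := fun v h => Finset.mem_union.1 (F₂.B_sub h)
    -- Vertices common to both parts lie in the root bags, hence in the open pieces or their
    -- attachments; a closed vertex therefore belongs to one part only.
    have hcl₁ : ∀ v ∈ S₁, v ∉ O₁ → v ∉ Y₁ → v ∉ S₂ := fun v h hO hY h' =>
      (hBOY₁ v (hB₁' v h h')).elim hO fun h => hY (F₁.D_sub h)
    have hcl₂ : ∀ v ∈ S₂, v ∉ O₂ → v ∉ Y₂ → v ∉ S₁ := fun v h hO hY h' =>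
      (hBOY₂ v (hB₂' v h' h)).elim hO fun h => hY (F₂.D_sub h)
    have hdis₁ : ∀ v ∈ O₁, v ∉ Y₁ := fun v h h' => Finset.disjoint_left.1 F₁.disj h h'
    have hdis₂ : ∀ v ∈ O₂, v ∉ Y₂ := fun v h h' => Finset.disjoint_left.1 F₂.disj h h'
    have hB₁S : ∀ v ∈ B₁, v ∈ S₁ := fun v h =>
      (hBOY₁ v h).elim (fun h => F₁.O_sub h) fun h => F₁.Y_sub (F₁.D_sub h)
    -- closed vertices remain in closed pieces, whatever is marked in `Y₁ ∪ Y₂ ∪ B₁`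
    have hclosed : ∀ v ∈ S₁ ∪ S₂, v ∉ O₁ → v ∉ O₂ → v ∉ Y₁ ∪ Y₂ → ∃ C N : Finset V, v ∈ C ∧
        C ⊆ S₁ ∪ S₂ ∧ Disjoint C (Y₁ ∪ Y₂ ∪ B₁) ∧ Disjoint C (O₁ ∪ O₂) ∧ C.card ≤ K ∧
        N ⊆ Y₁ ∪ Y₂ ∧ N.card ≤ 2 * w ∧ ∀ c ∈ C, ∀ u ∈ S₁ ∪ S₂, G.Adj c u → u ∈ C ∪ N := by
      intro v hv hvO₁ hvO₂ hvY
      rw [Finset.mem_union, not_or] at hvY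
      rcases Finset.mem_union.1 hv with hv | hv
      · obtain ⟨C, N, hvC, hCS, hCY, hCO, hCK, hNY, hNw, hC⟩ := F₁.closed v hv hvO₁ hvY.1
        have hC₂ : ∀ c ∈ C, c ∉ S₂ := fun c hc => hcl₁ c (hCS hc)
          (Finset.disjoint_left.1 hCO hc) (Finset.disjoint_left.1 hCY hc)
        refine ⟨C, N, hvC, hCS.trans Finset.subset_union_left, ?_, ?_, hCK,
          hNY.trans Finset.subset_union_left, hNw, fun c hc u hu hcu => ?_⟩
        · refine Finset.disjoint_left.2 fun c hc hc' => ?_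
          rcases Finset.mem_union.1 hc' with hc' | hc'
          · rcases Finset.mem_union.1 hc' with hc' | hc'
            exacts [Finset.disjoint_left.1 hCY hc hc', hC₂ c hc (F₂.Y_sub hc')]
          · exact (hBOY₁ c hc').elim (Finset.disjoint_left.1 hCO hc)
              fun h => Finset.disjoint_left.1 hCY hc (F₁.D_sub h)
        · refine Finset.disjoint_left.2 fun c hc hc' => ?_
          rcases Finset.mem_union.1 hc' with hc' | hc'
          exacts [Finset.disjoint_left.1 hCO hc hc', hC₂ c hc (F₂.O_sub hc')]
        · by_cases hu₁ : u ∈ S₁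
          · exact hC c hc u hu₁ hcu
          · exact absurd hcu (hadj c (hCS hc) (hC₂ c hc) u
              ((Finset.mem_union.1 hu).resolve_left hu₁) hu₁)
      · obtain ⟨C, N, hvC, hCS, hCY, hCO, hCK, hNY, hNw, hC⟩ := F₂.closed v hv hvO₂ hvY.2
        have hC₁ : ∀ c ∈ C, c ∉ S₁ := fun c hc => hcl₂ c (hCS hc)
          (Finset.disjoint_left.1 hCO hc) (Finset.disjoint_left.1 hCY hc)
        refine ⟨C, N, hvC, hCS.trans Finset.subset_union_right, ?_, ?_, hCK,
          hNY.trans Finset.subset_union_right, hNw, fun c hc u hu hcu => ?_⟩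
        · refine Finset.disjoint_left.2 fun c hc hc' => ?_
          rcases Finset.mem_union.1 hc' with hc' | hc'
          · rcases Finset.mem_union.1 hc' with hc' | hc'
            exacts [hC₁ c hc (F₁.Y_sub hc'), Finset.disjoint_left.1 hCY hc hc']
          · exact hC₁ c hc (hB₁S c hc')
        · refine Finset.disjoint_left.2 fun c hc hc' => ?_
          rcases Finset.mem_union.1 hc' with hc' | hc'
          exacts [hC₁ c hc (F₁.O_sub hc'), Finset.disjoint_left.1 hCO hc hc']
        · by_cases hu₂ : u ∈ S₂
          · exact hC c hc u hu₂ hcu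
          · exact absurd hcu.symm (hadj u ((Finset.mem_union.1 hu).resolve_right hu₂) hu₂ c
              (hCS hc) (hC₁ c hc))
    have hcount : Disjoint (S₁ \ (O₁ ∪ Y₁)) (S₂ \ (O₂ ∪ Y₂)) := by
      refine Finset.disjoint_left.2 fun v h h' => ?_
      rw [Finset.mem_sdiff, Finset.mem_union, not_or] at h h'
      exact hcl₁ v h.1 h.2.1 h.2.2 h'.1
    have hY : (Y₁ ∪ Y₂).card ≤ w * (m₁ + m₂) := by
      rw [mul_add]
      exact (Finset.card_union_le _ _).trans (add_le_add F₁.Y_card F₂.Y_card)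
    have hch₁ := F₁.charge
    have hch₂ := F₂.charge
    by_cases hkeep : ((O₁ ∪ O₂) \ (Y₁ ∪ Y₂)).card ≤ K ∧ (D₁ = ∅ ∨ D₂ = ∅)
    · obtain ⟨hK, hD⟩ := hkeep
      have hDcard : (D₁ ∪ D₂).card ≤ w := by
        rcases hD with h | h
        · rw [h, Finset.empty_union]; exact F₂.D_card
        · rw [h, Finset.union_empty]; exact F₁.D_card
      have hDY : D₁ ∪ D₂ ⊆ Y₁ ∪ Y₂ := Finset.union_subset_union F₁.D_sub F₂.D_sub
      have hkey₁ : ∀ v, v ∈ O₁ ∪ D₁ → v ∈ (O₁ ∪ O₂) \ (Y₁ ∪ Y₂) ∪ (D₁ ∪ D₂) := by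
        intro v hv
        simp only [Finset.mem_union (s := _ \ _), Finset.mem_sdiff, Finset.mem_union (s := O₁)
          (t := O₂), Finset.mem_union (s := Y₁), Finset.mem_union (s := D₁) (t := D₂)]
        exact open_subset_keep hdis₁
          (fun v h h' => hBOY₂ v (hB₂' v (F₁.O_sub h) (F₂.Y_sub h'))) hdis₂ v hv
      have hkey₂ : ∀ v, v ∈ O₂ ∪ D₂ → v ∈ (O₁ ∪ O₂) \ (Y₁ ∪ Y₂) ∪ (D₁ ∪ D₂) := by
        intro v hv
        rw [Finset.union_comm O₁, Finset.union_comm Y₁, Finset.union_comm D₁]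
        simp only [Finset.mem_union (s := _ \ _), Finset.mem_sdiff, Finset.mem_union (s := O₂)
          (t := O₁), Finset.mem_union (s := Y₂), Finset.mem_union (s := D₂) (t := D₁)]
        exact open_subset_keep hdis₂
          (fun v h h' => hBOY₁ v (hB₁' v (F₁.Y_sub h') (F₂.O_sub h))) hdis₁ v hv
      refine ⟨Y₁ ∪ Y₂, (O₁ ∪ O₂) \ (Y₁ ∪ Y₂), D₁ ∪ D₂, m₁ + m₂,
        Finset.union_subset_union F₁.Y_sub F₂.Y_sub,
        Finset.sdiff_subset.trans (Finset.union_subset_union F₁.O_sub F₂.O_sub),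
        Finset.sdiff_disjoint, hDY, hDcard, hK, fun v hv => hkey₁ v (F₁.B_sub hv), ?_, ?_, hY, ?_⟩
      · intro v hv u hu hvu
        obtain ⟨hvO, hvY⟩ := Finset.mem_sdiff.1 hv
        rw [Finset.mem_union, not_or] at hvY
        have hO₁ : v ∈ S₁ → v ∈ S₂ → v ∈ O₁ := fun h h' =>
          (hBOY₁ v (hB₁' v h h')).resolve_right fun h => hvY.1 (F₁.D_sub h)
        have hO₂ : v ∈ S₁ → v ∈ S₂ → v ∈ O₂ := fun h h' =>
          (hBOY₂ v (hB₂' v h h')).resolve_right fun h => hvY.2 (F₂.D_sub h)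
        by_cases hv₁ : v ∈ S₁ <;> by_cases hv₂ : v ∈ S₂
        · rcases Finset.mem_union.1 hu with hu | hu
          · exact hkey₁ u (F₁.O_adj v (hO₁ hv₁ hv₂) u hu hvu)
          · exact hkey₂ u (F₂.O_adj v (hO₂ hv₁ hv₂) u hu hvu)
        · have hvO₁ : v ∈ O₁ := (Finset.mem_union.1 hvO).resolve_right fun h => hv₂ (F₂.O_sub h)
          by_cases hu₁ : u ∈ S₁
          · exact hkey₁ u (F₁.O_adj v hvO₁ u hu₁ hvu)
          · exact absurd hvu (hadj v hv₁ hv₂ u ((Finset.mem_union.1 hu).resolve_left hu₁) hu₁)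
        · have hvO₂ : v ∈ O₂ := (Finset.mem_union.1 hvO).resolve_left fun h => hv₁ (F₁.O_sub h)
          by_cases hu₂ : u ∈ S₂
          · exact hkey₂ u (F₂.O_adj v hvO₂ u hu₂ hvu)
          · exact absurd hvu.symm
              (hadj u ((Finset.mem_union.1 hu).resolve_right hu₂) hu₂ v hv₂ hv₁)
        · exact (Finset.mem_union.1 hvO).elim (fun h => absurd (F₁.O_sub h) hv₁)
            fun h => absurd (F₂.O_sub h) hv₂
      · intro v hv hvO hvY
        rw [Finset.mem_sdiff, not_and, not_not] at hvO
        obtain ⟨C, N, hvC, hCS, hCY, hCO, hrest⟩ := hclosed v hv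
          (fun h => hvY (hvO (Finset.mem_union_left _ h)))
          (fun h => hvY (hvO (Finset.mem_union_right _ h))) hvY
        exact ⟨C, N, hvC, hCS, hCY.mono_right Finset.subset_union_left,
          hCO.mono_right Finset.sdiff_subset, hrest⟩
      · have hsub : (S₁ \ (O₁ ∪ Y₁)) ∪ (S₂ \ (O₂ ∪ Y₂)) ⊆
            (S₁ ∪ S₂) \ ((O₁ ∪ O₂) \ (Y₁ ∪ Y₂) ∪ (Y₁ ∪ Y₂)) := by
          exact closed_subset_keep hcl₁ hcl₂ F₁.Y_sub F₂.Y_sub F₁.O_sub F₂.O_sub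
        have hc := Finset.card_le_card hsub
        rw [Finset.card_union_of_disjoint hcount] at hc
        have hif : (if D₁ ∪ D₂ = ∅ then 0 else 1) ≤
            (if D₁ = ∅ then 0 else 1) + if D₂ = ∅ then 0 else 1 := by
          by_cases h1 : D₁ = ∅ <;> by_cases h2 : D₂ = ∅ <;> simp [h1, h2]
        calc _ ≤ (m₁ + m₂ + ((if D₁ = ∅ then 0 else 1) + if D₂ = ∅ then 0 else 1)) * J :=
              Nat.mul_le_mul_right _ (by omega)
          _ = (m₁ + if D₁ = ∅ then 0 else 1) * J + (m₂ + if D₂ = ∅ then 0 else 1) * J := by ring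
          _ ≤ _ := by omega
    · have hYS : Y₁ ∪ Y₂ ∪ B₁ ⊆ S₁ ∪ S₂ := Finset.union_subset
        (Finset.union_subset_union F₁.Y_sub F₂.Y_sub)
        fun v hv => Finset.mem_union_left _ (hB₁S v hv)
      refine ⟨Y₁ ∪ Y₂ ∪ B₁, ∅, B₁, m₁ + m₂ + 1, hYS, by simp, by simp,
        Finset.subset_union_right, hd₁.card_le, by simp, by simp, by simp, ?_, ?_, ?_⟩
      · intro v hv _ hvY
        by_cases hvO₁ : v ∈ O₁
        · refine ⟨O₁ \ (Y₁ ∪ Y₂ ∪ B₁), D₁ ∪ B₁, Finset.mem_sdiff.2 ⟨hvO₁, hvY⟩,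
            Finset.sdiff_subset.trans (F₁.O_sub.trans Finset.subset_union_left),
            Finset.sdiff_disjoint, by simp,
            (Finset.card_le_card Finset.sdiff_subset).trans F₁.O_card,
            Finset.union_subset_union (F₁.D_sub.trans Finset.subset_union_left) subset_rfl, ?_, ?_⟩
          · have := Finset.card_union_le D₁ B₁
            have := F₁.D_card
            have := hd₁.card_le
            omega
          · intro c hc u hu hcu
            obtain ⟨hcO, hcY⟩ := Finset.mem_sdiff.1 hc
            have hc₁ := F₁.O_sub hcO
            have hc₂ : c ∉ S₂ := fun h => hcY (Finset.mem_union_right _ (hB₁' c hc₁ h))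
            have hu₁ : u ∈ S₁ := by
              by_contra hu₁
              exact hadj c hc₁ hc₂ u ((Finset.mem_union.1 hu).resolve_left hu₁) hu₁ hcu
            have h1 := F₁.O_adj c hcO u hu₁ hcu
            have h2 := hdis₁ u
            have h3 : u ∈ Y₂ → u ∈ B₁ := fun h => hB₁' u hu₁ (F₂.Y_sub h)
            simp only [Finset.mem_union, Finset.mem_sdiff] at h1 ⊢
            tauto
        by_cases hvO₂ : v ∈ O₂
        · refine ⟨O₂ \ (Y₁ ∪ Y₂ ∪ B₁), D₂ ∪ B₁, Finset.mem_sdiff.2 ⟨hvO₂, hvY⟩,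
            Finset.sdiff_subset.trans (F₂.O_sub.trans Finset.subset_union_right),
            Finset.sdiff_disjoint, by simp,
            (Finset.card_le_card Finset.sdiff_subset).trans F₂.O_card,
            Finset.union_subset_union (F₂.D_sub.trans Finset.subset_union_right) subset_rfl, ?_, ?_⟩
          · have := Finset.card_union_le D₂ B₁
            have := F₂.D_card
            have := hd₁.card_le
            omega
          · intro c hc u hu hcu
            obtain ⟨hcO, hcY⟩ := Finset.mem_sdiff.1 hc
            have hc₂ := F₂.O_sub hcO
            have hc₁ : c ∉ S₁ := fun h => hcY (Finset.mem_union_right _ (hB₁' c h hc₂))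
            have hu₂ : u ∈ S₂ := by
              by_contra hu₂
              exact hadj u ((Finset.mem_union.1 hu).resolve_right hu₂) hu₂ c hc₂ hc₁ hcu.symm
            have h1 := F₂.O_adj c hcO u hu₂ hcu
            have h2 := hdis₂ u
            have h3 : u ∈ Y₁ → u ∈ B₁ := fun h => hB₁' u (F₁.Y_sub h) hu₂
            simp only [Finset.mem_union, Finset.mem_sdiff] at h1 ⊢
            tauto
        obtain ⟨C, N, hvC, hCS, hCY, hCO, hCK, hN, hrest⟩ := hclosed v hv hvO₁ hvO₂
          (fun h => hvY (Finset.mem_union_left _ h))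
        exact ⟨C, N, hvC, hCS, hCY, by simp, hCK, hN.trans Finset.subset_union_left, hrest⟩
      · rw [mul_add, mul_one]
        exact (Finset.card_union_le _ _).trans (add_le_add hY hd₁.card_le)
      · have hsub : (S₁ \ (O₁ ∪ Y₁)) ∪ (S₂ \ (O₂ ∪ Y₂)) ∪ (((O₁ ∪ O₂) \ (Y₁ ∪ Y₂)) \ B₁) ⊆
            (S₁ ∪ S₂) \ (∅ ∪ (Y₁ ∪ Y₂ ∪ B₁)) := by
          exact closed_subset_mark hcl₁ hcl₂ F₁.Y_sub F₂.Y_sub F₁.O_sub F₂.O_sub hB₁S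
            fun v h => (hBOY₁ v h).imp_right fun h => F₁.D_sub h
        have hdis' : Disjoint ((S₁ \ (O₁ ∪ Y₁)) ∪ (S₂ \ (O₂ ∪ Y₂)))
            (((O₁ ∪ O₂) \ (Y₁ ∪ Y₂)) \ B₁) := by
          exact closed_disjoint_open hcl₁ hcl₂ F₁.O_sub F₂.O_sub
        have hc := Finset.card_le_card hsub
        rw [Finset.card_union_of_disjoint hdis', Finset.card_union_of_disjoint hcount] at hc
        have hif : (if B₁ = ∅ then 0 else 1) ≤ 1 := by split_ifs <;> simp
        have h0 : (m₁ + m₂ + 1 + if B₁ = ∅ then 0 else 1) * J ≤ m₁ * J + m₂ * J + 2 * J := by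
          calc _ ≤ (m₁ + m₂ + 1 + 1) * J := Nat.mul_le_mul_right _ (by omega)
            _ = _ := by ring
        rw [add_mul] at hch₁ hch₂
        by_cases hK : ((O₁ ∪ O₂) \ (Y₁ ∪ Y₂)).card ≤ K
        · have hD : ¬ (D₁ = ∅ ∨ D₂ = ∅) := fun h => hkeep ⟨hK, h⟩
          rw [not_or] at hD
          rw [if_neg hD.1] at hch₁
          rw [if_neg hD.2] at hch₂
          omega
        -- More than `K` open vertices minus at most `w` in `B₁` leave at least `J`, by `hJ`.
        · have h1 := Finset.le_card_sdiff B₁ ((O₁ ∪ O₂) \ (Y₁ ∪ Y₂))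
          have h2 := hd₁.card_le
          omega

/-- Graphs of small treewidth are fragmented by removing a small fraction of the vertices. -/
theorem TreewidthLE.exists_fragmentation {G : SimpleGraph V} [Fintype V] {t : ℕ}
    (h : TreewidthLE G t) (J : ℕ) :
    ∃ Y : Finset V, J * Y.card ≤ 2 * (t + 1) * Fintype.card V ∧
      ∀ v, v ∉ Y → ∃ C N : Finset V, v ∈ C ∧ Disjoint C Y ∧ C.card ≤ J + (t + 1) ∧
        N ⊆ Y ∧ N.card ≤ 2 * (t + 1) ∧ ∀ c ∈ C, ∀ u, G.Adj c u → u ∈ C ∨ u ∈ N := by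
  obtain ⟨B, hB⟩ := h.decomp
  obtain ⟨Y, O, D, m, F⟩ := hB.exists_frag (K := J + (t + 1)) (J := J) (by omega) (by omega)
  refine ⟨Y, ?_, fun v hv => ?_⟩
  · have h1 := F.charge
    have h2 := F.Y_card
    have h3 : (Finset.univ \ (O ∪ Y)).card ≤ Fintype.card V := Finset.card_le_univ _
    have h4 : m * J ≤ 2 * Fintype.card V := by
      rw [add_mul] at h1
      omega
    calc J * Y.card ≤ J * ((t + 1) * m) := Nat.mul_le_mul_left _ h2
      _ = (t + 1) * (m * J) := by ring
      _ ≤ (t + 1) * (2 * Fintype.card V) := Nat.mul_le_mul_left _ h4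
      _ = _ := by ring
  · by_cases hvO : v ∈ O
    · exact ⟨O, D, hvO, F.disj, F.O_card, F.D_sub, by have := F.D_card; omega,
        fun c hc u hcu => Finset.mem_union.1 (F.O_adj c hc u (Finset.mem_univ _) hcu)⟩
    · obtain ⟨C, N, h1, -, h2, -, h3, h4, h5, h6⟩ := F.closed v (Finset.mem_univ _) hvO hv
      exact ⟨C, N, h1, h2, h3, h4, h5, 
        fun c hc u hcu => Finset.mem_union.1 (h6 c hc u (Finset.mem_univ _) hcu)⟩

end Structure

section Structure

open scoped Classical

/-! ## Graphs without large protrusions -/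

/-- In `G` there is no set `D` of at most about `N` vertices, with a neighbourhood of at most `r`
vertices, that together with this neighbourhood has more than `s` vertices. -/
def NoProtrusion {V : Type*} (G : SimpleGraph V) (r s N : ℕ) : Prop :=
  ∀ D B : Finset V, Disjoint D B → (∀ v ∈ D, ∀ u, G.Adj v u → u ∈ D ∪ B) → B.card ≤ r →
    D.card + B.card ≤ N → D.card + B.card ≤ s

/-- The components of `G - Z`. -/
noncomputable def comps {V : Type*} [Fintype V] (G : SimpleGraph V) (Z : Finset V) :
    Finset (Finset V) :=
  (Finset.univ \ Z).image fun v => Finset.univ.filter (ConnIn G {z | z ∉ Z} v)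

section comps

variable {V : Type*} [Fintype V] {G : SimpleGraph V} {Z C C' : Finset V}

theorem exists_mem_comps {v : V} (hv : v ∉ Z) : ∃ C ∈ comps G Z, v ∈ C :=
  ⟨_, Finset.mem_image_of_mem _ (by simpa using hv), by simpa using ConnIn.refl hv⟩

theorem mem_comps (hC : C ∈ comps G Z) : ∃ v ∈ C, v ∉ Z ∧ ∀ u, u ∈ C ↔ ConnIn G {z | z ∉ Z} v u := by
  obtain ⟨v, hv, rfl⟩ := Finset.mem_image.1 hC
  have hv : v ∉ Z := by simpa using hv
  exact ⟨v, by simpa using ConnIn.refl hv, hv, by simp⟩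

theorem comps_disjoint (hC : C ∈ comps G Z) : Disjoint C Z := by
  obtain ⟨v, -, -, h⟩ := mem_comps hC
  exact Finset.disjoint_left.2 fun u hu => ((h u).1 hu).right_mem

theorem comps_pairwise (hC : C ∈ comps G Z) (hC' : C' ∈ comps G Z) (hne : C ≠ C') :
    Disjoint C C' := by
  obtain ⟨v, -, -, h⟩ := mem_comps hC
  obtain ⟨v', -, -, h'⟩ := mem_comps hC'
  refine Finset.disjoint_left.2 fun u hu hu' => hne ?_
  have hvv := ((h u).1 hu).trans ((h' u).1 hu').symm
  ext x
  rw [h, h']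
  exact ⟨fun hx => hvv.symm.trans hx, fun hx => hvv.trans hx⟩

theorem comps_connected (hC : C ∈ comps G Z) :
    ∀ x ∈ C, ∀ y ∈ C, ConnIn G (C : Set V) x y := by
  obtain ⟨v, -, -, h⟩ := mem_comps hC
  have key : ∀ x ∈ C, ConnIn G (C : Set V) v x := by
    intro x hx
    have hvx := (h x).1 hx
    refine hvx.induct (P := fun x => ConnIn G (C : Set V) v x)
      (ConnIn.refl ((h v).2 (ConnIn.refl hvx.left_mem))) fun a b ha hb hab hva => ?_
    have haC : a ∈ C := hva.right_mem
    exact hva.trans (ConnIn.of_adj hab haC ((h b).2 (((h a).1 haC).trans (ConnIn.of_adj hab ha hb))))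
  exact fun x hx y hy => (key x hx).symm.trans (key y hy)

theorem mem_of_adj_comps (hC : C ∈ comps G Z) {v u : V} (hv : v ∈ C) (hvu : G.Adj v u) :
    u ∈ C ∪ nbrs G Z C := by
  obtain ⟨x, -, -, h⟩ := mem_comps hC
  by_cases hu : u ∈ Z
  · exact Finset.mem_union_right _ (Finset.mem_filter.2 ⟨Finset.mem_sdiff.2
      ⟨hu, fun hu' => Finset.disjoint_left.1 (comps_disjoint hC) hu' hu⟩, v, hv, hvu⟩)
  · have hxv := (h v).1 hv
    exact Finset.mem_union_left _ ((h u).2 (hxv.trans (ConnIn.of_adj hvu hxv.right_mem hu)))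

/-- Components with a common small neighbourhood are together small if there are no protrusions. -/
theorem sum_card_le_of_noProtrusion {r s N : ℕ} (hG : NoProtrusion G r s N) (hN : 2 * s + r ≤ N)
    {B : Finset V} (hB : B.card ≤ r) (ℱ : Finset (Finset V)) (hℱ : ∀ C ∈ ℱ, C ∈ comps G Z)
    (hB' : ∀ C ∈ ℱ, nbrs G Z C = B) (hs : ∀ C ∈ ℱ, C.card ≤ s) : ∑ C ∈ ℱ, C.card ≤ s := by
  induction ℱ using Finset.induction_on with
  | empty => simp
  | insert C ℱ hC ih =>
    have h1 := ih (fun C' h => hℱ C' (by simp [h])) (fun C' h => hB' C' (by simp [h]))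
      (fun C' h => hs C' (by simp [h]))
    have h2 := hs C (by simp)
    have hBZ : B ⊆ Z := by
      rw [← hB' C (by simp)]
      exact nbrs_subset _ _ _
    have hcard : ((insert C ℱ).biUnion id).card = ∑ C ∈ insert C ℱ, C.card := by
      refine Finset.card_biUnion fun C hC C' hC' hne => comps_pairwise (hℱ C hC) (hℱ C' hC') hne
    -- The earlier components have at most `s` vertices together, the new one at most `s`, and `B`
    -- at most `r`. The union is thus within the range of `hG`, which brings its size back to `s`.
    have h3 := hG ((insert C ℱ).biUnion id) B ?_ ?_ hB ?_
    · omega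
    · rw [Finset.disjoint_biUnion_left]
      exact fun C hC => (comps_disjoint (hℱ C hC)).mono_right hBZ
    · intro v hv u hvu
      obtain ⟨C', hC', hv⟩ := Finset.mem_biUnion.1 hv
      rcases Finset.mem_union.1 (mem_of_adj_comps (hℱ C' hC') hv hvu) with h | h
      · exact Finset.mem_union_left _ (Finset.mem_biUnion.2 ⟨C', hC', h⟩)
      · rw [hB' C' hC'] at h
        exact Finset.mem_union_right _ h
    · rw [hcard, Finset.sum_insert hC]
      omega

end comps

/-- A component of `G - (X ∪ Y)` stays inside one piece of the fragmentation of `G - X`, because all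
exits from the piece lie in `X` or `Y`. -/
theorem exists_fragmentation_compl {V : Type*} [Fintype V] {G : SimpleGraph V} {X : Finset V}
    {t : ℕ} (h : TreewidthLE (G.induce (X : Set V)ᶜ) t) (J : ℕ) :
    ∃ Y : Finset V, J * Y.card ≤ 2 * (t + 1) * Fintype.card V ∧
      ∀ C ∈ comps G (X ∪ Y), C.card ≤ J + (t + 1) ∧ (nbrs G Y C).card ≤ 2 * (t + 1) := by
  obtain ⟨Y, hY, hpiece⟩ := h.exists_fragmentation J
  refine ⟨Y.map (Function.Embedding.subtype _), ?_, fun C hC => ?_⟩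
  · rw [Finset.card_map]
    exact hY.trans (Nat.mul_le_mul_left _ (Fintype.card_subtype_le _))
  obtain ⟨v, -, hvZ, hv⟩ := mem_comps hC
  have hmap : ∀ u (hu : u ∉ X) (T : Finset ((X : Set V)ᶜ : Set V)),
      u ∈ T.map (Function.Embedding.subtype _) ↔ (⟨u, by simpa using hu⟩ : ((X : Set V)ᶜ : Set V)) ∈ T := by
    intro u hu T
    simp only [Finset.mem_map, Function.Embedding.subtype_apply]
    constructor
    · rintro ⟨a, ha, rfl⟩; exact ha
    · intro h; exact ⟨_, h, rfl⟩
  have hZ : ∀ u, u ∉ X ∪ Y.map (Function.Embedding.subtype _) →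
      ∃ hu : u ∉ X, (⟨u, by simpa using hu⟩ : ((X : Set V)ᶜ : Set V)) ∉ Y := by
    intro u hu
    rw [Finset.mem_union, not_or] at hu
    exact ⟨hu.1, fun h => hu.2 ((hmap u hu.1 Y).2 h)⟩
  obtain ⟨hvX, hvY⟩ := hZ v hvZ
  obtain ⟨P, N, hvP, hPY, hPc, hNY, hNc, hadj⟩ := hpiece _ hvY
  have hCP : C ⊆ P.map (Function.Embedding.subtype _) := by
    intro u hu
    refine ((hv u).1 hu).induct (P := fun u => u ∈ P.map (Function.Embedding.subtype _))
      ((hmap v hvX P).2 hvP) fun a b ha hb hab haP => ?_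
    obtain ⟨haX, haY⟩ := hZ a ha
    obtain ⟨hbX, hbY⟩ := hZ b hb
    rw [hmap b hbX]
    rcases hadj _ ((hmap a haX P).1 haP) ⟨b, by simpa using hbX⟩ (by simpa using hab) with h | h
    exacts [h, absurd (hNY h) hbY]
  refine ⟨(Finset.card_le_card hCP).trans (by rwa [Finset.card_map]), ?_⟩
  refine (Finset.card_le_card (t := N.map (Function.Embedding.subtype _)) ?_).trans
    (by rwa [Finset.card_map])
  intro u hu
  obtain ⟨huY, c, hc, hcu⟩ := Finset.mem_filter.1 hu
  obtain ⟨⟨u, huX⟩, huY', rfl⟩ := Finset.mem_map.1 (Finset.mem_sdiff.1 huY).1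
  obtain ⟨⟨c, hcX⟩, hcP, rfl⟩ := Finset.mem_map.1 (hCP hc)
  rcases hadj ⟨c, hcX⟩ hcP ⟨u, huX⟩ (by simpa using hcu) with h | h
  · exact absurd huY' (Finset.disjoint_left.1 hPY h)
  · exact Finset.mem_map_of_mem _ h

/-- A graph that excludes a topological minor and has no protrusions is linear in the size of
every treewidth modulator. -/
theorem exists_card_le_of_noProtrusion (W : Type*) [Finite W] (t : ℕ) :
    ∃ r, ∀ s, ∃ N a : ℕ, ∀ (V : Type) [Fintype V] (G : SimpleGraph V),
      ¬ HasModel (Set.univ : Set (Sym2 W)) G Set.univ → ∀ X : Finset V,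
      TreewidthLE (G.induce (X : Set V)ᶜ) t → NoProtrusion G r s N →
      Fintype.card V ≤ a * X.card + a := by
  have := Fintype.ofFinite W
  obtain ⟨α, hα⟩ := exists_hasModel_of_dense (Finset.univ : Finset (Sym2 W))
  rw [Finset.coe_univ] at hα
  set h := Fintype.card W
  set w := t + 1 with hw
  refine ⟨h + 2 * w, fun s => ?_⟩
  set r := h + 2 * w
  -- The count below yields `β * Z.card` plus terms in `X`, and `J` is chosen such that `β * Y.card`
  -- is at most half the number of vertices. Here `β` must not depend on `K`, and `r` must not
  -- depend on `s`.
  set β := 1 + s * α + s * 2 ^ α with hβ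
  set J := 4 * w * β
  set K := J + w with hK
  -- This `N` covers one component with its neighbourhood, at most `K + r` vertices, as well as the
  -- unions of size `2 * s + r` in `sum_card_le_of_noProtrusion`.
  refine ⟨K + 2 * s + r, 2 * (β + K * α) + 2 * s, fun V _ G hG X hX hirr => ?_⟩
  obtain ⟨Y, hY, hcomps⟩ := exists_fragmentation_compl hX J
  set Z := X ∪ Y with hZ
  let 𝒞₁ := (comps G Z).filter fun C => h ≤ (nbrs G X C).card
  let 𝒞₂ := (comps G Z).filter fun C => ¬ h ≤ (nbrs G X C).card
  have hmem₁ : ∀ C ∈ 𝒞₁, C ∈ comps G Z := fun C hC => (Finset.mem_filter.1 hC).1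
  have hmem₂ : ∀ C ∈ 𝒞₂, C ∈ comps G Z := fun C hC => (Finset.mem_filter.1 hC).1
  -- A component left over by the packing relative to `X` has fewer than `h` neighbours in `X`, so
  -- all of `𝒞₁` is used.
  have hcard₁ : 𝒞₁.card ≤ α * X.card := by
    obtain ⟨𝒰, h𝒰, hcard, hsmall, -⟩ := exists_packing (hα V) hG X 𝒞₁
      (fun C hC => (comps_disjoint (hmem₁ C hC)).mono_right Finset.subset_union_left)
      (fun C hC C' hC' hne => comps_pairwise (hmem₁ C hC) (hmem₁ C' hC') hne)
      (fun C hC => comps_connected (hmem₁ C hC))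
    refine (Finset.card_le_card fun C hC => ?_).trans hcard
    by_contra hCU
    exact absurd (hsmall C (Finset.mem_sdiff.2 ⟨hC, hCU⟩)) (not_lt.2 (Finset.mem_filter.1 hC).2)
  obtain ⟨𝒰, h𝒰, hcard, -, himage⟩ := exists_packing (hα V) hG Z 𝒞₂
      (fun C hC => comps_disjoint (hmem₂ C hC))
      (fun C hC C' hC' hne => comps_pairwise (hmem₂ C hC) (hmem₂ C' hC') hne)
      (fun C hC => comps_connected (hmem₂ C hC))
  have hnbr : ∀ C ∈ 𝒞₂, (nbrs G Z C).card ≤ r := by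
    intro C hC
    have h1 : nbrs G Z C ⊆ nbrs G X C ∪ nbrs G Y C := by
      intro u hu
      simp only [nbrs, Finset.mem_filter, Finset.mem_sdiff, Finset.mem_union, hZ] at hu ⊢
      obtain ⟨⟨h | h, h'⟩, hadj⟩ := hu
      exacts [Or.inl ⟨⟨h, h'⟩, hadj⟩, Or.inr ⟨⟨h, h'⟩, hadj⟩]
    have h2 := (Finset.card_le_card h1).trans (Finset.card_union_le _ _)
    have h3 := (hcomps C (hmem₂ C hC)).2
    have h4 := (Finset.mem_filter.1 hC).2
    omega
  -- Such a component with its neighbourhood is a candidate protrusion, so the bound `K` on its size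
  -- improves to `s`. This is what keeps `K` out of `β`.
  have hsmall : ∀ C ∈ 𝒞₂, C.card ≤ s := by
    intro C hC
    have h1 := hnbr C hC
    have h2 := (hcomps C (hmem₂ C hC)).1
    have := hirr C (nbrs G Z C) ((comps_disjoint (hmem₂ C hC)).mono_right (nbrs_subset _ _ _))
      (fun v hv u hvu => mem_of_adj_comps (hmem₂ C hC) hv hvu) h1 (by omega)
    omega
  have hsum₁ : ∑ C ∈ 𝒞₁, C.card ≤ K * (α * X.card) := by
    refine (Finset.sum_le_card_nsmul _ _ K fun C hC => (hcomps C (hmem₁ C hC)).1).trans ?_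
    rw [smul_eq_mul, mul_comm]
    exact Nat.mul_le_mul_left _ hcard₁
  have hsum₂ : ∑ C ∈ 𝒰, C.card ≤ s * (α * Z.card) := by
    refine (Finset.sum_le_card_nsmul _ _ s fun C hC => hsmall C (h𝒰 hC)).trans ?_
    rw [smul_eq_mul, mul_comm]
    exact Nat.mul_le_mul_left _ hcard
  -- The unused components are grouped by neighbourhood: there are few groups, and each has at most
  -- `s` vertices in total.
  have hsum₃ : ∑ C ∈ 𝒞₂ \ 𝒰, C.card ≤ s * (2 ^ α * Z.card + 1) := by
    rw [← Finset.sum_fiberwise_of_maps_to (t := (𝒞₂ \ 𝒰).image (nbrs G Z)) (g := nbrs G Z)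
      fun C hC => Finset.mem_image_of_mem _ hC]
    refine (Finset.sum_le_card_nsmul _ _ s fun B hB => ?_).trans ?_
    · obtain ⟨C, hC, rfl⟩ := Finset.mem_image.1 hB
      have hsub : ∀ C' ∈ (𝒞₂ \ 𝒰).filter (fun C' => nbrs G Z C' = nbrs G Z C), C' ∈ 𝒞₂ :=
        fun C' h => (Finset.mem_sdiff.1 (Finset.mem_filter.1 h).1).1
      exact sum_card_le_of_noProtrusion hirr (by omega) (hnbr C (Finset.mem_sdiff.1 hC).1) _
        (fun C' h => hmem₂ C' (hsub C' h)) (fun C' h => (Finset.mem_filter.1 h).2)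
        (fun C' h => hsmall C' (hsub C' h))
    · rw [smul_eq_mul, mul_comm]
      exact Nat.mul_le_mul_left _ himage
  have hcover : Fintype.card V ≤ Z.card + ∑ C ∈ comps G Z, C.card := by
    have hsub : (Finset.univ : Finset V) ⊆ Z ∪ (comps G Z).biUnion id := by
      intro v _
      by_cases hv : v ∈ Z
      · exact Finset.mem_union_left _ hv
      · obtain ⟨C, hC, hvC⟩ := exists_mem_comps (G := G) hv
        exact Finset.mem_union_right _ (Finset.mem_biUnion.2 ⟨C, hC, hvC⟩)
    exact (Finset.card_le_card hsub).trans ((Finset.card_union_le _ _).trans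
      (Nat.add_le_add_left Finset.card_biUnion_le _))
  have hsplit : ∑ C ∈ comps G Z, C.card =
      ∑ C ∈ 𝒞₁, C.card + (∑ C ∈ 𝒞₂ \ 𝒰, C.card + ∑ C ∈ 𝒰, C.card) := by
    rw [Finset.sum_sdiff h𝒰]
    exact (Finset.sum_filter_add_sum_filter_not _ _ _).symm
  have hZcard : Z.card ≤ X.card + Y.card := Finset.card_union_le _ _
  have hYcard : 2 * β * Y.card ≤ Fintype.card V := by
    have h1 : 2 * w * (2 * β * Y.card) ≤ 2 * w * Fintype.card V := by
      calc _ = J * Y.card := by ring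
        _ ≤ _ := hY
    exact Nat.le_of_mul_le_mul_left h1 (by omega)
  have h1 : Fintype.card V ≤ β * Z.card + K * α * X.card + s := by
    rw [hsplit] at hcover
    calc _ ≤ _ := hcover
      _ ≤ Z.card + (K * (α * X.card) + (s * (2 ^ α * Z.card + 1) + s * (α * Z.card))) := by omega
      _ = _ := by rw [hβ]; ring
  have h2 : β * Z.card ≤ β * X.card + β * Y.card := by
    rw [← mul_add]; exact Nat.mul_le_mul_left _ hZcard
  calc Fintype.card V ≤ 2 * (β * X.card) + 2 * (K * α * X.card) + 2 * s := by
        rw [mul_assoc] at hYcard; omega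
    _ = 2 * (β + K * α) * X.card + 2 * s := by ring
    _ ≤ _ := by gcongr <;> omega

/-- Graphs that exclude a topological minor are sparse. -/
theorem exists_arcs_le (W : Type*) [Finite W] :
    ∃ α : ℕ, ∀ (V : Type) [Fintype V] (G : SimpleGraph V),
      ¬ HasModel (Set.univ : Set (Sym2 W)) G Set.univ → G.edgeSet.ncard ≤ α * Fintype.card V := by
  have := Fintype.ofFinite W
  obtain ⟨α, hα⟩ := exists_hasModel_of_dense (Finset.univ : Finset (Sym2 W))
  rw [Finset.coe_univ] at hα
  refine ⟨α, fun V _ G hG => ?_⟩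
  have h1 : G.edgeSet.ncard ≤ arcs G Finset.univ := by
    have h2 : 2 * G.edgeSet.ncard = arcs G Finset.univ := by
      rw [Set.ncard_eq_toFinset_card', arcs]
      have := G.sum_degrees_eq_twice_card_edges
      simp only [SimpleGraph.degree, SimpleGraph.neighborFinset_eq_filter] at this
      rw [SimpleGraph.edgeFinset] at this
      convert this.symm using 3
    omega
  refine h1.trans ?_
  rcases (Finset.univ : Finset V).eq_empty_or_nonempty with h | h
  · rw [h]; simp [arcs]
  · by_contra hlt
    refine hG ((hα V G _ h ?_).mono (Set.subset_univ _))
    rw [Finset.card_univ]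
    omega

end Structure

/-! ## Gluing -/

section Replacement

open scoped Classical

/-- A graph that is covered by copies of `A` and `C` that meet in the labels is `A ⊕ C`. -/
theorem BoundariedGraph.glue_iso {t : ℕ} (A C : BoundariedGraph t) (G : FinGraph) (a : A.V → G.V)
    (c : C.V → G.V) (ha : Function.Injective a) (hc : Function.Injective c)
    (hlab : ∀ i, a (A.label i) = c (C.label i))
    (hmeet : ∀ x y, a x = c y → ∃ i, x = A.label i ∧ y = C.label i)
    (hsurj : ∀ v, (∃ x, a x = v) ∨ ∃ y, c y = v)
    (hadj : ∀ u v, G.graph.Adj u v ↔ (∃ x y, a x = u ∧ a y = v ∧ A.graph.Adj x y) ∨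
      ∃ x y, c x = u ∧ c y = v ∧ C.graph.Adj x y) :
    Nonempty ((A.glue C).graph ≃g G.graph) := by
  have hrel : ∀ x y, A.glueRel C x y → Sum.elim a c x = Sum.elim a c y := by
    rintro _ _ ⟨i, rfl, rfl⟩
    exact hlab i
  let f : (A.glue C).V → G.V := Quot.lift (Sum.elim a c) hrel
  have hinj : Function.Injective f := by
    rintro ⟨x | x⟩ ⟨y | y⟩ h
    · exact congrArg _ (congrArg _ (ha h))
    · obtain ⟨i, rfl, rfl⟩ := hmeet x y h
      exact Quot.sound ⟨i, rfl, rfl⟩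
    · obtain ⟨i, rfl, rfl⟩ := hmeet y x h.symm
      exact (Quot.sound ⟨i, rfl, rfl⟩).symm
    · exact congrArg _ (congrArg _ (hc h))
  have hsur : Function.Surjective f := by
    intro v
    rcases hsurj v with ⟨x, rfl⟩ | ⟨x, rfl⟩
    exacts [⟨Quot.mk _ (Sum.inl x), rfl⟩, ⟨Quot.mk _ (Sum.inr x), rfl⟩]
  refine ⟨Equiv.ofBijective f ⟨hinj, hsur⟩, ?_⟩
  intro p q
  change G.graph.Adj (f p) (f q) ↔ (p ≠ q ∧ ∃ x y, Quot.mk _ x = p ∧ Quot.mk _ y = q ∧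
    (A.graph.sum C.graph).Adj x y)
  constructor
  · intro h
    refine ⟨fun hpq => h.ne (congrArg f hpq), ?_⟩
    rcases (hadj _ _).1 h with ⟨x, y, hx, hy, hxy⟩ | ⟨x, y, hx, hy, hxy⟩
    · exact ⟨Sum.inl x, Sum.inl y, hinj hx, hinj hy, by simpa using hxy⟩
    · exact ⟨Sum.inr x, Sum.inr y, hinj hx, hinj hy, by simpa using hxy⟩
  · rintro ⟨-, x | x, y | y, rfl, rfl, h⟩
    · exact (hadj _ _).2 (Or.inl ⟨x, y, rfl, rfl, by simpa using h⟩)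
    · simp at h
    · simp at h
    · exact (hadj _ _).2 (Or.inr ⟨x, y, rfl, rfl, by simpa using h⟩)

/-- The vertices of a boundaried graph can be numbered such that the labels come first. -/
theorem BoundariedGraph.exists_numbering {t : ℕ} (A : BoundariedGraph t) :
    ∃ (h : t ≤ Nat.card A.V) (G : SimpleGraph (Fin (Nat.card A.V))) (e : A.graph ≃g G),
      ∀ i, e (A.label i) = Fin.castLE h i := by
  have := Fintype.ofFinite A.V
  have h : t ≤ Nat.card A.V := by
    simpa using Nat.card_le_card_of_injective A.label A.label.injective
  let e₀ : A.V ≃ Fin (Nat.card A.V) := Finite.equivFin A.V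
  have hi₁ : Function.Injective fun i => e₀ (A.label i) := e₀.injective.comp A.label.injective
  have hi₂ : Function.Injective (Fin.castLE h) := Fin.castLE_injective h
  -- A permutation extending the bijection from the numbers of the labels to the first `t` numbers.
  let σ : Equiv.Perm (Fin (Nat.card A.V)) := Equiv.extendSubtype
    (p := fun x => x ∈ Set.range fun i => e₀ (A.label i))
    (q := fun x => x ∈ Set.range (Fin.castLE h))
    ((Equiv.ofInjective _ hi₁).symm.trans (Equiv.ofInjective _ hi₂))
  refine ⟨h, A.graph.map (e₀.trans σ).toEmbedding, SimpleGraph.Iso.map _ _, fun i => ?_⟩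
  change σ (e₀ (A.label i)) = _
  rw [Equiv.extendSubtype_apply_of_mem _ _ ⟨i, rfl⟩]
  simp only [Equiv.trans_apply]
  have : (Equiv.ofInjective _ hi₁).symm ⟨e₀ (A.label i), ⟨i, rfl⟩⟩ = i :=
    Equiv.ofInjective_symm_apply hi₁ i
  rw [this]
  rfl

/-! ## Representatives of boundaried graphs -/

namespace ParamGraphProblem

variable {𝒢 : Set FinGraph} (Q : ParamGraphProblem 𝒢)

/-- `A` may be replaced by `B` if the parameter is changed by `c`. -/
def EquivBy {t : ℕ} (A B : BoundariedGraph t) (c : ℤ) : Prop :=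
  ∀ (C : BoundariedGraph t) (k : ℤ), (A.glue C ∈ 𝒢 ↔ B.glue C ∈ 𝒢) ∧
    (Q.YesInt (A.glue C) k ↔ Q.YesInt (B.glue C) (k + c))

variable {Q}

theorem EquivBy.symm_trans {t : ℕ} {A B B' : BoundariedGraph t} {c c' : ℤ}
    (h : Q.EquivBy A B c) (h' : Q.EquivBy A B' c') : Q.EquivBy B B' (c' - c) := by
  intro C k
  refine ⟨(h C k).1.symm.trans (h' C k).1, ?_⟩
  have h1 := (h C (k - c)).2
  have h2 := (h' C (k - c)).2
  rw [sub_add_cancel] at h1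
  rw [← h1, h2, sub_add_eq_add_sub, add_sub_assoc]

/-- Every class of boundaried graphs has a member by which all others can be replaced without
increasing the parameter. -/
theorem exists_least_representative {t : ℕ} (A₀ : BoundariedGraph t) :
    ∃ B : BoundariedGraph t, ∀ A : BoundariedGraph t, Q.Equiv A₀ A → ∃ δ : ℕ, Q.EquivBy A B (-δ) := by
  -- A context with a yes-instance at `k` gives every member of shift `c` a yes-instance at `k + c`,
  -- which cannot be negative. The shifts are therefore bounded below, and a member of least shift
  -- is taken. Without yes-instances every shift is correct, in particular zero.
  by_cases hyes : ∃ (C : BoundariedGraph t) (k : ℕ), Q.Yes (A₀.glue C) k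
  · obtain ⟨C, k, hk⟩ := hyes
    have hpos : ∀ B c, Q.EquivBy A₀ B c → 0 ≤ k + c := by
      intro B c h
      obtain ⟨m, hm, -⟩ := (h C k).2.1 ⟨k, rfl, hk⟩
      omega
    have hex : ∃ m : ℕ, ∃ (B : BoundariedGraph t) (c : ℤ), Q.EquivBy A₀ B c ∧ (m : ℤ) = k + c :=
      ⟨k, A₀, 0, fun C k => by simp, by simp⟩
    obtain ⟨B, c, hB, hm⟩ := Nat.find_spec hex
    refine ⟨B, fun A ⟨d, hd⟩ => ?_⟩
    have hmin : Nat.find hex ≤ (k + d).toNat :=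
      Nat.find_min' hex ⟨A, d, hd, Int.toNat_of_nonneg (hpos A d hd)⟩
    have h0 := hpos A d hd
    refine ⟨(d - c).toNat, ?_⟩
    have : (-((d - c).toNat : ℤ)) = c - d := by omega
    rw [this]
    exact EquivBy.symm_trans hd hB
  · push Not at hyes
    refine ⟨A₀, fun A ⟨d, hd⟩ => ⟨0, fun C k => ?_⟩⟩
    have hno : ∀ k, ¬ Q.YesInt (A₀.glue C) k := fun k ⟨m, _, hm⟩ => hyes C m hm
    refine ⟨(hd C k).1.symm, iff_of_false (fun h => ?_) (hno _)⟩
    exact hno (k - d) ((hd C (k - d)).2.2 (by simpa using h))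

/-- There are finitely many classes, so the sizes of their least representatives have a maximum. -/
theorem HasFiniteIntegerIndex.exists_representatives (hQ : Q.HasFiniteIntegerIndex) (t : ℕ) :
    ∃ s : ℕ, ∀ A : BoundariedGraph t, A.toFinGraph ∈ 𝒢 →
      ∃ (B : BoundariedGraph t) (δ : ℕ), Nat.card B.V ≤ s ∧ Q.EquivBy A B (-δ) := by
  have := hQ t
  have key : ∀ q : Quotient (Q.equivSetoid t), ∃ B : BoundariedGraph t,
      ∀ A : {A : BoundariedGraph t // A.toFinGraph ∈ 𝒢}, Quotient.mk _ A = q →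
        ∃ δ : ℕ, Q.EquivBy A.1 B (-δ) := by
    intro q
    obtain ⟨A₀, rfl⟩ := Quotient.exists_rep q
    obtain ⟨B, hB⟩ := exists_least_representative (Q := Q) A₀.1
    refine ⟨B, fun A hA => hB A.1 ?_⟩
    exact Quotient.exact hA.symm
  choose B hB using key
  obtain ⟨s, hs⟩ := Finite.exists_le fun q => Nat.card (B q).V
  refine ⟨s, fun A hA => ?_⟩
  obtain ⟨δ, hδ⟩ := hB _ ⟨A, hA⟩ rfl
  exact ⟨_, δ, hs _, hδ⟩

theorem HasFiniteIntegerIndex.exists_representatives_le (hQ : Q.HasFiniteIntegerIndex) (r : ℕ) :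
    ∃ s : ℕ, ∀ t ≤ r, ∀ A : BoundariedGraph t, A.toFinGraph ∈ 𝒢 →
      ∃ (B : BoundariedGraph t) (δ : ℕ), Nat.card B.V ≤ s ∧ Q.EquivBy A B (-δ) := by
  choose s hs using hQ.exists_representatives
  refine ⟨(Finset.range (r + 1)).sup s, fun t ht A hA => ?_⟩
  obtain ⟨B, δ, hB, h⟩ := hs t A hA
  exact ⟨B, δ, hB.trans (Finset.le_sup (by simpa using Nat.lt_succ_of_le ht)), h⟩

end ParamGraphProblem

/-! ## Replacing occurrences of boundaried graphs -/

/-- The graph `G` restricted to the vertices in `U`. -/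
def FinGraph.restrict {V : Type} [Finite V] (G : SimpleGraph V) (U : Set V) : FinGraph :=
  ⟨U, G.induce U⟩

section Occurrence

variable {V : Type} {m t : ℕ}

/-- `φ` embeds `A` into the restriction of `G` to `U` as an induced subgraph, such that all
neighbours of unlabeled vertices are in its image. The first `t` vertices of `A` are labeled. -/
structure Occurs (G : SimpleGraph V) (U : Set V) (A : SimpleGraph (Fin m)) (t : ℕ)
    (φ : Fin m → V) : Prop where
  inj : Function.Injective φ
  mem : ∀ i, φ i ∈ U
  adj : ∀ i j, G.Adj (φ i) (φ j) ↔ A.Adj i j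
  nbr : ∀ i : Fin m, t ≤ i → ∀ v ∈ U, G.Adj (φ i) v → v ∈ Set.range φ

/-- The vertices that are not unlabeled vertices of the occurrence `φ`. -/
def restSet (U : Set V) (t : ℕ) (φ : Fin m → V) : Set V :=
  {v | v ∈ U ∧ ∀ i : Fin m, t ≤ i → v ≠ φ i}

/-- The part of `G` that remains when an occurrence is cut off, without edges between labels. -/
def rest [Finite V] (G : SimpleGraph V) (U : Set V) {φ : Fin m → V} (ht : t ≤ m)
    (hφ : Function.Injective φ) (hU : ∀ i, φ i ∈ U) : BoundariedGraph t where
  V := restSet U t φ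
  graph :=
    { Adj := fun x y => G.Adj x y ∧ ¬ ((∃ i : Fin t, x.1 = φ (Fin.castLE ht i)) ∧
        ∃ i : Fin t, y.1 = φ (Fin.castLE ht i))
      symm := ⟨fun _ _ h => ⟨h.1.symm, fun h' => h.2 h'.symm⟩⟩
      loopless := ⟨fun _ h => h.1.ne rfl⟩ }
  label := ⟨fun i => ⟨φ (Fin.castLE ht i), hU _, fun j hj h => by
      have := congrArg Fin.val (hφ h)
      simp only [Fin.val_castLE] at this
      omega⟩,
    fun i j h => by simpa using hφ (congrArg Subtype.val h)⟩

/-- No edge leaves an occurrence at an unlabeled vertex, so `G` on `U` is the occurrence glued to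
the rest. The rest is any `C` with an injection `c`, because the context cut from the old graph must
also be recognised in the new one. -/
theorem Occurs.glue_iso [Finite V] {G : SimpleGraph V} {U : Set V} {A : SimpleGraph (Fin m)}
    {φ : Fin m → V} (h : Occurs G U A t φ) (ht : t ≤ m) {A' C : BoundariedGraph t}
    (e : A'.graph ≃g A) (he : ∀ i, e (A'.label i) = Fin.castLE ht i) (c : C.V → V)
    (hc : Function.Injective c) (hrange : Set.range c = restSet U t φ)
    (hlab : ∀ i, c (C.label i) = φ (Fin.castLE ht i))
    (hCadj : ∀ x y, C.graph.Adj x y ↔ G.Adj (c x) (c y) ∧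
      ¬ ((∃ i : Fin t, c x = φ (Fin.castLE ht i)) ∧ ∃ i : Fin t, c y = φ (Fin.castLE ht i))) :
    Nonempty ((A'.glue C).graph ≃g (FinGraph.restrict G U).graph) := by
  have hcU : ∀ y, c y ∈ restSet U t φ := fun y => hrange ▸ ⟨y, rfl⟩
  have hrest : ∀ u ∈ U, ∀ v ∈ U, G.Adj u v → u ∉ Set.range φ → v ∈ restSet U t φ := by
    intro u _ v hv huv hu'
    refine ⟨hv, ?_⟩
    rintro i hi rfl
    exact hu' (h.nbr i hi u ‹_› huv.symm)
  have hlt : ∀ i : Fin m, φ i ∈ restSet U t φ → ∃ j : Fin t, i = Fin.castLE ht j := by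
    intro i hi
    by_cases hit : t ≤ i
    · exact absurd rfl (hi.2 i hit)
    · exact ⟨⟨i, by omega⟩, by ext; simp⟩
  refine BoundariedGraph.glue_iso A' C (FinGraph.restrict G U) (fun x => ⟨φ (e x), h.mem _⟩)
    (fun y => ⟨c y, (hcU y).1⟩) ?_ ?_ ?_ ?_ ?_ ?_
  · intro x y hxy
    exact e.injective (h.inj (congrArg Subtype.val hxy))
  · intro x y hxy
    exact hc (congrArg Subtype.val hxy)
  · intro i
    exact Subtype.ext ((congrArg φ (he i)).trans (hlab i).symm)
  · intro x y hxy
    have hxy : φ (e x) = c y := congrArg Subtype.val hxy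
    obtain ⟨j, hj⟩ := hlt (e x) (hxy ▸ hcU y)
    refine ⟨j, e.injective (by rw [he, hj]), hc ?_⟩
    rw [hlab, ← hxy, hj]
  · rintro ⟨v, hv⟩
    by_cases hvφ : v ∈ Set.range φ
    · obtain ⟨i, rfl⟩ := hvφ
      exact Or.inl ⟨e.symm i, Subtype.ext (by simp)⟩
    · have : v ∈ Set.range c := hrange ▸ ⟨hv, fun i _ h => hvφ ⟨i, h.symm⟩⟩
      obtain ⟨y, rfl⟩ := this
      exact Or.inr ⟨y, rfl⟩
  · rintro ⟨u, hu⟩ ⟨v, hv⟩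
    change G.Adj u v ↔ _
    constructor
    · intro huv
      by_cases hboth : u ∈ Set.range φ ∧ v ∈ Set.range φ
      · obtain ⟨⟨i, rfl⟩, j, rfl⟩ := hboth
        refine Or.inl ⟨e.symm i, e.symm j, Subtype.ext (by simp), Subtype.ext (by simp), ?_⟩
        rw [e.symm.map_adj_iff]
        exact (h.adj i j).1 huv
      · have hur : u ∈ restSet U t φ ∧ v ∈ restSet U t φ := by
          by_cases hu' : u ∈ Set.range φ
          · have hv' : v ∉ Set.range φ := fun hv' => hboth ⟨hu', hv'⟩
            exact ⟨hrest v hv u hu huv.symm hv', hv, fun i _ h => hv' ⟨i, h.symm⟩⟩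
          · exact ⟨⟨hu, fun i _ h => hu' ⟨i, h.symm⟩⟩, hrest u hu v hv huv hu'⟩
        rw [← hrange] at hur
        obtain ⟨⟨x, rfl⟩, y, rfl⟩ := hur
        refine Or.inr ⟨x, y, rfl, rfl, (hCadj x y).2 ⟨huv, ?_⟩⟩
        rintro ⟨⟨i, hi⟩, j, hj⟩
        exact hboth ⟨⟨_, hi.symm⟩, _, hj.symm⟩
    · rintro (⟨x, y, hx, hy, hxy⟩ | ⟨x, y, hx, hy, hxy⟩)
      · obtain rfl : φ (e x) = u := congrArg Subtype.val hx
        obtain rfl : φ (e y) = v := congrArg Subtype.val hy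
        exact (h.adj _ _).2 (e.map_adj_iff.2 hxy)
      · obtain rfl : c x = u := congrArg Subtype.val hx
        obtain rfl : c y = v := congrArg Subtype.val hy
        exact ((hCadj x y).1 hxy).1

end Occurrence

/-- A reduction rule: an occurrence of `A` may be replaced by the smaller graph `B`, if the
parameter is decreased by `δ`. The first `t` vertices of `A` and `B` are labeled. -/
structure Rule {𝒢 : Set FinGraph} (Q : ParamGraphProblem 𝒢) where
  m : ℕ
  m' : ℕ
  t : ℕ
  δ : ℕ
  A : SimpleGraph (Fin m)
  B : SimpleGraph (Fin m')
  lt : m' < m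
  le : t ≤ m
  le' : t ≤ m'
  valid : ∃ (A' B' : BoundariedGraph t) (e : A'.graph ≃g A) (e' : B'.graph ≃g B),
    (∀ i, e (A'.label i) = Fin.castLE le i) ∧ (∀ i, e' (B'.label i) = Fin.castLE le' i) ∧
    Q.EquivBy A' B' (-δ)

namespace ParamGraphProblem

variable {𝒢 : Set FinGraph} {Q : ParamGraphProblem 𝒢}

/-- The effect of the rule `ρ` applied to the occurrence `φ`. -/
structure Replaces {V : Type} (ρ : Rule Q) (φ : Fin ρ.m → V) (G G' : SimpleGraph V)
    (U U' : Set V) : Prop where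
  -- The replacement is written onto the first `ρ.m'` vertices of the occurrence, and the other
  -- vertices of the occurrence are deleted.
  mem : ∀ i, φ i ∈ U' ↔ i < ρ.m'
  mem_iff : ∀ v, v ∉ Set.range φ → (v ∈ U' ↔ v ∈ U)
  adj : ∀ i j : Fin ρ.m', G'.Adj (φ (Fin.castLE ρ.lt.le i)) (φ (Fin.castLE ρ.lt.le j)) ↔ ρ.B.Adj i j
  adj_iff : ∀ u ∈ U', ∀ v ∈ U', ¬ (u ∈ Set.range φ ∧ v ∈ Set.range φ) → (G'.Adj u v ↔ G.Adj u v)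

/-- The old and the new graph arise by gluing the two sides of the rule to the same context `C`,
where `ρ.valid` applies. -/
theorem Replaces.sound (h𝒢 : ∀ G G' : FinGraph, Nonempty (G.graph ≃g G'.graph) → G ∈ 𝒢 → G' ∈ 𝒢)
    {V : Type} [Finite V] {ρ : Rule Q} {φ : Fin ρ.m → V} {G G' : SimpleGraph V} {U U' : Set V}
    (h : Replaces ρ φ G G' U U') (hφ : Occurs G U ρ.A ρ.t φ) :
    (FinGraph.restrict G U ∈ 𝒢 ↔ FinGraph.restrict G' U' ∈ 𝒢) ∧
    ∀ k : ℤ, Q.YesInt (FinGraph.restrict G U) k ↔ Q.YesInt (FinGraph.restrict G' U') (k - ρ.δ) := by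
  obtain ⟨A', B', e, e', he, he', hequiv⟩ := ρ.valid
  let C := rest G U ρ.le hφ.inj hφ.mem
  have hle := ρ.lt.le
  have hφ' : Occurs G' U' ρ.B ρ.t fun i => φ (Fin.castLE hle i) := by
    refine ⟨hφ.inj.comp (Fin.castLE_injective hle), fun i => (h.mem _).2 (by simp),
      fun i j => h.adj i j, fun i hi v hv hiv => ?_⟩
    have hiU : φ (Fin.castLE hle i) ∈ U' := (h.mem _).2 (by simp)
    have hvφ : v ∈ Set.range φ := by
      by_contra hvφ
      exact hvφ (hφ.nbr (Fin.castLE hle i) (by simpa using hi) v ((h.mem_iff v hvφ).1 hv)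
        ((h.adj_iff _ hiU v hv fun h => hvφ h.2).1 hiv))
    obtain ⟨j, rfl⟩ := hvφ
    exact ⟨⟨j, (h.mem j).1 hv⟩, congrArg φ (by ext; simp)⟩
  have hset : restSet U' ρ.t (fun i => φ (Fin.castLE hle i)) = restSet U ρ.t φ := by
    ext v
    by_cases hvφ : v ∈ Set.range φ
    · obtain ⟨j, rfl⟩ := hvφ
      have h1 : φ j ∈ restSet U ρ.t φ ↔ (j : ℕ) < ρ.t := by
        refine ⟨fun hj => ?_, fun hj => ⟨hφ.mem j, fun i hi hij => ?_⟩⟩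
        · by_contra hlt
          exact hj.2 j (by omega) rfl
        · rw [hφ.inj hij] at hj; omega
      have h2 := ρ.le'
      rw [h1]
      refine ⟨fun hj => ?_, fun hj => ⟨(h.mem j).2 (by omega), fun i hi hij => ?_⟩⟩
      · by_contra hlt
        have hj' := (h.mem j).1 hj.1
        exact hj.2 ⟨j, hj'⟩ (by simpa using hlt) (congrArg φ (by ext; simp))
      · have := congrArg Fin.val (hφ.inj hij)
        simp only [Fin.val_castLE] at this
        omega
    · refine ⟨fun hv => ⟨(h.mem_iff v hvφ).1 hv.1, fun i _ hi => hvφ ⟨i, hi.symm⟩⟩,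
        fun hv => ⟨(h.mem_iff v hvφ).2 hv.1, fun i _ hi => hvφ ⟨_, hi.symm⟩⟩⟩
  have hlt : ∀ i : Fin ρ.m, φ i ∈ restSet U ρ.t φ → ∃ j : Fin ρ.t, i = Fin.castLE ρ.le j := by
    intro i hi
    by_cases hit : ρ.t ≤ i
    · exact absurd rfl (hi.2 i hit)
    · exact ⟨⟨i, by omega⟩, by ext; simp⟩
  have iso₁ := hφ.glue_iso ρ.le e he (C := C) Subtype.val Subtype.val_injective
    Subtype.range_coe (fun _ => rfl) (fun _ _ => Iff.rfl)
  have iso₂ := hφ'.glue_iso ρ.le' e' he' (C := C) Subtype.val Subtype.val_injective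
    (by rw [hset]; exact Subtype.range_coe) (fun _ => rfl) (fun x y => by
      change _ ∧ ¬ ((∃ i : Fin ρ.t, x.1 = φ (Fin.castLE ρ.le i)) ∧
        ∃ i : Fin ρ.t, y.1 = φ (Fin.castLE ρ.le i)) ↔ _ ∧ ¬ ((∃ i : Fin ρ.t, x.1 =
          φ (Fin.castLE ρ.le i)) ∧ ∃ i : Fin ρ.t, y.1 = φ (Fin.castLE ρ.le i))
      refine and_congr_left fun hxy => (h.adj_iff _ ?_ _ ?_ ?_).symm
      · exact (hset.ge x.2).1
      · exact (hset.ge y.2).1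
      · rintro ⟨⟨i, hi⟩, j, hj⟩
        obtain ⟨i', rfl⟩ := hlt i (hi ▸ x.2)
        obtain ⟨j', rfl⟩ := hlt j (hj ▸ y.2)
        exact hxy ⟨⟨i', hi.symm⟩, j', hj.symm⟩)
  have hmem : ∀ {G G' : FinGraph}, Nonempty (G.graph ≃g G'.graph) → (G ∈ 𝒢 ↔ G' ∈ 𝒢) :=
    fun h => ⟨h𝒢 _ _ h, h𝒢 _ _ (h.map fun f => f.symm)⟩
  have hyes : ∀ {G G' : FinGraph} (k : ℤ), Nonempty (G.graph ≃g G'.graph) →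
      (Q.YesInt G k ↔ Q.YesInt G' k) := fun k h =>
    ⟨fun ⟨m, hm, hy⟩ => ⟨m, hm, Q.iso h hy⟩,
      fun ⟨m, hm, hy⟩ => ⟨m, hm, Q.iso (h.map fun f => f.symm) hy⟩⟩
  refine ⟨(hmem iso₁).symm.trans ((hequiv C 0).1.trans (hmem iso₂)), fun k => ?_⟩
  rw [← hyes k iso₁, (hequiv C k).2, hyes _ iso₂, sub_eq_add_neg]

/-- The pattern that a rule replaces. -/
def _root_.Rule.pattern (ρ : Rule Q) : Σ m : ℕ, ℕ × SimpleGraph (Fin m) := ⟨ρ.m, ρ.t, ρ.A⟩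

/-- There is a finite list of rules for all patterns of bounded size that can be replaced. -/
theorem exists_rules (Q : ParamGraphProblem 𝒢) (N : ℕ) :
    ∃ L : List (Rule Q), ∀ ρ : Rule Q, ρ.m ≤ N → ∃ ρ' ∈ L, ρ'.pattern = ρ.pattern := by
  let F : (Σ m : Fin (N + 1), Fin (N + 1) × SimpleGraph (Fin m)) →
      Σ m : ℕ, ℕ × SimpleGraph (Fin m) := fun p => ⟨p.1, p.2.1, p.2.2⟩
  have hfin : (Rule.pattern '' {ρ : Rule Q | ρ.m ≤ N}).Finite := by
    refine (Set.finite_range F).subset ?_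
    rintro _ ⟨ρ, hρ, rfl⟩
    have hρ : ρ.m ≤ N := hρ
    have := ρ.le
    exact ⟨⟨⟨ρ.m, by omega⟩, ⟨ρ.t, by omega⟩, ρ.A⟩, rfl⟩
  -- Whether a rule applies depends on its pattern only, so one rule for each pattern is enough.
  have hex : ∀ p : hfin.toFinset, ∃ ρ : Rule Q, ρ.pattern = p.1 := by
    rintro ⟨p, hp⟩
    obtain ⟨ρ, -, rfl⟩ := hfin.mem_toFinset.1 hp
    exact ⟨ρ, rfl⟩
  choose f hf using hex
  refine ⟨Finset.univ.toList.map f, fun ρ hρ => ?_⟩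
  have hp : ρ.pattern ∈ hfin.toFinset := hfin.mem_toFinset.2 ⟨ρ, hρ, rfl⟩
  exact ⟨f ⟨_, hp⟩, List.mem_map.2 ⟨_, by simp, rfl⟩, hf _⟩

/-- If no rule applies then there are no protrusions. -/
theorem noProtrusion_of_not_occurs
    (h𝒢 : ∀ G G' : FinGraph, (∃ f : G'.graph →g G.graph, Function.Injective f) → G ∈ 𝒢 → G' ∈ 𝒢)
    {r s N : ℕ} (hs : ∀ t ≤ r, ∀ A : BoundariedGraph t, A.toFinGraph ∈ 𝒢 →
      ∃ (B : BoundariedGraph t) (δ : ℕ), Nat.card B.V ≤ s ∧ Q.EquivBy A B (-δ))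
    {L : List (Rule Q)} (hL : ∀ ρ : Rule Q, ρ.m ≤ N → ∃ ρ' ∈ L, ρ'.pattern = ρ.pattern)
    {V : Type} [Finite V] {G : SimpleGraph V} {U : Set V} (hG : FinGraph.restrict G U ∈ 𝒢)
    (hirr : ∀ ρ ∈ L, ∀ φ, ¬ Occurs G U ρ.A ρ.t φ) :
    NoProtrusion (FinGraph.restrict G U).graph r s N := by
  intro D B hDB hnbr hBr hN
  by_contra hlt
  -- The protrusion is a boundaried graph with the vertices of `B` as labels. It has more than `s`
  -- vertices, so exchanging it for its representative is a rule.
  let A' : BoundariedGraph B.card :=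
    { V := {v // v ∈ D ∪ B}
      graph := (FinGraph.restrict G U).graph.induce {v | v ∈ D ∪ B}
      label := ⟨fun i => ⟨(B.equivFin.symm i).1, Finset.mem_union_right _ (B.equivFin.symm i).2⟩,
        fun i j h => B.equivFin.symm.injective (Subtype.ext (by simpa using h))⟩ }
  have hcard : Nat.card A'.V = D.card + B.card := by
    change Nat.card {v // v ∈ D ∪ B} = _
    rw [Nat.card_eq_fintype_card, Fintype.card_coe, Finset.card_union_of_disjoint hDB]
  have hA' : A'.toFinGraph ∈ 𝒢 :=
    h𝒢 _ _ ⟨⟨Subtype.val, fun h => h⟩, Subtype.val_injective⟩ hG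
  obtain ⟨B', δ, hB's, hequiv⟩ := hs _ hBr A' hA'
  obtain ⟨hA, GA, e, he⟩ := A'.exists_numbering
  obtain ⟨hB, GB, e', he'⟩ := B'.exists_numbering
  let ρ : Rule Q := ⟨_, _, B.card, δ, GA, GB, by omega, hA, hB, A', B', e, e', he, he', hequiv⟩
  obtain ⟨ρ', hρ', hpat⟩ := hL ρ (by change Nat.card A'.V ≤ N; omega)
  have hocc : Occurs G U GA B.card fun i => (e.symm i).1.1 := by
    refine ⟨fun i j h => e.symm.injective (Subtype.ext (Subtype.ext h)), fun i => (e.symm i).1.2,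
      fun i j => e.symm.map_adj_iff, fun i hi v hv hiv => ?_⟩
    have hiD : (e.symm i).1 ∈ D := by
      by_contra hiD
      have hiB := (Finset.mem_union.1 (e.symm i).2).resolve_left hiD
      have h0 := congrArg Subtype.val (B.equivFin.symm_apply_apply ⟨_, hiB⟩)
      have h1 : A'.label (B.equivFin ⟨_, hiB⟩) = e.symm i := Subtype.ext h0
      have h2 := he (B.equivFin ⟨_, hiB⟩)
      rw [h1, RelIso.apply_symm_apply] at h2
      rw [h2, Fin.val_castLE] at hi
      have := (B.equivFin ⟨_, hiB⟩).2
      omega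
    have hvU := hnbr _ hiD ⟨v, hv⟩ hiv
    exact ⟨e ⟨⟨v, hv⟩, hvU⟩, by simp⟩
  -- The rule in the list shares only its pattern with `ρ`; the occurrence is transported along this
  -- equality of dependent tuples.
  have key : ∀ p : Σ m : ℕ, ℕ × SimpleGraph (Fin m), p = ρ.pattern →
      ∃ φ : Fin p.1 → V, Occurs G U p.2.2 p.2.1 φ := by
    rintro _ rfl
    exact ⟨_, hocc⟩
  obtain ⟨φ, hφ⟩ := key _ hpat
  exact hirr ρ' hρ' φ hφ

end ParamGraphProblem

end Replacement

/-! ## A program logic for random access machines -/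

namespace RAM

section Logic

open scoped Classical

@[simp] theorem State.setReg_reg (s : State) (x a r : ℕ) :
    (s.setReg x a).reg r = if r = x then a else s.reg r := Function.update_apply _ _ _ _

@[simp] theorem State.setReg_mem (s : State) (x a : ℕ) : (s.setReg x a).mem = s.mem := rfl

@[simp] theorem State.setMem_reg (s : State) (x a : ℕ) : (s.setMem x a).reg = s.reg := rfl

@[simp] theorem State.setMem_mem (s : State) (x a r : ℕ) :
    (s.setMem x a).mem r = if r = x then a else s.mem r := Function.update_apply _ _ _ _

theorem State.ext_of {s s' : State} (h : ∀ r, s.reg r = s'.reg r) (h' : s.mem = s'.mem) :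
    s = s' := by
  obtain ⟨r, m⟩ := s
  obtain ⟨r', m'⟩ := s'
  obtain rfl : r = r' := funext h
  obtain rfl : m = m' := h'
  rfl

/-- Started in a state with `pre` and a one in register `2`, the program halts after a number of
steps that is polynomial in register `0`; registers `0` and `2` are kept, and the first and the
last state are related by `R`. -/
def Spec (P : Prog) (pre : State → Prop) (R : State → State → Prop) : Prop :=
  -- The bound is evaluated at any `N` above register `0`, so no monotonicity of polynomials is
  -- needed. Register `1` holds the parameter, `3` a flag, `4` and `5` are scratch, `8` to `11`
  -- serve loops, and in the reduction the registers from `12` on hold alternately the entries of a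
  -- tuple and their loop counters.
  ∃ p : Polynomial ℕ, ∀ N s, s.reg 0 ≤ N → s.reg 2 = 1 → pre s →
    ∃ m s', Run P s m s' ∧ m ≤ p.eval N ∧ s'.reg 0 = s.reg 0 ∧ s'.reg 2 = 1 ∧ R s s'

variable {P P' : Prog} {pre pre' : State → Prop} {R R' : State → State → Prop}

theorem Spec.conseq (h : Spec P pre R) (hpre : ∀ s, pre' s → pre s)
    (hR : ∀ s s', pre' s → s'.reg 0 = s.reg 0 → R s s' → R' s s') : Spec P pre' R' := by
  obtain ⟨p, hp⟩ := h
  refine ⟨p, fun N s hN h2 hs => ?_⟩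
  obtain ⟨m, s', hrun, hm, h0, h2', h⟩ := hp N s hN h2 (hpre s hs)
  exact ⟨m, s', hrun, hm, h0, h2', hR s s' hs h0 h⟩

theorem Spec.of_run (f : State → State) (hrun : ∀ s, Run P s 1 (f s))
    (h0 : ∀ s, (f s).reg 0 = s.reg 0) (h2 : ∀ s, (f s).reg 2 = s.reg 2) :
    Spec P pre fun s s' => s' = f s :=
  ⟨1, fun _ s _ hs _ => ⟨1, f s, hrun s, by simp, h0 s, (h2 s).trans hs, rfl⟩⟩

theorem Spec.skip : Spec .skip pre fun s s' => s' = s :=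
  Spec.of_run id Run.skip (fun _ => rfl) fun _ => rfl

theorem Spec.const {x c : ℕ} (h0 : 0 ≠ x) (h2 : 2 ≠ x) :
    Spec (.const x c) pre fun s s' => s' = s.setReg x c :=
  Spec.of_run _ (Run.const x c) (by simp [h0]) (by simp [h2])

theorem Spec.copy {x y : ℕ} (h0 : 0 ≠ x) (h2 : 2 ≠ x) :
    Spec (.copy x y) pre fun s s' => s' = s.setReg x (s.reg y) :=
  Spec.of_run _ (Run.copy x y) (by simp [h0]) (by simp [h2])

theorem Spec.add {x y z : ℕ} (h0 : 0 ≠ x) (h2 : 2 ≠ x) :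
    Spec (.add x y z) pre fun s s' => s' = s.setReg x (s.reg y + s.reg z) :=
  Spec.of_run _ (Run.add x y z) (by simp [h0]) (by simp [h2])

theorem Spec.sub {x y z : ℕ} (h0 : 0 ≠ x) (h2 : 2 ≠ x) :
    Spec (.sub x y z) pre fun s s' => s' = s.setReg x (s.reg y - s.reg z) :=
  Spec.of_run _ (Run.sub x y z) (by simp [h0]) (by simp [h2])

theorem Spec.load {x y : ℕ} (h0 : 0 ≠ x) (h2 : 2 ≠ x) :
    Spec (.load x y) pre fun s s' => s' = s.setReg x (s.mem (s.reg y)) :=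
  Spec.of_run _ (Run.load x y) (by simp [h0]) (by simp [h2])

theorem Spec.store {x y : ℕ} :
    Spec (.store x y) pre fun s s' => s' = s.setMem (s.reg x) (s.reg y) :=
  Spec.of_run _ (Run.store x y) (by simp) (by simp)

theorem Spec.seq (h : Spec P pre R) (h' : Spec P' pre' R')
    (hpre : ∀ s s', pre s → s'.reg 0 = s.reg 0 → R s s' → pre' s') :
    Spec (.seq P P') pre fun s s'' => ∃ s', s'.reg 0 = s.reg 0 ∧ s'.reg 2 = 1 ∧ R s s' ∧ R' s' s'' := by
  obtain ⟨p, hp⟩ := h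
  obtain ⟨q, hq⟩ := h'
  refine ⟨p + q, fun N s hN h2 hs => ?_⟩
  obtain ⟨m, s', hrun, hm, h0, h2', h⟩ := hp N s hN h2 hs
  obtain ⟨m', s'', hrun', hm', h0', h2'', h'⟩ := hq N s' (h0 ▸ hN) h2' (hpre s s' hs h0 h)
  refine ⟨m + m', s'', hrun.seq hrun', ?_, h0'.trans h0, h2'', s', h0, h2', h, h'⟩
  rw [Polynomial.eval_add]
  omega

theorem Spec.cond {x : ℕ} (h : Spec P (fun s => pre s ∧ s.reg x ≠ 0) R)
    (h' : Spec P' (fun s => pre s ∧ s.reg x = 0) R') :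
    Spec (.cond x P P') pre fun s s' => (s.reg x ≠ 0 ∧ R s s') ∨ (s.reg x = 0 ∧ R' s s') := by
  obtain ⟨p, hp⟩ := h
  obtain ⟨q, hq⟩ := h'
  refine ⟨p + q + 1, fun N s hN h2 hs => ?_⟩
  simp only [Polynomial.eval_add, Polynomial.eval_one]
  by_cases hx : s.reg x = 0
  · obtain ⟨m, s', hrun, hm, h0, h2', h⟩ := hq N s hN h2 ⟨hs, hx⟩
    exact ⟨m + 1, s', .condZero hx hrun, by omega, h0, h2', Or.inr ⟨hx, h⟩⟩
  · obtain ⟨m, s', hrun, hm, h0, h2', h⟩ := hp N s hN h2 ⟨hs, hx⟩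
    exact ⟨m + 1, s', .condPos hx hrun, by omega, h0, h2', Or.inl ⟨hx, h⟩⟩

/-- `for x < reg 0 do P`, counting down in register `c` -/
def forN (x c : ℕ) (P : Prog) : Prog :=
  .seq (.const x 0) (.seq (.copy c 0) (.loop c (.seq P (.seq (.add x x 2) (.sub c c 2)))))

/-- The machine tests only for zero, so `c` counts down while `x` counts up. The invariant ignores
both registers, and the body must preserve them. -/
theorem Spec.forN {x c : ℕ} {preb : State → Prop} {Rb : State → State → Prop}
    (hP : Spec P preb Rb) (Inv : State → ℕ → State → Prop)
    (hx0 : 0 ≠ x) (hx2 : 2 ≠ x) (hc0 : 0 ≠ c) (hc2 : 2 ≠ c) (hxc : x ≠ c)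
    (hInv : ∀ s₀ j s a b, Inv s₀ j s → Inv s₀ j ((s.setReg x a).setReg c b))
    (hstart : ∀ s, pre s → Inv s 0 s)
    (hpre : ∀ s₀ j s, pre s₀ → s.reg 0 = s₀.reg 0 → Inv s₀ j s → s.reg x = j → j < s₀.reg 0 → preb s)
    (hstep : ∀ s₀ j s s', pre s₀ → s.reg 0 = s₀.reg 0 → Inv s₀ j s → s.reg x = j → j < s₀.reg 0 →
      Rb s s' → Inv s₀ (j + 1) s' ∧ s'.reg x = s.reg x ∧ s'.reg c = s.reg c) :
    Spec (forN x c P) pre fun s s' => Inv s (s.reg 0) s' := by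
  obtain ⟨p, hp⟩ := hP
  have key : ∀ N s₀, pre s₀ → s₀.reg 0 ≤ N → ∀ k j s, j + k = s₀.reg 0 → s.reg 0 = s₀.reg 0 →
      s.reg 2 = 1 → s.reg x = j → s.reg c = k → Inv s₀ j s →
      ∃ m s', Run (.loop c (.seq P (.seq (.add x x 2) (.sub c c 2)))) s m s' ∧
        m ≤ k * (p.eval N + 3) + 1 ∧ s'.reg 0 = s₀.reg 0 ∧ s'.reg 2 = 1 ∧
        Inv s₀ (s₀.reg 0) s' := by
    intro N s₀ hpre₀ hN k
    induction k with
    | zero =>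
      intro j s hj h0 h2 hx hc hI
      obtain rfl : j = s₀.reg 0 := by omega
      exact ⟨1, s, .loopZero hc, by omega, h0, h2, hI⟩
    | succ k ih =>
      intro j s hj h0 h2 hx hc hI
      have hjn : j < s₀.reg 0 := by omega
      obtain ⟨m, s', hrun, hm, h0', h2', hR⟩ := hp N s (h0 ▸ hN) h2
        (hpre s₀ j s hpre₀ h0 hI hx hjn)
      obtain ⟨hI', hx', hc'⟩ := hstep s₀ j s s' hpre₀ h0 hI hx hjn hR
      obtain ⟨m', s'', hrun', hm', h0'', h2'', hI''⟩ := ih (j + 1)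
        ((s'.setReg x (s'.reg x + s'.reg 2)).setReg c
          ((s'.setReg x (s'.reg x + s'.reg 2)).reg c - (s'.setReg x (s'.reg x + s'.reg 2)).reg 2))
        (by omega) (by simp [hc0, hx0, h0', h0]) (by simp [hc2, hx2, h2'])
        (by simp [hxc, hx', hx, h2']) (by simp [hxc.symm, hx2, hc', hc, h2'])
        (hInv _ _ _ _ _ hI')
      refine ⟨m + (1 + 1) + m' + 1, s'', .loopPos (by omega)
        (hrun.seq ((Run.add x x 2 s').seq (Run.sub c c 2 _))) hrun', ?_, h0'', h2'', hI''⟩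
      rw [add_mul, one_mul]
      omega
  refine ⟨Polynomial.X * (p + 3) + 3, fun N s hN h2 hs => ?_⟩
  obtain ⟨m, s', hrun, hm, h0, h2', hI⟩ := key N s hs hN (s.reg 0) 0
    ((s.setReg x 0).setReg c ((s.setReg x 0).reg 0)) (by omega) (by simp [hc0, hx0])
    (by simp [hc2, hx2, h2]) (by simp [hxc]) (by simp [hx0]) (hInv _ _ _ _ _ (hstart s hs))
  refine ⟨1 + (1 + m), s', (Run.const x 0 s).seq ((Run.copy c 0 _).seq hrun), ?_, h0, h2', hI⟩
  have h3 : Polynomial.eval N (3 : Polynomial ℕ) = 3 := Polynomial.eval_ofNat 3 N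
  rw [Polynomial.eval_add, Polynomial.eval_mul, Polynomial.eval_X, Polynomial.eval_add, h3]
  have := Nat.mul_le_mul_right (p.eval N + 3) hN
  omega

/-- `reg 4 := reg i * reg 0 + reg j`, the address of an entry of the matrix -/
def addr (i j : ℕ) : Prog :=
  .seq (.copy 4 j) (.seq (.copy 5 i) (.loop 5 (.seq (.add 4 4 0) (.sub 5 5 2))))

/-- Multiplication is repeated addition; the bound on the row index keeps the running time
polynomial. The row may not be in register `4`, which is overwritten by the column first. -/
theorem Spec.addr {i j : ℕ} (hi : i ≠ 4) :
    Spec (addr i j) (fun s => s.reg i ≤ s.reg 0)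
      fun s s' => s' = (s.setReg 4 (s.reg i * s.reg 0 + s.reg j)).setReg 5 0 := by
  have key : ∀ k s, s.reg 2 = 1 → s.reg 5 = k →
      Run (.loop 5 (.seq (.add 4 4 0) (.sub 5 5 2))) s (3 * k + 1)
        ((s.setReg 4 (k * s.reg 0 + s.reg 4)).setReg 5 0) := by
    intro k
    induction k with
    | zero =>
      intro s _ hs
      have : (s.setReg 4 (0 * s.reg 0 + s.reg 4)).setReg 5 0 = s :=
        State.ext_of (fun r => by simp only [State.setReg_reg]; split_ifs <;> simp_all) rfl
      rw [this]
      exact .loopZero hs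
    | succ k ih =>
      intro s h2 hs
      have hrun := Run.loopPos (x := 5) (by omega) ((Run.add 4 4 0 s).seq (Run.sub 5 5 2 _))
        (ih _ (by simp [h2]) (by simp [h2, hs]))
      have hm : 3 * (k + 1) + 1 = 1 + 1 + (3 * k + 1) + 1 := by ring
      rw [hm]
      convert hrun using 1
      refine State.ext_of (fun r => ?_) rfl
      simp only [State.setReg_reg]
      by_cases h5 : r = 5
      · simp [h5]
      by_cases h4 : r = 4
      · simp [h4]; ring
      simp [h4, h5]
  refine ⟨3 * Polynomial.X + 3, fun N s hN h2 hs => ?_⟩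
  have hrun := (Run.copy 4 j s).seq ((Run.copy 5 i _).seq
    (key (s.reg i) ((s.setReg 4 (s.reg j)).setReg 5 ((s.setReg 4 (s.reg j)).reg i))
      (by simp [h2]) (by simp [hi])))
  refine ⟨_, _, hrun, ?_, by simp, by simp [h2], ?_⟩
  · have h3 : Polynomial.eval N (3 : Polynomial ℕ) = 3 := Polynomial.eval_ofNat 3 N
    rw [Polynomial.eval_add, Polynomial.eval_mul, Polynomial.eval_X, h3]
    omega
  · refine State.ext_of (fun r => ?_) rfl
    simp only [State.setReg_reg]
    split_ifs <;> simp_all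

/-! ### Tests -/

/-- Only registers from `3` to `k - 1` are changed. -/
def Fr (k : ℕ) (s s' : State) : Prop :=
  s'.mem = s.mem ∧ ∀ r, r < 3 ∨ k ≤ r → s'.reg r = s.reg r

theorem Fr.refl {k : ℕ} (s : State) : Fr k s s := ⟨rfl, fun _ _ => rfl⟩

theorem Fr.trans {k : ℕ} {s s' s'' : State} (h : Fr k s s') (h' : Fr k s' s'') : Fr k s s'' :=
  ⟨h'.1.trans h.1, fun r hr => (h'.2 r hr).trans (h.2 r hr)⟩

theorem Fr.mono {k l : ℕ} {s s' : State} (h : Fr k s s') (hkl : k ≤ l) : Fr l s s' :=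
  ⟨h.1, fun r hr => h.2 r (by omega)⟩

/-- The property `b` does not depend on registers from `3` to `k - 1`. -/
def Stable (k : ℕ) (b : State → Prop) : Prop := ∀ s s', Fr k s s' → (b s ↔ b s')

theorem Stable.mono {k l : ℕ} {b : State → Prop} (h : Stable l b) (hkl : k ≤ l) : Stable k b :=
  fun s s' hs => h s s' (hs.mono hkl)

/-- The program decides `c`, with the answer in register `4`. -/
def Dec (pre : State → Prop) (D : Prog) (c : State → Prop) : Prop :=
  Spec D pre fun s s' => Fr 8 s s' ∧ s'.reg 3 = s.reg 3 ∧ (s'.reg 4 ≠ 0 ↔ c s)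

/-- The program clears the flag in register `3` if `b` fails. -/
def IsTest (k : ℕ) (pre : State → Prop) (P : Prog) (b : State → Prop) : Prop :=
  Spec P pre fun s s' => Fr k s s' ∧ (b s → s'.reg 3 = s.reg 3) ∧ (¬ b s → s'.reg 3 = 0)

variable {k : ℕ} {b b' c : State → Prop} {D : Prog}

theorem IsTest.mono {l : ℕ} (h : IsTest k pre P b) (hkl : k ≤ l) : IsTest l pre P b :=
  h.conseq (fun _ h => h) fun _ _ _ _ h => ⟨h.1.mono hkl, h.2⟩

theorem IsTest.congr (h : IsTest k pre P b) (hb : ∀ s, pre s → (b s ↔ b' s)) :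
    IsTest k pre P b' :=
  h.conseq (fun _ h => h) fun s s' hs _ h => ⟨h.1, by rw [← hb s hs]; exact h.2⟩

/-- A test never sets the flag, so a sequence of tests decides the conjunction. Stability is needed
because the first test alters scratch registers. -/
theorem IsTest.and (h : IsTest k pre P b) (h' : IsTest k pre P' b') (hpre : Stable k pre)
    (hb : Stable k b') : IsTest k pre (.seq P P') fun s => b s ∧ b' s := by
  refine (Spec.seq h h' fun s s' hs _ hR => (hpre s s' hR.1).1 hs).conseq (fun _ h => h) ?_
  rintro s s'' - - ⟨s', -, -, ⟨h1, h2, h2'⟩, h3, h4, h4'⟩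
  refine ⟨h1.trans h3, fun h => (h4 ((hb s s' h1).1 h.2)).trans (h2 h.1), fun h => ?_⟩
  by_cases h6 : b' s
  · rw [h4 ((hb s s' h1).1 h6), h2' fun h5 => h ⟨h5, h6⟩]
  · exact h4' fun h => h6 ((hb s s' h1).2 h)

/-- The sequence of the programs in a list -/
def seqs : List Prog → Prog
  | [] => .skip
  | P :: L => .seq P (seqs L)

theorem IsTest.all {α : Type*} (L : List α) {F : α → Prog} {f : α → State → Prop}
    (hpre : Stable k pre) (h : ∀ a ∈ L, IsTest k pre (F a) (f a)) (hf : ∀ a ∈ L, Stable k (f a)) :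
    IsTest k pre (seqs (L.map F)) fun s => ∀ a ∈ L, f a s := by
  induction L with
  | nil =>
    refine Spec.skip.conseq (fun _ h => h) ?_
    rintro s s' - - rfl
    exact ⟨Fr.refl _, by simp⟩
  | cons a L ih =>
    have ih' := ih (fun a ha => h a (by simp [ha])) fun a ha => hf a (by simp [ha])
    refine ((h a (by simp)).and ih' hpre ?_).congr fun s _ => by simp
    exact fun s s' hs => forall₂_congr fun a ha => hf a (by simp [ha]) s s' hs

theorem Dec.isTest (h : Dec pre D c) :
    IsTest 8 pre (.seq D (.cond 4 .skip (.const 3 0))) c := by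
  refine (Spec.seq h (Spec.cond (pre := fun _ => True) Spec.skip
    (Spec.const (by norm_num) (by norm_num))) fun _ _ _ _ _ => trivial).conseq (fun _ h => h) ?_
  rintro s s'' - - ⟨s', -, -, ⟨h1, h3, h4⟩, ⟨h5, rfl⟩ | ⟨h5, rfl⟩⟩
  · exact ⟨h1, fun _ => h3, fun h => absurd (h4.1 h5) h⟩
  · refine ⟨⟨h1.1, fun r hr => ?_⟩, fun h => absurd h5 (h4.2 h), fun _ => by simp⟩
    rw [State.setReg_reg, if_neg (by omega), h1.2 r hr]

theorem Dec.isTest_not (h : Dec pre D c) :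
    IsTest 8 pre (.seq D (.cond 4 (.const 3 0) .skip)) fun s => ¬ c s := by
  refine (Spec.seq h (Spec.cond (pre := fun _ => True)
    (Spec.const (by norm_num) (by norm_num)) Spec.skip) fun _ _ _ _ _ => trivial).conseq
    (fun _ h => h) ?_
  rintro s s'' - - ⟨s', -, -, ⟨h1, h3, h4⟩, ⟨h5, rfl⟩ | ⟨h5, rfl⟩⟩
  · refine ⟨⟨h1.1, fun r hr => ?_⟩, fun h => absurd (h4.1 h5) h, fun _ => by simp⟩
    rw [State.setReg_reg, if_neg (by omega), h1.2 r hr]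
  · exact ⟨h1, fun _ => h3, fun h => absurd h5 (h4.2 (not_not.1 h))⟩

theorem Dec.or_isTest (h : Dec pre D c) (h' : IsTest 8 pre P b) (hpre : Stable 8 pre)
    (hb : Stable 8 b) : IsTest 8 pre (.seq D (.cond 4 .skip P)) fun s => c s ∨ b s := by
  refine (Spec.seq h (Spec.cond (pre := pre) Spec.skip (Spec.conseq h' (fun _ h => h.1)
    fun _ _ _ _ h => h)) fun s s' hs _ hR => (hpre s s' hR.1).1 hs).conseq (fun _ h => h) ?_
  rintro s s'' - - ⟨s', -, -, ⟨h1, h3, h4⟩, ⟨h5, rfl⟩ | ⟨h5, h6, h7, h8⟩⟩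
  · exact ⟨h1, fun _ => h3, fun h => absurd (Or.inl (h4.1 h5)) h⟩
  · refine ⟨h1.trans h6, fun h => ?_, fun h => h8 fun hb' => h (Or.inr ((hb s s' h1).2 hb'))⟩
    exact (h7 ((hb s s' h1).1 (h.resolve_left fun h => h4.2 h h5))).trans h3

/-- Skip the test `P` if one of the conditions is met. -/
def skipIf (P : Prog) : List Prog → Prog
  | [] => P
  | D :: L => .seq D (.cond 4 .skip (skipIf P L))

theorem IsTest.skipIf {α : Type*} (L : List α) {F : α → Prog} {f : α → State → Prop}
    (hP : IsTest 8 pre P b) (hpre : Stable 8 pre) (hb : Stable 8 b)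
    (h : ∀ a ∈ L, Dec pre (F a) (f a)) (hf : ∀ a ∈ L, Stable 8 (f a)) :
    IsTest 8 pre (skipIf P (L.map F)) fun s => (∃ a ∈ L, f a s) ∨ b s := by
  induction L with
  | nil => exact hP.congr fun s _ => by simp
  | cons a L ih =>
    have ih' := ih (fun a ha => h a (by simp [ha])) fun a ha => hf a (by simp [ha])
    refine ((h a (by simp)).or_isTest ih' hpre ?_).congr fun s _ => by simp [or_assoc]
    intro s s' hs
    have h1 : (∃ a ∈ L, f a s) ↔ ∃ a ∈ L, f a s' :=
      exists_congr fun a => and_congr_right fun ha => hf a (by simp [ha]) s s' hs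
    exact or_congr h1 (hb s s' hs)

/-- Register `9` is the bound variable: `b` may depend on it, but not on the counter in register
`8`. The flag survives only if every round leaves it. -/
theorem IsTest.forN (h : IsTest 8 (fun s => pre s ∧ s.reg 9 < s.reg 0) P b) (hpre : Stable 10 pre)
    (hb : Stable 9 b) :
    IsTest 10 pre (forN 9 8 P) fun s => ∀ v < s.reg 0, b (s.setReg 9 v) := by
  refine Spec.conseq (Spec.forN (pre := pre) h (fun s₀ j s => Fr 10 s₀ s ∧
    ((∀ v < j, b (s₀.setReg 9 v)) → s.reg 3 = s₀.reg 3) ∧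
    (¬ (∀ v < j, b (s₀.setReg 9 v)) → s.reg 3 = 0)) (by norm_num) (by norm_num)
    (by norm_num) (by norm_num) (by norm_num) ?_ ?_ ?_ ?_) (fun _ h => h) fun _ _ _ _ h => h
  · rintro s₀ j s x y ⟨h1, h2⟩
    refine ⟨⟨h1.1, fun r hr => ?_⟩, by simpa using h2⟩
    rw [State.setReg_reg, State.setReg_reg, if_neg (by omega), if_neg (by omega), h1.2 r hr]
  · intro s _
    exact ⟨Fr.refl _, fun _ => rfl, fun h => absurd (fun v hv => absurd hv (by omega)) h⟩
  · rintro s₀ j s hs₀ h0 ⟨h1, -⟩ hx hj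
    exact ⟨(hpre s₀ s h1).1 hs₀, by omega⟩
  · rintro s₀ j s s' hs₀ h0 ⟨h1, h2, h2'⟩ hx hj ⟨h3, h4, h4'⟩
    refine ⟨⟨h1.trans (h3.mono (by norm_num)), ?_⟩, h3.2 9 (by norm_num), h3.2 8 (by norm_num)⟩
    have hbs : b (s₀.setReg 9 j) ↔ b s := by
      refine hb _ _ ⟨h1.1, fun r hr => ?_⟩
      rw [State.setReg_reg]
      split_ifs with h9
      · rw [h9, hx]
      · exact h1.2 r (by omega)
    rw [Nat.forall_lt_succ_right, hbs]
    refine ⟨fun h => (h4 h.2).trans (h2 h.1), fun h => ?_⟩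
    by_cases h6 : b s
    · rw [h4 h6, h2' fun h5 => h ⟨h5, h6⟩]
    · exact h4' h6

/-- Decide whether two registers are equal. -/
def eqDec (i j : ℕ) : Prog :=
  .seq (.sub 4 i j) (.seq (.sub 5 j i) (.seq (.add 4 4 5) (.sub 4 2 4)))

/-- With truncated subtraction, the sum of the two differences is zero only for equal values;
subtracting it from one turns this into the answer. -/
theorem Dec.eqDec {i j : ℕ} (hi : 8 ≤ i) (hj : 8 ≤ j) :
    Dec pre (eqDec i j) fun s => s.reg i = s.reg j := by
  refine (Spec.seq (Spec.sub (by norm_num) (by norm_num)) (Spec.seq (pre := fun _ => True)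
    (Spec.sub (by norm_num) (by norm_num)) (Spec.seq (pre := fun _ => True)
    (Spec.add (by norm_num) (by norm_num)) (Spec.sub (pre := fun _ => True) (by norm_num)
    (by norm_num)) ?_) ?_) ?_).conseq (fun _ h => h) ?_
  · simp
  · simp
  · simp
  rintro s s' - - ⟨_, -, -, rfl, _, -, -, rfl, _, -, h2, rfl, rfl⟩
  have h4 : i ≠ 4 := by omega
  have h4' : j ≠ 4 := by omega
  have h5 : i ≠ 5 := by omega
  refine ⟨⟨rfl, fun r hr => ?_⟩, by simp, ?_⟩
  · simp only [State.setReg_reg]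
    rw [if_neg (by omega), if_neg (by omega), if_neg (by omega), if_neg (by omega)]
  · simp only [State.setReg_reg] at h2 ⊢
    simp [h4, h4'] at h2 ⊢
    rw [h2]
    omega

/-- Decide whether an entry of the matrix is not zero. -/
def readDec (i j : ℕ) : Prog := .seq (addr i j) (.load 4 4)

theorem Dec.readDec {i j : ℕ} (hi : 8 ≤ i) (hpre : ∀ s, pre s → s.reg i ≤ s.reg 0) :
    Dec pre (readDec i j) fun s => s.mem (s.reg i * s.reg 0 + s.reg j) ≠ 0 := by
  refine (Spec.seq (pre := pre) ((Spec.addr (by omega)).conseq hpre fun _ _ _ _ h => h)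
    (Spec.load (pre := fun _ => True) (by norm_num) (by norm_num)) (by simp)).conseq
    (fun _ h => h) ?_
  rintro s s' - - ⟨_, -, -, rfl, rfl⟩
  refine ⟨⟨rfl, fun r hr => ?_⟩, by simp, by simp⟩
  simp only [State.setReg_reg]
  rw [if_neg (by omega), if_neg (by omega), if_neg (by omega)]

/-- Write the constant `c` into the matrix. -/
def write (i j c : ℕ) : Prog := .seq (addr i j) (.seq (.const 5 c) (.store 4 5))

theorem Spec.write {i j c : ℕ} (hi : 8 ≤ i) :
    Spec (write i j c) (fun s => s.reg i ≤ s.reg 0) fun s s' =>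
      s'.mem = Function.update s.mem (s.reg i * s.reg 0 + s.reg j) c ∧
        ∀ r, r < 3 ∨ 8 ≤ r → s'.reg r = s.reg r := by
  refine (Spec.seq (Spec.addr (by omega)) (Spec.seq (pre := fun _ => True)
    (Spec.const (by norm_num) (by norm_num)) (Spec.store (pre := fun _ => True)) (by simp))
    (by simp)).conseq (fun _ h => h) ?_
  rintro s s' - - ⟨_, -, -, rfl, _, -, -, rfl, rfl⟩
  refine ⟨?_, fun r hr => ?_⟩
  · simp [State.setMem, State.setReg]
  · simp only [State.setMem_reg, State.setReg_reg]
    rw [if_neg (by omega), if_neg (by omega), if_neg (by omega)]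

end Logic

end RAM

/-! ## Applying a rule to the matrix in the memory -/

namespace RAM

section RuleProgram

open scoped Classical

variable {𝒢 : Set FinGraph} {Q : ParamGraphProblem 𝒢}

/-- The vertices `φ i` form an occurrence of the pattern of `ρ` in the graph in the memory, a
matrix with `n` rows. Vertices with a diagonal entry that is not zero have been deleted. -/
structure OccursMem (ρ : Rule Q) (n : ℕ) (mem : ℕ → ℕ) (φ : Fin ρ.m → ℕ) : Prop where
  inj : ∀ i j, i ≠ j → φ i ≠ φ j
  -- For `i = j` this says that `φ i` has not been deleted, since `ρ.A` has no loops.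
  adj : ∀ i j, mem (φ i * n + φ j) ≠ 0 ↔ ρ.A.Adj i j
  nbr : ∀ v < n, mem (v * n + v) ≠ 0 ∨ (∃ i, v = φ i) ∨
    ∀ j : Fin ρ.m, ρ.t ≤ j → mem (φ j * n + v) = 0

/-- The values of the registers that hold the images of the vertices of a pattern. -/
def State.tuple (s : State) (m : ℕ) (i : Fin m) : ℕ := s.reg (12 + 2 * i)

theorem Fr.tuple {k : ℕ} (hk : k ≤ 12) {s s' : State} (h : Fr k s s') (m : ℕ) :
    s'.tuple m = s.tuple m := funext fun _ => h.2 _ (Or.inr (by omega))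

/-- All images of vertices of the pattern are vertices. -/
def TupleLt (m : ℕ) (s : State) : Prop := ∀ i, s.tuple m i < s.reg 0

theorem stable_tupleLt {k : ℕ} (hk : k ≤ 12) (m : ℕ) : Stable k (TupleLt m) := fun s s' h => by
  rw [TupleLt, TupleLt, h.tuple hk, h.2 0 (by norm_num)]

noncomputable def testInj (m : ℕ) : Prog :=
  seqs ((Finset.univ.offDiag : Finset (Fin m × Fin m)).toList.map fun p =>
    .seq (eqDec (12 + 2 * p.1) (12 + 2 * p.2)) (.cond 4 (.const 3 0) .skip))

theorem isTest_testInj (m : ℕ) :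
    IsTest 10 (TupleLt m) (testInj m) fun s => ∀ i j, i ≠ j → s.tuple m i ≠ s.tuple m j := by
  refine (IsTest.all _ (f := fun p s => ¬ s.tuple m p.1 = s.tuple m p.2)
    (stable_tupleLt (by norm_num) m) (fun p _ => ?_) fun p _ s s' h => ?_).congr fun s _ => ?_
  · exact (Dec.eqDec (by omega) (by omega)).isTest_not.mono (by norm_num)
  · beta_reduce; rw [h.tuple (by norm_num)]
  · simp

noncomputable def testAdj {m : ℕ} (A : SimpleGraph (Fin m)) : Prog :=
  seqs ((Finset.univ : Finset (Fin m × Fin m)).toList.map fun p =>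
    .seq (readDec (12 + 2 * p.1) (12 + 2 * p.2))
      (if A.Adj p.1 p.2 then .cond 4 .skip (.const 3 0) else .cond 4 (.const 3 0) .skip))

theorem isTest_testAdj {m : ℕ} (A : SimpleGraph (Fin m)) :
    IsTest 10 (TupleLt m) (testAdj A) fun s =>
      ∀ i j, s.mem (s.tuple m i * s.reg 0 + s.tuple m j) ≠ 0 ↔ A.Adj i j := by
  refine (IsTest.all _ (f := fun p s =>
    s.mem (s.tuple m p.1 * s.reg 0 + s.tuple m p.2) ≠ 0 ↔ A.Adj p.1 p.2)
    (stable_tupleLt (by norm_num) m) (fun p _ => ?_) fun p _ s s' h => ?_).congr fun s _ => ?_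
  · have hdec : Dec (TupleLt m) (readDec (12 + 2 * p.1) (12 + 2 * p.2))
        fun s => s.mem (s.tuple m p.1 * s.reg 0 + s.tuple m p.2) ≠ 0 :=
      Dec.readDec (by omega) fun s hs => (hs p.1).le
    split_ifs with h
    · exact (hdec.isTest.mono (by norm_num)).congr fun s _ => by simp [h]
    · exact (hdec.isTest_not.mono (by norm_num)).congr fun s _ => by simp [h]
  · beta_reduce; rw [h.tuple (by norm_num), h.1, h.2 0 (by norm_num)]
  · simp

noncomputable def testNbr (m t : ℕ) : Prog :=
  forN 9 8 (.seq (readDec 9 9) (.cond 4 .skip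
    (skipIf (seqs (((Finset.univ : Finset (Fin m)).filter fun j => t ≤ j.1).toList.map fun j : Fin m =>
        .seq (readDec (12 + 2 * j) 9) (.cond 4 (.const 3 0) .skip)))
      ((Finset.univ : Finset (Fin m)).toList.map fun i : Fin m => eqDec 9 (12 + 2 * i)))))

theorem isTest_testNbr (m t : ℕ) :
    IsTest 10 (TupleLt m) (testNbr m t) fun s => ∀ v < s.reg 0, s.mem (v * s.reg 0 + v) ≠ 0 ∨
      (∃ i, v = s.tuple m i) ∨ ∀ j : Fin m, t ≤ j → s.mem (s.tuple m j * s.reg 0 + v) = 0 := by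
  have hpre : Stable 8 fun s => TupleLt m s ∧ s.reg 9 < s.reg 0 := fun s s' h =>
    and_congr (stable_tupleLt (by norm_num) m s s' h)
      (by rw [h.2 9 (by norm_num), h.2 0 (by norm_num)])
  have h1 : IsTest 8 (fun s => TupleLt m s ∧ s.reg 9 < s.reg 0)
      (seqs (((Finset.univ : Finset (Fin m)).filter fun j => t ≤ j.1).toList.map fun j : Fin m =>
        .seq (readDec (12 + 2 * j) 9) (.cond 4 (.const 3 0) .skip)))
      fun s => ∀ j : Fin m, t ≤ j → s.mem (s.tuple m j * s.reg 0 + s.reg 9) = 0 := by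
    refine (IsTest.all _ (f := fun j s => ¬ s.mem (s.tuple m j * s.reg 0 + s.reg 9) ≠ 0)
      hpre (fun j _ => ?_) fun j _ s s' h => ?_).congr fun s _ => ?_
    · exact (Dec.readDec (by omega) fun s hs => (hs.1 j).le).isTest_not
    · beta_reduce; rw [h.tuple (by norm_num), h.1, h.2 0 (by norm_num), h.2 9 (by norm_num)]
    · simp
  have hs1 : Stable 9 fun s => ∀ j : Fin m, t ≤ j → s.mem (s.tuple m j * s.reg 0 + s.reg 9) = 0 :=
    fun s s' h => by
      simp only [h.tuple (show 9 ≤ 12 by norm_num), h.1, h.2 0 (by norm_num), h.2 9 (by norm_num)]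
  have h2 := h1.skipIf (Finset.univ : Finset (Fin m)).toList
    (f := fun i s => s.reg 9 = s.tuple m i) hpre (hs1.mono (by norm_num))
    (fun i _ => Dec.eqDec (by norm_num) (by omega)) fun i _ s s' h => by
      beta_reduce; rw [h.tuple (by norm_num), h.2 9 (by norm_num)]
  have hs2 : Stable 9 fun s => (∃ i ∈ (Finset.univ : Finset (Fin m)).toList,
      s.reg 9 = s.tuple m i) ∨
      ∀ j : Fin m, t ≤ j → s.mem (s.tuple m j * s.reg 0 + s.reg 9) = 0 := fun s s' h =>
    or_congr (by simp only [h.tuple (show 9 ≤ 12 by norm_num), h.2 9 (by norm_num)]) (hs1 s s' h)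
  have h3 := (Dec.readDec (i := 9) (j := 9) (by norm_num)
    fun s (hs : TupleLt m s ∧ s.reg 9 < s.reg 0) => hs.2.le).or_isTest h2 hpre
    (hs2.mono (by norm_num))
  refine (h3.forN (stable_tupleLt (by norm_num) m) fun s s' h =>
    or_congr (by rw [h.1, h.2 0 (by norm_num), h.2 9 (by norm_num)]) (hs2 s s' h)).congr
    fun s _ => forall₂_congr fun v _ => ?_
  have htup : (s.setReg 9 v).tuple m = s.tuple m := funext fun i => by
    rw [State.tuple, State.setReg_reg, if_neg (by omega)]; rfl
  simp [htup]

noncomputable def ruleTest (ρ : Rule Q) : Prog :=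
  .seq (testInj ρ.m) (.seq (testAdj ρ.A) (testNbr ρ.m ρ.t))

theorem isTest_ruleTest (ρ : Rule Q) :
    IsTest 10 (TupleLt ρ.m) (ruleTest ρ) fun s =>
      OccursMem ρ (s.reg 0) s.mem (s.tuple ρ.m) := by
  have hst : ∀ s s', Fr 10 s s' → s'.tuple ρ.m = s.tuple ρ.m ∧ s'.mem = s.mem ∧
      s'.reg 0 = s.reg 0 := fun s s' h => ⟨h.tuple (by norm_num) _, h.1, h.2 0 (by norm_num)⟩
  refine ((isTest_testInj ρ.m).and ((isTest_testAdj ρ.A).and (isTest_testNbr ρ.m ρ.t)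
    (stable_tupleLt (by norm_num) _) fun s s' h => ?_) (stable_tupleLt (by norm_num) _)
    fun s s' h => ?_).congr fun s _ => ⟨fun h => ⟨h.1, h.2.1, h.2.2⟩, fun h => ⟨h.1, h.2, h.3⟩⟩
  · obtain ⟨h1, h2, h3⟩ := hst s s' h
    rw [h1, h2, h3]
  · obtain ⟨h1, h2, h3⟩ := hst s s' h
    rw [h1, h2, h3]

/-- The new entries of the matrix after an application of the rule `ρ`. -/
noncomputable def _root_.Rule.entry (ρ : Rule Q) (i j : Fin ρ.m) : ℕ :=
  -- The default `1` on the diagonal deletes the vertices from `ρ.m'` on; their other entries are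
  -- irrelevant.
  if h : i.1 < ρ.m' ∧ j.1 < ρ.m' then if ρ.B.Adj ⟨i, h.1⟩ ⟨j, h.2⟩ then 1 else 0 else 1

/-- The entries of the tuple are distinct and smaller than the row length, so different pairs have
different addresses and no write destroys another. -/
theorem Spec.writes {m : ℕ} (F : Fin m × Fin m → ℕ) (L : List (Fin m × Fin m)) :
    Spec (seqs (L.map fun p => RAM.write (12 + 2 * p.1) (12 + 2 * p.2) (F p)))
      (fun s => TupleLt m s ∧ ∀ i j, i ≠ j → s.tuple m i ≠ s.tuple m j) fun s s' =>
        (∀ r, r < 3 ∨ 8 ≤ r → s'.reg r = s.reg r) ∧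
        (∀ p ∈ L, s'.mem (s.tuple m p.1 * s.reg 0 + s.tuple m p.2) = F p) ∧
        ∀ a, (∀ p ∈ L, a ≠ s.tuple m p.1 * s.reg 0 + s.tuple m p.2) → s'.mem a = s.mem a := by
  induction L with
  | nil =>
    refine Spec.skip.conseq (fun _ h => h) ?_
    rintro s s' - - rfl
    simp
  | cons p L ih =>
    have htup : ∀ {s s' : State}, (∀ r, r < 3 ∨ 8 ≤ r → s'.reg r = s.reg r) →
        s'.tuple m = s.tuple m := fun h => funext fun i => h _ (Or.inr (by omega))
    refine (Spec.seq ((Spec.write (by omega)).conseq (fun s hs => (hs.1 p.1).le)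
      fun _ _ _ _ h => h) ih ?_).conseq (fun _ h => h) ?_
    · rintro s s' ⟨hs, hinj⟩ - ⟨-, h⟩
      rw [TupleLt, htup h, h 0 (by norm_num)]
      exact ⟨hs, hinj⟩
    · rintro s s'' ⟨hs, hinj⟩ - ⟨s', h0, -, ⟨h1, h2⟩, h3, h4, h5⟩
      rw [htup h2, h2 0 (by norm_num)] at h4 h5
      have hp : s.reg (12 + 2 * p.1) * s.reg 0 + s.reg (12 + 2 * p.2) =
        s.tuple m p.1 * s.reg 0 + s.tuple m p.2 := rfl
      rw [hp] at h1
      have haddr : ∀ q : Fin m × Fin m, s.tuple m p.1 * s.reg 0 + s.tuple m p.2 =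
          s.tuple m q.1 * s.reg 0 + s.tuple m q.2 → p = q := by
        intro q hq
        have hn : 0 < s.reg 0 := (Nat.zero_le _).trans_lt (hs p.1)
        have e1 := congrArg (· / s.reg 0) hq
        have e2 := congrArg (· % s.reg 0) hq
        simp only [Nat.mul_comm _ (s.reg 0),
          Nat.mul_add_div hn, Nat.div_eq_of_lt (hs _), Nat.mul_add_mod,
          Nat.mod_eq_of_lt (hs _), add_zero] at e1 e2
        refine Prod.ext ?_ ?_
        · by_contra hne; exact hinj _ _ hne e1
        · by_contra hne; exact hinj _ _ hne e2
      refine ⟨fun r hr => (h3 r hr).trans (h2 r hr), fun q hq => ?_, fun a ha => ?_⟩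
      · by_cases hqL : q ∈ L
        · exact h4 q hqL
        · obtain rfl : q = p := by simpa [hqL] using hq
          rw [h5 _ fun q' hq' heq => hqL (haddr q' heq ▸ hq'), h1, Function.update_self]
      · rw [h5 a fun q hq => ha q (by simp [hq]), h1,
          Function.update_of_ne (ha p (by simp))]

noncomputable def applyRule (ρ : Rule Q) : Prog :=
  .seq (seqs ((Finset.univ : Finset (Fin ρ.m × Fin ρ.m)).toList.map fun p =>
    write (12 + 2 * p.1) (12 + 2 * p.2) (ρ.entry p.1 p.2))) (.seq (.const 5 ρ.δ) (.sub 1 1 5))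

/-- The memory after an application of the rule `ρ` to the occurrence `φ`. -/
def Applied (ρ : Rule Q) (n : ℕ) (φ : Fin ρ.m → ℕ) (mem mem' : ℕ → ℕ) : Prop :=
  (∀ i j, mem' (φ i * n + φ j) = ρ.entry i j) ∧
    ∀ a, (∀ i j, a ≠ φ i * n + φ j) → mem' a = mem a

theorem Spec.applyRule (ρ : Rule Q) :
    Spec (applyRule ρ)
      (fun s => TupleLt ρ.m s ∧ ∀ i j, i ≠ j → s.tuple ρ.m i ≠ s.tuple ρ.m j) fun s s' =>
        (∀ r, 8 ≤ r → s'.reg r = s.reg r) ∧ s'.reg 1 = s.reg 1 - ρ.δ ∧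
        Applied ρ (s.reg 0) (s.tuple ρ.m) s.mem s'.mem := by
  refine (Spec.seq (Spec.writes (fun p => ρ.entry p.1 p.2) _) (Spec.seq (pre := fun _ => True)
    (Spec.const (by norm_num) (by norm_num)) (Spec.sub (pre := fun _ => True) (by norm_num)
    (by norm_num)) (by simp)) (by simp)).conseq (fun _ h => h) ?_
  rintro s s' - - ⟨s₁, -, -, ⟨h1, h2, h3⟩, _, -, -, rfl, rfl⟩
  refine ⟨fun r hr => ?_, ?_, fun i j => h2 (i, j) (by simp), fun a ha => h3 a fun p _ => ha _ _⟩
  · simp only [State.setReg_reg]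
    rw [if_neg (by omega), if_neg (by omega), h1 r (Or.inr hr)]
  · simp [h1 1 (by norm_num)]

noncomputable def ruleProg (ρ : Rule Q) : Prog :=
  .seq (.const 3 1) (.seq (ruleTest ρ) (.cond 3 (applyRule ρ) .skip))

theorem Spec.ruleProg (ρ : Rule Q) :
    Spec (ruleProg ρ) (TupleLt ρ.m) fun s s' => (∀ r, 10 ≤ r → s'.reg r = s.reg r) ∧
      ((¬ OccursMem ρ (s.reg 0) s.mem (s.tuple ρ.m) ∧ s'.mem = s.mem ∧ s'.reg 1 = s.reg 1) ∨
        (OccursMem ρ (s.reg 0) s.mem (s.tuple ρ.m) ∧ s'.reg 1 = s.reg 1 - ρ.δ ∧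
          Applied ρ (s.reg 0) (s.tuple ρ.m) s.mem s'.mem)) := by
  have hst := stable_tupleLt (k := 10) (by norm_num) ρ.m
  have hfr : ∀ s, Fr 10 s (s.setReg 3 1) := fun s => ⟨rfl, fun r hr => by
    rw [State.setReg_reg, if_neg (by omega)]⟩
  have htest : Spec (.seq (.const 3 1) (ruleTest ρ)) (TupleLt ρ.m) fun s s' => Fr 10 s s' ∧
      (s'.reg 3 ≠ 0 ↔ OccursMem ρ (s.reg 0) s.mem (s.tuple ρ.m)) := by
    refine (Spec.seq (Spec.const (by norm_num) (by norm_num)) (isTest_ruleTest ρ)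
      (by rintro s _ hs - rfl; exact (hst _ _ (hfr s)).1 hs)).conseq (fun _ h => h) ?_
    rintro s s' - - ⟨_, -, -, rfl, h1, h2, h3⟩
    beta_reduce at h2 h3
    rw [(hfr s).tuple (by norm_num)] at h2 h3
    simp only [State.setReg_reg, State.setReg_mem, if_true, OfNat.zero_ne_ofNat, if_false] at h2 h3
    refine ⟨(hfr s).trans h1, ⟨fun h => ?_, fun h => by rw [h2 h]; norm_num⟩⟩
    by_contra hcon
    exact h (h3 hcon)
  obtain ⟨p, hp⟩ := htest
  obtain ⟨q, hq⟩ := Spec.applyRule ρ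
  refine ⟨p + q + 2, fun N s hN h2 hs => ?_⟩
  obtain ⟨m, s', hrun, hm, h0, h2', hfr', hiff⟩ := hp N s hN h2 hs
  have hadd : Polynomial.eval N (p + q + 2) = p.eval N + q.eval N + 2 := by
    rw [Polynomial.eval_add, Polynomial.eval_add, Polynomial.eval_ofNat 2 N]
  -- The specification of the test brackets the sequence differently, so its run is split and
  -- reassembled.
  cases hrun with
  | seq hrun₁ hrun₂ =>
  by_cases hocc : OccursMem ρ (s.reg 0) s.mem (s.tuple ρ.m)
  · have hs' : TupleLt ρ.m s' ∧ ∀ i j, i ≠ j → s'.tuple ρ.m i ≠ s'.tuple ρ.m j := by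
      refine ⟨(hst s s' hfr').1 hs, ?_⟩
      rw [hfr'.tuple (by norm_num)]
      exact hocc.inj
    obtain ⟨m', s'', hrun', hm', h0', h2'', h3, h4, h5⟩ := hq N s' (h0 ▸ hN) h2' hs'
    rw [hfr'.tuple (by norm_num), hfr'.1, h0] at h5
    refine ⟨_, s'', hrun₁.seq (hrun₂.seq (.condPos (hiff.2 hocc) hrun')), by omega,
      h0'.trans h0, h2'', fun r hr => (h3 r (by omega)).trans (hfr'.2 r (Or.inr hr)),
      Or.inr ⟨hocc, ?_, h5⟩⟩
    rw [h4, hfr'.2 1 (by norm_num)]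
  · refine ⟨_, s', hrun₁.seq (hrun₂.seq (.condZero ?_ (.skip _))), by omega, h0, h2',
      fun r hr => hfr'.2 r (Or.inr hr), Or.inl ⟨hocc, hfr'.1, hfr'.2 1 (by norm_num)⟩⟩
    by_contra h
    exact hocc (hiff.1 h)

end RuleProgram

end RAM

/-! ## Exhaustive application of the rules -/

namespace RAM

section Reduction

variable {𝒢 : Set FinGraph} {Q : ParamGraphProblem 𝒢}

/-- The vertices of the graph in the memory that have not been deleted. -/
def aliveSet (n : ℕ) (mem : ℕ → ℕ) : Set (Fin n) := {i | mem (i * n + i) = 0}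

/-- The graph whose adjacency matrix is in the memory. -/
def memGraph (n : ℕ) (mem : ℕ → ℕ) : SimpleGraph (Fin n) where
  Adj i j := i ≠ j ∧ mem (i * n + j) ≠ 0 ∧ mem (j * n + i) ≠ 0
  symm := ⟨fun _ _ h => ⟨h.1.symm, h.2.2, h.2.1⟩⟩
  loopless := ⟨fun _ h => h.1 rfl⟩

/-- The graph in the memory, without the deleted vertices. -/
def memFinGraph (n : ℕ) (mem : ℕ → ℕ) : FinGraph :=
  FinGraph.restrict (memGraph n mem) (aliveSet n mem)

/-- The memory holds the adjacency matrix of a graph. -/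
def Valid (n : ℕ) (mem : ℕ → ℕ) : Prop :=
  ∀ i ∈ aliveSet n mem, ∀ j ∈ aliveSet n mem,
    mem (i * n + j) = mem (j * n + i) ∧ mem (i * n + j) ≤ 1

theorem addr_inj {n i j u v : ℕ} (hj : j < n) (hv : v < n) (h : i * n + j = u * n + v) :
    i = u ∧ j = v := by
  have hn : 0 < n := by omega
  have e1 := congrArg (· / n) h
  have e2 := congrArg (· % n) h
  simp only [Nat.mul_comm _ n, Nat.mul_add_div hn, Nat.div_eq_of_lt hj, Nat.div_eq_of_lt hv,
    Nat.mul_add_mod, Nat.mod_eq_of_lt hj, Nat.mod_eq_of_lt hv, add_zero] at e1 e2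
  exact ⟨e1, e2⟩

theorem OccursMem.mem_alive {ρ : Rule Q} {n : ℕ} {mem : ℕ → ℕ} {φ : Fin ρ.m → Fin n}
    (h : OccursMem ρ n mem fun i => φ i) (i : Fin ρ.m) : φ i ∈ aliveSet n mem := by
  by_contra hcon
  exact ((h.adj i i).1 hcon).ne rfl

/-- Adjacency in `memGraph` asks for both symmetric entries while `OccursMem` reads one; `Valid`
closes the gap. -/
theorem occursMem_iff {ρ : Rule Q} {n : ℕ} {mem : ℕ → ℕ} (hv : Valid n mem) (φ : Fin ρ.m → Fin n) :
    OccursMem ρ n mem (fun i => φ i) ↔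
      Occurs (memGraph n mem) (aliveSet n mem) ρ.A ρ.t φ := by
  constructor
  · intro h
    have hal := h.mem_alive
    have hinj : Function.Injective φ := fun i j hij => by
      by_contra hne
      exact h.inj i j hne (congrArg Fin.val hij)
    refine ⟨hinj, hal, fun i j => ⟨fun hij => (h.adj i j).1 hij.2.1, fun hij => ⟨?_, ?_, ?_⟩⟩,
      fun i hi v hvU hiv => ?_⟩
    · exact fun he => hij.ne (hinj he)
    · exact (h.adj i j).2 hij
    · exact (h.adj j i).2 hij.symm
    · rcases h.nbr v v.2 with h' | ⟨j, hj⟩ | h'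
      · exact absurd hvU h'
      · exact ⟨j, Fin.ext hj.symm⟩
      · exact absurd (h' i hi) hiv.2.1
  · intro h
    refine ⟨fun i j hne he => hne (h.inj (Fin.ext he)), fun i j => ?_, fun v hvn => ?_⟩
    · rw [← h.adj i j]
      refine ⟨fun hij => ⟨?_, hij, ?_⟩, fun hij => hij.2.1⟩
      · intro he
        rw [← he] at hij
        exact hij (h.mem i)
      · rw [← (hv _ (h.mem i) _ (h.mem j)).1]
        exact hij
    · by_cases hva : mem (v * n + v) = 0
      · refine Or.inr ?_
        by_contra hcon
        push Not at hcon
        obtain ⟨h1, j, hj, hjv⟩ := hcon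
        have hva' : (⟨v, hvn⟩ : Fin n) ∈ aliveSet n mem := hva
        obtain ⟨i, hi⟩ := h.nbr j hj ⟨v, hvn⟩ hva' ⟨fun he => h1 j (congrArg Fin.val he).symm, hjv, by
          have := (hv _ (h.mem j) _ hva').1
          exact fun h0 => hjv (this.trans h0)⟩
        exact h1 i (congrArg Fin.val hi).symm
      · exact Or.inl hva

theorem _root_.Rule.entry_comm (ρ : Rule Q) (i j : Fin ρ.m) : ρ.entry i j = ρ.entry j i := by
  unfold Rule.entry
  by_cases h : i.1 < ρ.m' ∧ j.1 < ρ.m'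
  · rw [dif_pos h, dif_pos h.symm]
    split_ifs with h1 h2 h2
    exacts [rfl, absurd h1.symm h2, absurd h2.symm h1, rfl]
  · rw [dif_neg h, dif_neg fun h' => h h'.symm]

theorem _root_.Rule.entry_le (ρ : Rule Q) (i j : Fin ρ.m) : ρ.entry i j ≤ 1 := by
  unfold Rule.entry
  split_ifs <;> omega

theorem _root_.Rule.entry_self (ρ : Rule Q) (i : Fin ρ.m) : ρ.entry i i = 0 ↔ i < ρ.m' := by
  unfold Rule.entry
  split_ifs with h h' <;> simp_all

theorem Applied.replaces {ρ : Rule Q} {n : ℕ} {mem mem' : ℕ → ℕ} {φ : Fin ρ.m → Fin n}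
    (h : Applied ρ n (fun i => φ i) mem mem') (hv : Valid n mem)
    (hocc : OccursMem ρ n mem fun i => φ i) :
    Valid n mem' ∧ ParamGraphProblem.Replaces ρ φ (memGraph n mem) (memGraph n mem')
      (aliveSet n mem) (aliveSet n mem') ∧ (aliveSet n mem').ncard < (aliveSet n mem).ncard := by
  obtain ⟨h1, h2⟩ := h
  have hoff : ∀ u v : Fin n, ¬ (u ∈ Set.range φ ∧ v ∈ Set.range φ) →
      mem' (u * n + v) = mem (u * n + v) := by
    refine fun u v huv => h2 _ fun i j he => huv ?_
    obtain ⟨hu, hv⟩ := addr_inj v.2 (φ j).2 he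
    exact ⟨⟨i, Fin.ext hu.symm⟩, j, Fin.ext hv.symm⟩
  have hmem : ∀ i, φ i ∈ aliveSet n mem' ↔ i.1 < ρ.m' := fun i => by
    rw [← ρ.entry_self, ← h1 i i]; rfl
  have hmem' : ∀ v, v ∉ Set.range φ → (v ∈ aliveSet n mem' ↔ v ∈ aliveSet n mem) := fun v hv => by
    change mem' _ = 0 ↔ mem _ = 0
    rw [hoff v v fun h => hv h.1]
  have hsub : aliveSet n mem' ⊆ aliveSet n mem := by
    intro v hv'
    by_cases hvφ : v ∈ Set.range φ
    · obtain ⟨i, rfl⟩ := hvφ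
      exact hocc.mem_alive i
    · exact (hmem' v hvφ).1 hv'
  have hinj : Function.Injective φ := fun i j hij => by
    by_contra hne
    exact hocc.inj i j hne (congrArg Fin.val hij)
  refine ⟨fun u hu v hv' => ?_, ⟨hmem, hmem', fun i j => ?_, fun u hu v hv' huv => ?_⟩, ?_⟩
  · by_cases huv : u ∈ Set.range φ ∧ v ∈ Set.range φ
    · obtain ⟨⟨i, rfl⟩, j, rfl⟩ := huv
      rw [h1, h1]
      exact ⟨ρ.entry_comm i j, ρ.entry_le i j⟩
    · rw [hoff u v huv, hoff v u fun h => huv h.symm]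
      exact hv u (hsub hu) v (hsub hv')
  · have he : ∀ i j : Fin ρ.m', mem' (φ (Fin.castLE ρ.lt.le i) * n + φ (Fin.castLE ρ.lt.le j)) ≠ 0 ↔
        ρ.B.Adj i j := by
      intro i j
      rw [h1, Rule.entry, dif_pos ⟨i.2, j.2⟩]
      split_ifs with h <;> simpa using h
    refine ⟨fun h => (he i j).1 h.2.1, fun h => ⟨fun hij => h.ne ?_, (he i j).2 h,
      (he j i).2 h.symm⟩⟩
    exact Fin.castLE_injective _ (hinj hij)
  · change (_ ∧ _ ∧ _) ↔ (_ ∧ _ ∧ _)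
    rw [hoff u v huv, hoff v u fun h => huv h.symm]
  · refine Set.ncard_lt_ncard ⟨hsub, fun hsup => ?_⟩ (Set.toFinite _)
    -- The vertex with index `ρ.m'` was present before and is deleted now.
    have := (hmem ⟨ρ.m', ρ.lt⟩).1 (hsup (hocc.mem_alive _))
    exact absurd this (lt_irrefl _)

/-- The instance with parameter `K - 1` is a yes-instance. Here `K = 0` stands for a negative
parameter. -/
def YesSucc (Q : ParamGraphProblem 𝒢) (G : FinGraph) (K : ℕ) : Prop := ∃ k, K = k + 1 ∧ Q.Yes G k

/-- Some rule of the list applies to the graph in the memory. -/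
def Reducible (L : List (Rule Q)) (n : ℕ) (mem : ℕ → ℕ) : Prop :=
  ∃ ρ ∈ L, ∃ φ : Fin ρ.m → ℕ, (∀ i, φ i < n) ∧ OccursMem ρ n mem φ

/-- The rules of the list lead from an instance to an equivalent instance with fewer vertices, or
nothing has been changed. -/
structure Progress (L : List (Rule Q)) (n : ℕ) (mem : ℕ → ℕ) (K : ℕ) (mem' : ℕ → ℕ) (K' : ℕ) :
    Prop where
  valid : Valid n mem'
  mem_iff : memFinGraph n mem ∈ 𝒢 ↔ memFinGraph n mem' ∈ 𝒢
  yes_iff : YesSucc Q (memFinGraph n mem) K ↔ YesSucc Q (memFinGraph n mem') K'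
  le : K' ≤ K
  change : (mem' = mem ∧ K' = K) ∨
    (Reducible L n mem ∧ (aliveSet n mem').ncard < (aliveSet n mem).ncard)

namespace Progress

variable {L : List (Rule Q)} {n K K' K'' : ℕ} {mem mem' mem'' : ℕ → ℕ}

theorem refl (h : Valid n mem) : Progress L n mem K mem K :=
  ⟨h, Iff.rfl, Iff.rfl, le_rfl, Or.inl ⟨rfl, rfl⟩⟩

theorem ncard_le (h : Progress L n mem K mem' K') :
    (aliveSet n mem').ncard ≤ (aliveSet n mem).ncard := by
  rcases h.change with ⟨h, -⟩ | ⟨-, h⟩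
  exacts [h ▸ le_rfl, h.le]

theorem trans (h : Progress L n mem K mem' K') (h' : Progress L n mem' K' mem'' K'') :
    Progress L n mem K mem'' K'' := by
  refine ⟨h'.valid, h.mem_iff.trans h'.mem_iff, h.yes_iff.trans h'.yes_iff, h'.le.trans h.le, ?_⟩
  rcases h.change with ⟨rfl, rfl⟩ | ⟨h1, h2⟩
  · exact h'.change
  · exact Or.inr ⟨h1, h'.ncard_le.trans_lt h2⟩

/-- Any change lowers the number of vertices for good, so a memory that has returned to its first
content has not changed in between. -/
theorem eq_of_eq (h : Progress L n mem K mem' K') (h' : Progress L n mem' K' mem'' K'')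
    (he : mem'' = mem) : mem' = mem := by
  rcases h.change with ⟨h1, -⟩ | ⟨-, h1⟩
  · exact h1
  · exact absurd h'.ncard_le (by rw [he]; omega)

end Progress

/-- The class `𝒢` is closed under isomorphism. -/
def IsoClosed (𝒢 : Set FinGraph) : Prop :=
  ∀ G G' : FinGraph, Nonempty (G.graph ≃g G'.graph) → G ∈ 𝒢 → G' ∈ 𝒢

theorem Applied.progress (h𝒢 : IsoClosed 𝒢) {L : List (Rule Q)} {ρ : Rule Q} (hρ : ρ ∈ L) {n K : ℕ}
    {mem mem' : ℕ → ℕ} {φ : Fin ρ.m → ℕ} (hφ : ∀ i, φ i < n) (hv : Valid n mem)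
    (hocc : OccursMem ρ n mem φ) (h : Applied ρ n φ mem mem') :
    Progress L n mem K mem' (K - ρ.δ) := by
  obtain ⟨ψ, rfl⟩ : ∃ ψ : Fin ρ.m → Fin n, φ = fun i => (ψ i : ℕ) := ⟨fun i => ⟨φ i, hφ i⟩, rfl⟩
  obtain ⟨h1, h2, h3⟩ := h.replaces hv hocc
  obtain ⟨h4, h5⟩ := h2.sound h𝒢 ((occursMem_iff hv ψ).1 hocc)
  refine ⟨h1, h4, ?_, Nat.sub_le _ _, Or.inr ⟨⟨ρ, hρ, _, hφ, hocc⟩, h3⟩⟩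
  -- Truncation at zero agrees with `YesInt`: both sides fail once the shifted parameter is
  -- negative.
  constructor
  · rintro ⟨k, rfl, hk⟩
    obtain ⟨m, hm, hy⟩ := (h5 k).1 ⟨k, rfl, hk⟩
    exact ⟨m, by omega, hy⟩
  · rintro ⟨k, hk, hy⟩
    obtain ⟨m, hm, hy'⟩ := (h5 (k + ρ.δ)).2 ⟨k, by omega, hy⟩
    exact ⟨m, by omega, hy'⟩

/-- The program tries the rule `ρ` for all tuples that extend the given tuple of length `d`. -/
def Sweep (L : List (Rule Q)) (ρ : Rule Q) (d : ℕ) (P : Prog) : Prop :=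
  Spec P (fun s => (∀ i < d, s.reg (12 + 2 * i) < s.reg 0) ∧ Valid (s.reg 0) s.mem) fun s s' =>
    (∀ r, 10 ≤ r → r < 12 + 2 * d → s'.reg r = s.reg r) ∧
    Progress L (s.reg 0) s.mem (s.reg 1) s'.mem (s'.reg 1) ∧
    (s'.mem = s.mem → ∀ φ : Fin ρ.m → ℕ, (∀ i, φ i < s.reg 0) →
      (∀ i, i.1 < d → φ i = s.reg (12 + 2 * i)) → ¬ OccursMem ρ (s.reg 0) s.mem φ)

theorem sweep_ruleProg (h𝒢 : IsoClosed 𝒢) {L : List (Rule Q)} {ρ : Rule Q} (hρ : ρ ∈ L) :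
    Sweep L ρ ρ.m (ruleProg ρ) := by
  refine (Spec.ruleProg ρ).conseq (fun s hs i => hs.1 i i.2) ?_
  rintro s s' ⟨hs, hv⟩ - ⟨h1, ⟨h2, h3, h4⟩ | ⟨h2, h3, h4⟩⟩
  · refine ⟨fun r hr _ => h1 r hr, ?_, fun _ φ _ hφ hocc => h2 ?_⟩
    · rw [h3, h4]; exact Progress.refl hv
    · have : φ = s.tuple ρ.m := funext fun i => hφ i i.2
      rwa [← this]
  · have hp := h4.progress h𝒢 hρ (K := s.reg 1) (fun i => hs i i.2) hv h2
    refine ⟨fun r hr _ => h1 r hr, by rw [h3]; exact hp, fun he => ?_⟩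
    have := (h4.replaces (φ := fun i => ⟨_, hs i i.2⟩) hv h2).2.2
    rw [he] at this
    exact absurd this (lt_irrefl _)

/-- The rule may fire in the middle of the loop, and later tuples are then tested in a changed
graph. Completeness is claimed only if the memory is the same at the end; by `eq_of_eq` all tuples
were then tested in the same graph. -/
theorem Sweep.forN {L : List (Rule Q)} {ρ : Rule Q} {d : ℕ} (hd : d < ρ.m) {P : Prog}
    (h : Sweep L ρ (d + 1) P) : Sweep L ρ d (forN (12 + 2 * d) (13 + 2 * d) P) := by
  refine Spec.conseq (Spec.forN
    (pre := fun s => (∀ i < d, s.reg (12 + 2 * i) < s.reg 0) ∧ Valid (s.reg 0) s.mem) h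
    (fun s₀ j s => (∀ r, 10 ≤ r → r < 12 + 2 * d → s.reg r = s₀.reg r) ∧
      Progress L (s₀.reg 0) s₀.mem (s₀.reg 1) s.mem (s.reg 1) ∧
      (s.mem = s₀.mem → ∀ φ : Fin ρ.m → ℕ, (∀ i, φ i < s₀.reg 0) →
        (∀ i, i.1 < d → φ i = s₀.reg (12 + 2 * i)) → φ ⟨d, hd⟩ < j →
        ¬ OccursMem ρ (s₀.reg 0) s₀.mem φ))
    (by omega) (by omega) (by omega) (by omega) (by omega) ?_ ?_ ?_ ?_) (fun _ h => h) ?_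
  · rintro s₀ j s a b ⟨h1, h2, h3⟩
    refine ⟨fun r hr hr' => ?_, ?_, h3⟩
    · rw [State.setReg_reg, State.setReg_reg, if_neg (by omega), if_neg (by omega), h1 r hr hr']
    · rwa [State.setReg_reg, State.setReg_reg, if_neg (by omega), if_neg (by omega)]
  · rintro s ⟨-, hv⟩
    exact ⟨fun _ _ _ => rfl, Progress.refl hv, fun _ φ _ _ h => absurd h (Nat.not_lt_zero _)⟩
  · rintro s₀ j s ⟨hs₀, -⟩ h0 ⟨h1, h2, -⟩ hx hj
    refine ⟨fun i hi => ?_, by rw [h0]; exact h2.valid⟩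
    rcases Nat.lt_succ_iff_lt_or_eq.1 hi with hi | rfl
    · rw [h1 _ (by omega) (by omega), h0]
      exact hs₀ i hi
    · rw [hx, h0]; exact hj
  · rintro s₀ j s s' hs₀ h0 ⟨h1, h2, h3⟩ hx hj ⟨h4, h5, h6⟩
    rw [h0] at h5 h6
    refine ⟨⟨fun r hr hr' => ?_, h2.trans h5, fun he φ hφ hφd hφj hocc => ?_⟩,
      h4 _ (by omega) (by omega), h4 _ (by omega) (by omega)⟩
    · rw [h4 r hr (by omega), h1 r hr hr']
    · have hs : s.mem = s₀.mem := h2.eq_of_eq h5 he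
      rcases Nat.lt_succ_iff_lt_or_eq.1 hφj with hlt | heq
      · exact h3 hs φ hφ hφd hlt hocc
      · refine h6 (he.trans hs.symm) φ hφ (fun i hi => ?_) (hs ▸ hocc)
        rcases Nat.lt_succ_iff_lt_or_eq.1 hi with hi | hi
        · rw [hφd i hi, h1 _ (by omega) (by omega)]
        · obtain rfl : i = ⟨d, hd⟩ := Fin.ext hi
          rw [heq, ← hx]
  · rintro s s' - - ⟨h1, h2, h3⟩
    exact ⟨h1, h2, fun he φ hφ hφd => h3 he φ hφ hφd (hφ _)⟩

/-- Nested loops over the first `d` components of a tuple -/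
def tuples : ℕ → Prog → Prog
  | 0, P => P
  | d + 1, P => tuples d (forN (12 + 2 * d) (13 + 2 * d) P)

theorem Sweep.tuples {L : List (Rule Q)} {ρ : Rule Q} {d : ℕ} (hd : d ≤ ρ.m) {P : Prog}
    (h : Sweep L ρ d P) : Sweep L ρ 0 (tuples d P) := by
  induction d generalizing P with
  | zero => exact h
  | succ d ih => exact ih (by omega) (h.forN (by omega))

noncomputable def pass (L : List (Rule Q)) : Prog :=
  seqs (L.map fun ρ => tuples ρ.m (ruleProg ρ))

theorem Spec.pass (h𝒢 : IsoClosed 𝒢) {L : List (Rule Q)} (L' : List (Rule Q))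
    (hL' : ∀ ρ ∈ L', ρ ∈ L) :
    Spec (pass L') (fun s => Valid (s.reg 0) s.mem) fun s s' =>
      s'.reg 10 = s.reg 10 ∧ s'.reg 11 = s.reg 11 ∧
      Progress L (s.reg 0) s.mem (s.reg 1) s'.mem (s'.reg 1) ∧
      (s'.mem = s.mem → ¬ Reducible L' (s.reg 0) s.mem) := by
  induction L' with
  | nil =>
    refine Spec.skip.conseq (fun _ h => h) ?_
    rintro s s' hv - rfl
    exact ⟨rfl, rfl, Progress.refl hv, fun _ ⟨ρ, hρ, _⟩ => by simp at hρ⟩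
  | cons ρ L' ih =>
    have hsweep := (sweep_ruleProg h𝒢 (hL' ρ (by simp))).tuples le_rfl
    refine (Spec.seq (hsweep.conseq (fun s hs => ⟨by simp, hs⟩) fun _ _ _ _ h => h)
      (ih fun ρ' h => hL' ρ' (by simp [h])) ?_).conseq (fun _ h => h) ?_
    · rintro s s' - h0 ⟨-, h, -⟩
      rw [h0]; exact h.valid
    · rintro s s'' - - ⟨s', h0, -, ⟨h1, h2, h3⟩, h4, h5, h6, h7⟩
      rw [h0] at h6 h7
      refine ⟨h4.trans (h1 10 (by norm_num) (by norm_num)),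
        h5.trans (h1 11 (by norm_num) (by norm_num)), h2.trans h6, fun he => ?_⟩
      have hs : s'.mem = s.mem := h2.eq_of_eq h6 he
      rintro ⟨ρ', hρ', φ, hφ, hocc⟩
      rcases List.mem_cons.1 hρ' with rfl | hρ'
      · exact h3 hs φ hφ (by simp) hocc
      · exact h7 (he.trans hs.symm) ⟨ρ', hρ', φ, hφ, hs ▸ hocc⟩

noncomputable def reduce (L : List (Rule Q)) : Prog := forN 10 11 (pass L)

/-- As many passes as there are vertices suffice: a pass that changes nothing certifies
irreducibility, and any other pass deletes a vertex. -/
theorem Spec.reduce (h𝒢 : IsoClosed 𝒢) (L : List (Rule Q)) :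
    Spec (reduce L) (fun s => Valid (s.reg 0) s.mem) fun s s' =>
      Progress L (s.reg 0) s.mem (s.reg 1) s'.mem (s'.reg 1) ∧
      ¬ Reducible L (s.reg 0) s'.mem := by
  refine Spec.conseq (Spec.forN (pre := fun s => Valid (s.reg 0) s.mem)
    (Spec.pass h𝒢 L fun _ h => h)
    (fun s₀ j s => Progress L (s₀.reg 0) s₀.mem (s₀.reg 1) s.mem (s.reg 1) ∧
      ((aliveSet (s₀.reg 0) s.mem).ncard + j ≤ s₀.reg 0 ∨ ¬ Reducible L (s₀.reg 0) s.mem))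
    (by norm_num) (by norm_num) (by norm_num) (by norm_num) (by norm_num) ?_ ?_ ?_ ?_)
    (fun _ h => h) ?_
  · rintro s₀ j s a b ⟨h1, h2⟩
    exact ⟨by simpa using h1, h2⟩
  · intro s hs
    refine ⟨Progress.refl hs, Or.inl ?_⟩
    have := Set.ncard_le_card (aliveSet (s.reg 0) s.mem)
    simpa using this
  · rintro s₀ j s - h0 ⟨h1, -⟩ - -
    rw [h0]; exact h1.valid
  · rintro s₀ j s s' - h0 ⟨h1, h2⟩ - - ⟨h3, h4, h5, h6⟩
    rw [h0] at h5 h6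
    refine ⟨⟨h1.trans h5, ?_⟩, h3, h4⟩
    rcases h5.change with ⟨he, -⟩ | ⟨hr, hlt⟩
    · exact Or.inr (he ▸ h6 he)
    · rcases h2 with h2 | h2
      · exact Or.inl (by omega)
      · exact absurd hr h2
  · rintro s s' - - ⟨h1, h2⟩
    refine ⟨h1, fun hr => ?_⟩
    rcases h2 with h2 | h2
    -- No vertex is left, but a pattern has at least one because `ρ.m' < ρ.m`.
    · obtain ⟨ρ, -, φ, hφ, hocc⟩ := hr
      have h0 : (aliveSet (s.reg 0) s'.mem).ncard = 0 := by omega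
      rw [Set.ncard_eq_zero] at h0
      have hlt := ρ.lt
      have := OccursMem.mem_alive (φ := fun i => ⟨φ i, hφ i⟩) hocc ⟨0, by omega⟩
      rw [h0] at this
      exact this
    · exact h2 hr

end Reduction

end RAM

/-! ## Writing the output -/

namespace RAM

section Output

/-- The number of vertices before `v` that have not been deleted. -/
def rank (n : ℕ) (M : ℕ → ℕ) (v : ℕ) : ℕ := Nat.count (fun v => M (v * n + v) = 0) v

theorem rank_zero (n : ℕ) (M : ℕ → ℕ) : rank n M 0 = 0 := Nat.count_zero _

theorem rank_succ {n : ℕ} {M : ℕ → ℕ} {v : ℕ} (h : M (v * n + v) = 0) :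
    rank n M (v + 1) = rank n M v + 1 := by
  rw [rank, Nat.count_succ, if_pos h]; rfl

theorem rank_succ_of_ne {n : ℕ} {M : ℕ → ℕ} {v : ℕ} (h : M (v * n + v) ≠ 0) :
    rank n M (v + 1) = rank n M v := by
  rw [rank, Nat.count_succ, if_neg h]; rfl

theorem rank_mono (n : ℕ) (M : ℕ → ℕ) : Monotone (rank n M) := Nat.count_monotone _

theorem rank_le (n : ℕ) (M : ℕ → ℕ) (v : ℕ) : rank n M v ≤ v := Nat.count_le _

theorem rank_lt {n : ℕ} {M : ℕ → ℕ} {u v : ℕ} (h : M (u * n + u) = 0) (huv : u < v) :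
    rank n M u < rank n M v :=
  (Nat.lt_succ_self _).trans_le ((rank_succ h).symm.le.trans (rank_mono n M huv))

theorem rank_congr {n : ℕ} {M M' : ℕ → ℕ} {v : ℕ} (h : ∀ u < v, M (u * n + u) = M' (u * n + u)) :
    rank n M v = rank n M' v := by
  induction v with
  | zero => rw [rank_zero, rank_zero]
  | succ v ih =>
    have ih' := ih fun u hu => h u (by omega)
    have hv := h v (by omega)
    by_cases h0 : M (v * n + v) = 0
    · rw [rank_succ h0, rank_succ (hv ▸ h0), ih']
    · rw [rank_succ_of_ne h0, rank_succ_of_ne (hv ▸ h0), ih']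

theorem addr_lt {n i j : ℕ} (hi : i < n) (hj : j < n) : i * n + j < n * n := by
  have := Nat.mul_le_mul_right n (Nat.succ_le_of_lt hi)
  rw [Nat.succ_mul] at this
  omega

/-- The entries of the matrix `M` before row `i` and column `j` that belong to vertices that have
not been deleted have been copied behind the matrix. -/
structure Packed (n : ℕ) (M : ℕ → ℕ) (i j : ℕ) (s : State) : Prop where
  ptr : s.reg 20 = n * n + rank n M i * rank n M n + rank n M j
  keep : ∀ a < n * n, s.mem a = M a
  entry : ∀ u v, v < n → u < i ∨ u = i ∧ v < j → M (u * n + u) = 0 → M (v * n + v) = 0 →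
    s.mem (n * n + rank n M u * rank n M n + rank n M v) = M (u * n + v)

/-- Append an entry of the row in register `10` if its column has not been deleted. -/
def packEntry : Prog :=
  .seq (readDec 12 12) (.cond 4 .skip
    (.seq (addr 10 12) (.seq (.load 4 4) (.seq (.store 20 4) (.add 20 20 2)))))

theorem Spec.packEntry :
    Spec packEntry (fun s => s.reg 12 ≤ s.reg 0 ∧ s.reg 10 ≤ s.reg 0) fun s s' =>
      (∀ r, 8 ≤ r ∨ r = 1 → r ≠ 20 → s'.reg r = s.reg r) ∧
      (s.mem (s.reg 12 * s.reg 0 + s.reg 12) = 0 → s'.reg 20 = s.reg 20 + 1 ∧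
        s'.mem = Function.update s.mem (s.reg 20) (s.mem (s.reg 10 * s.reg 0 + s.reg 12))) ∧
      (s.mem (s.reg 12 * s.reg 0 + s.reg 12) ≠ 0 → s'.reg 20 = s.reg 20 ∧ s'.mem = s.mem) := by
  refine (Spec.seq (Dec.readDec (i := 12) (j := 12) (by norm_num) fun s hs => hs.1)
    (Spec.cond (pre := fun s => s.reg 10 ≤ s.reg 0) Spec.skip (Spec.seq
      ((Spec.addr (i := 10) (j := 12) (by norm_num)).conseq (fun s hs => hs.1) fun _ _ _ _ h => h)
      (Spec.seq (pre := fun _ => True) (Spec.load (by norm_num) (by norm_num))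
        (Spec.seq (pre := fun _ => True) Spec.store
          (Spec.add (pre := fun _ => True) (by norm_num) (by norm_num)) (by simp)) (by simp))
      (by simp))) ?_).conseq (fun _ h => h) ?_
  · rintro s s' hs h0 ⟨h1, -⟩
    rw [h0, h1.2 10 (by norm_num)]
    exact hs.2
  · rintro s s'' - - ⟨s', h0, h2, ⟨h1, -, h3⟩, ⟨h4, rfl⟩ |
      ⟨h4, s₁, -, -, rfl, s₂, -, -, rfl, s₃, -, h5, rfl, rfl⟩⟩
    · refine ⟨fun r hr _ => h1.2 r (by omega), fun h => absurd h (h3.1 h4), fun _ => ⟨?_, h1.1⟩⟩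
      exact h1.2 20 (by norm_num)
    · simp only [State.setReg_reg, State.setMem_reg] at h5 ⊢
      norm_num at h5 ⊢
      refine ⟨fun r hr hr' => ?_, fun _ => ⟨?_, ?_⟩, fun h => absurd (h3.2 h) (by simpa using h4)⟩
      · rw [if_neg hr', if_neg (by omega), if_neg (by omega), if_neg (by omega)]
        exact h1.2 r (by omega)
      · rw [h1.2 20 (by norm_num), h2]
      · simp only [State.setMem, State.setReg]
        rw [h1.1, h1.2 20 (by norm_num), h1.2 10 (by norm_num), h1.2 12 (by norm_num), h0]

/-- Append the row in register `10` if it has not been deleted. -/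
def packRow : Prog :=
  .seq (readDec 10 10) (.cond 4 .skip (forN 12 13 packEntry))

/-- Quantifying over the reference matrix `M` lets successive rows be compared with the original
memory. -/
theorem Spec.packRow :
    Spec packRow (fun s => s.reg 10 < s.reg 0) fun s s' =>
      s'.reg 1 = s.reg 1 ∧ s'.reg 10 = s.reg 10 ∧ s'.reg 11 = s.reg 11 ∧
      ∀ M, Packed (s.reg 0) M (s.reg 10) 0 s → Packed (s.reg 0) M (s.reg 10 + 1) 0 s' := by
  refine (Spec.seq (Dec.readDec (i := 10) (j := 10) (by norm_num) fun s hs => le_of_lt hs)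
    (Spec.cond (pre := fun s => s.reg 10 < s.reg 0) Spec.skip
      ((Spec.forN (x := 12) (c := 13) (pre := fun s => s.reg 10 < s.reg 0) Spec.packEntry
        (fun s₀ j s => s.reg 1 = s₀.reg 1 ∧ s.reg 10 = s₀.reg 10 ∧ s.reg 11 = s₀.reg 11 ∧
          ∀ M, M (s₀.reg 10 * s₀.reg 0 + s₀.reg 10) = 0 → Packed (s₀.reg 0) M (s₀.reg 10) 0 s₀ →
            Packed (s₀.reg 0) M (s₀.reg 10) j s)
        (by norm_num) (by norm_num) (by norm_num) (by norm_num) (by norm_num)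
        ?_ ?_ ?_ ?_).conseq (fun s hs => hs.1) fun _ _ _ _ h => h)) ?_).conseq
    (fun _ h => h) ?_
  · rintro s₀ j s a b ⟨h1, h2, h3, h4⟩
    refine ⟨by simpa using h1, by simpa using h2, by simpa using h3, fun M hM hp => ?_⟩
    obtain ⟨h5, h6, h7⟩ := h4 M hM hp
    exact ⟨by simpa using h5, h6, h7⟩
  · exact fun s _ => ⟨rfl, rfl, rfl, fun M _ h => h⟩
  · rintro s₀ j s hs₀ h0 ⟨-, h2, -⟩ hx hj
    exact ⟨by omega, by omega⟩
  · rintro s₀ j s s' hs₀ h0 ⟨h1, h2, h3, h4⟩ hx hj ⟨h5, h6, h7⟩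
    refine ⟨⟨(h5 1 (by norm_num) (by norm_num)).trans h1, (h5 10 (by norm_num) (by norm_num)).trans h2,
      (h5 11 (by norm_num) (by norm_num)).trans h3, fun M hM hp => ?_⟩,
      h5 12 (by norm_num) (by norm_num), h5 13 (by norm_num) (by norm_num)⟩
    obtain ⟨h8, h9, h10⟩ := h4 M hM hp
    rw [hx, h0, h9 _ (addr_lt hj hj)] at h6 h7
    by_cases hMj : M (j * s₀.reg 0 + j) = 0
    · obtain ⟨h11, h12⟩ := h6 hMj
      rw [h2, h9 _ (addr_lt hs₀ hj)] at h12
      have hlt : ∀ a, a < s.reg 20 → s'.mem a = s.mem a := fun a ha => by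
        rw [h12, Function.update_of_ne ha.ne]
      refine ⟨by rw [h11, h8, rank_succ hMj, add_assoc], fun a ha => ?_, fun u v hv huv hu hv' => ?_⟩
      · rw [hlt a (by omega), h9 a ha]
      -- Entries packed earlier lie strictly below the write pointer and survive.
      · have hpos : u < s₀.reg 10 ∨ u = s₀.reg 10 ∧ v < j →
            s'.mem (s₀.reg 0 * s₀.reg 0 + rank (s₀.reg 0) M u * rank (s₀.reg 0) M (s₀.reg 0) +
              rank (s₀.reg 0) M v) = M (u * s₀.reg 0 + v) := by
          intro h
          rw [hlt, h10 u v hv h hu hv']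
          rw [h8]
          rcases h with h | ⟨rfl, h⟩
          · have h13 := rank_lt hu h
            have h14 := rank_lt hv' hv
            have h15 := Nat.mul_le_mul_right (rank (s₀.reg 0) M (s₀.reg 0)) (Nat.succ_le_of_lt h13)
            rw [Nat.succ_mul] at h15
            omega
          · have := rank_lt hv' h
            omega
        rcases huv with h | ⟨rfl, h⟩
        · exact hpos (Or.inl h)
        · rcases Nat.lt_succ_iff_lt_or_eq.1 h with h | rfl
          · exact hpos (Or.inr ⟨rfl, h⟩)
          · rw [← h8, h12, Function.update_self]
    · obtain ⟨h11, h12⟩ := h7 hMj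
      refine ⟨by rw [h11, h8, rank_succ_of_ne hMj], fun a ha => by rw [h12, h9 a ha],
        fun u v hv huv hu hv' => ?_⟩
      rw [h12]
      refine h10 u v hv ?_ hu hv'
      refine huv.imp_right fun h => ⟨h.1, lt_of_le_of_ne (Nat.lt_succ_iff.1 h.2) ?_⟩
      rintro rfl
      exact hMj hv'
  · rintro s s' hs h0 ⟨h1, -⟩
    rw [h0, h1.2 10 (by norm_num)]
    exact hs
  · rintro s s'' hs - ⟨s', h0, h2, ⟨h1, -, h3⟩, h⟩
    have hp : ∀ M, Packed (s.reg 0) M (s.reg 10) 0 s → Packed (s.reg 0) M (s.reg 10) 0 s' := by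
      rintro M ⟨h4, h5, h6⟩
      exact ⟨by rw [h1.2 20 (by norm_num), h4], by rwa [h1.1], by rwa [h1.1]⟩
    have e1 := h1.2 1 (by norm_num)
    have e10 := h1.2 10 (by norm_num)
    have e11 := h1.2 11 (by norm_num)
    rcases h with ⟨h4, rfl⟩ | ⟨h4, h5, h6, h7, h8⟩
    · refine ⟨e1, e10, e11, fun M hM => ?_⟩
      have hrow : M (s.reg 10 * s.reg 0 + s.reg 10) ≠ 0 := by
        rw [← hM.keep _ (addr_lt hs hs)]
        exact h3.1 h4
      obtain ⟨h5, h6, h7⟩ := hp M hM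
      refine ⟨by rw [h5, rank_succ_of_ne hrow], h6, fun u v hv huv hu hv' => ?_⟩
      refine h7 u v hv (Or.inl ?_) hu hv'
      refine lt_of_le_of_ne (Nat.lt_succ_iff.1 (by omega)) ?_
      rintro rfl
      exact hrow hu
    · rw [h0, e10] at h8
      refine ⟨h5.trans e1, h6.trans e10, h7.trans e11, fun M hM => ?_⟩
      have hrow : M (s.reg 10 * s.reg 0 + s.reg 10) = 0 := by
        rw [← hM.keep _ (addr_lt hs hs)]
        exact not_not.1 fun h => h3.2 h h4
      obtain ⟨h9, h10, h11⟩ := h8 M hrow (hp M hM)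
      refine ⟨?_, h10, fun u v hv huv hu hv' => h11 u v hv (by omega) hu hv'⟩
      rw [h9, rank_succ hrow, rank_zero, Nat.succ_mul]
      omega

/-- Append all rows that have not been deleted. -/
def packAll : Prog :=
  .seq (.const 21 0) (.seq (addr 0 21) (.seq (.copy 20 4) (forN 10 11 packRow)))

/-- With zero in register `21`, `addr 0 21` computes `n * n`, the first cell behind the matrix. -/
theorem Spec.packAll :
    Spec packAll (fun _ => True) fun s s' =>
      s'.reg 1 = s.reg 1 ∧ Packed (s.reg 0) s.mem (s.reg 0) 0 s' := by
  refine (Spec.seq (Spec.const (by norm_num) (by norm_num)) (Spec.seq (pre := fun _ => True)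
    ((Spec.addr (i := 0) (j := 21) (by norm_num)).conseq (fun s _ => le_rfl) fun _ _ _ _ h => h)
    (Spec.seq (pre := fun _ => True) (Spec.copy (by norm_num) (by norm_num))
      (Spec.forN (x := 10) (c := 11) (pre := fun _ => True) Spec.packRow
        (fun s₀ j s => s.reg 1 = s₀.reg 1 ∧ ∀ M, Packed (s₀.reg 0) M 0 0 s₀ →
          Packed (s₀.reg 0) M j 0 s) (by norm_num) (by norm_num) (by norm_num) (by norm_num)
        (by norm_num) ?_ ?_ ?_ ?_) (by simp)) (by simp)) (by simp)).conseq (fun _ h => h) ?_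
  · rintro s₀ j s a b ⟨h1, h4⟩
    refine ⟨by simpa using h1, fun M hp => ?_⟩
    obtain ⟨h5, h6, h7⟩ := h4 M hp
    exact ⟨by simpa using h5, h6, h7⟩
  · exact fun s _ => ⟨rfl, fun M h => h⟩
  · rintro s₀ j s - h0 - hx hj
    omega
  · rintro s₀ j s s' - h0 ⟨h1, h2⟩ hx hj ⟨h3, h4, h5, h6⟩
    rw [h0, hx] at h6
    exact ⟨⟨h3.trans h1, fun M hM => h6 M (h2 M hM)⟩, h4, h5⟩
  · rintro s s' - - ⟨s₁, -, -, rfl, s₂, -, -, rfl, s₃, -, -, rfl, h1, h2⟩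
    simp only [State.setReg_reg] at h1 h2
    norm_num at h1 h2
    refine ⟨h1, h2 s.mem ⟨?_, fun a _ => rfl, fun u v _ h => by omega⟩⟩
    simp [rank_zero]

/-- Copy the cell with address in register `20` to the cell with address in register `21`. -/
def copyCell : Prog :=
  .seq (.load 4 20) (.seq (.store 21 4) (.seq (.add 20 20 2) (.add 21 21 2)))

/-- Copy the cells behind the matrix to the place of the matrix. -/
def copyBack : Prog :=
  .seq (.const 21 0) (.seq (addr 0 21) (.seq (.copy 20 4) (forN 10 11 (forN 12 13 copyCell))))

/-- The first `a` cells have been copied. -/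
structure CopiedCells (n : ℕ) (M : ℕ → ℕ) (a : ℕ) (s : State) : Prop where
  src : s.reg 20 = n * n + a
  tgt : s.reg 21 = a
  done : ∀ b < a, s.mem b = M (n * n + b)
  keep : ∀ b, n * n ≤ b → s.mem b = M b

theorem CopiedCells.setReg {n : ℕ} {M : ℕ → ℕ} {a : ℕ} {s : State} (h : CopiedCells n M a s)
    {x b : ℕ} (hx : x < 20) : CopiedCells n M a (s.setReg x b) := by
  obtain ⟨h1, h2, h3, h4⟩ := h
  refine ⟨?_, ?_, h3, h4⟩
  · rw [State.setReg_reg, if_neg (by omega), h1]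
  · rw [State.setReg_reg, if_neg (by omega), h2]

theorem Spec.copyCell :
    Spec copyCell (fun _ => True) fun s s' => (∀ r, 8 ≤ r ∧ r < 20 ∨ r = 1 ∨ r = 22 → s'.reg r = s.reg r) ∧
      ∀ M a, a < s.reg 0 * s.reg 0 → CopiedCells (s.reg 0) M a s →
        CopiedCells (s.reg 0) M (a + 1) s' := by
  refine (Spec.seq (Spec.load (by norm_num) (by norm_num)) (Spec.seq (pre := fun _ => True)
    Spec.store (Spec.seq (pre := fun _ => True) (Spec.add (by norm_num) (by norm_num))
      (Spec.add (pre := fun _ => True) (by norm_num) (by norm_num))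
      (by simp)) (by simp)) (by simp)).conseq (fun _ h => h) ?_
  rintro s s' - - ⟨s₁, -, -, rfl, s₂, -, h2, rfl, s₃, -, -, rfl, rfl⟩
  simp only [State.setReg_reg, State.setMem_reg] at h2 ⊢
  norm_num at h2 ⊢
  refine ⟨fun r hr => ?_, fun M a ha ⟨h3, h4, h5, h6⟩ => ⟨?_, ?_, fun b hb => ?_, fun b hb => ?_⟩⟩
  · rw [if_neg (by omega), if_neg (by omega), if_neg (by omega)]
  · simp [h3, h2]; omega
  · simp [h4, h2]
  · simp only [State.setReg_mem, State.setMem_mem]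
    split_ifs with h7
    · rw [h3, h6 _ (by omega), h7, h4]
    · exact h5 b (by omega)
  · simp only [State.setReg_mem, State.setMem_mem]
    rw [if_neg (by omega), h6 b hb]

/-- All targets are below `n * n` and all sources are not, so no source is overwritten before it is
read. -/
theorem Spec.copyBack :
    Spec copyBack (fun _ => True) fun s s' => s'.reg 1 = s.reg 1 ∧ s'.reg 22 = s.reg 22 ∧
      ∀ b < s.reg 0 * s.reg 0, s'.mem b = s.mem (s.reg 0 * s.reg 0 + b) := by
  have hrow : Spec (RAM.forN 12 13 RAM.copyCell) (fun s => s.reg 10 < s.reg 0) fun s s' =>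
      s'.reg 1 = s.reg 1 ∧ s'.reg 22 = s.reg 22 ∧ s'.reg 10 = s.reg 10 ∧ s'.reg 11 = s.reg 11 ∧
      ∀ M, CopiedCells (s.reg 0) M (s.reg 10 * s.reg 0) s →
        CopiedCells (s.reg 0) M (s.reg 10 * s.reg 0 + s.reg 0) s' := by
    refine Spec.forN (pre := fun s => s.reg 10 < s.reg 0) Spec.copyCell
      (fun s₀ j s => s.reg 1 = s₀.reg 1 ∧ s.reg 22 = s₀.reg 22 ∧ s.reg 10 = s₀.reg 10 ∧ s.reg 11 = s₀.reg 11 ∧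
        ∀ M, CopiedCells (s₀.reg 0) M (s₀.reg 10 * s₀.reg 0) s₀ →
          CopiedCells (s₀.reg 0) M (s₀.reg 10 * s₀.reg 0 + j) s)
      (by norm_num) (by norm_num) (by norm_num) (by norm_num) (by norm_num) ?_ ?_ ?_ ?_
    · rintro s₀ j s a b ⟨h1, hk, h2, h3, h4⟩
      exact ⟨by simpa using h1, by simpa using hk, by simpa using h2, by simpa using h3, fun M hM =>
        ((h4 M hM).setReg (by norm_num)).setReg (by norm_num)⟩
    · exact fun s _ => ⟨rfl, rfl, rfl, rfl, fun M h => h⟩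
    · exact fun _ _ _ _ _ _ _ _ => trivial
    · rintro s₀ j s s' hs₀ h0 ⟨h1, hk, h2, h3, h4⟩ hx hj ⟨h5, h6⟩
      rw [h0] at h6
      exact ⟨⟨(h5 1 (by norm_num)).trans h1, (h5 22 (by norm_num)).trans hk,
        (h5 10 (by norm_num)).trans h2,
        (h5 11 (by norm_num)).trans h3, fun M hM => h6 M _ (addr_lt hs₀ hj) (h4 M hM)⟩,
        h5 12 (by norm_num), h5 13 (by norm_num)⟩
  refine (Spec.seq (Spec.const (by norm_num) (by norm_num)) (Spec.seq (pre := fun _ => True)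
    ((Spec.addr (i := 0) (j := 21) (by norm_num)).conseq (fun s _ => le_rfl) fun _ _ _ _ h => h)
    (Spec.seq (pre := fun _ => True) (Spec.copy (by norm_num) (by norm_num))
      (Spec.forN (x := 10) (c := 11) (pre := fun _ => True) hrow
        (fun s₀ j s => s.reg 1 = s₀.reg 1 ∧ s.reg 22 = s₀.reg 22 ∧ ∀ M, CopiedCells (s₀.reg 0) M 0 s₀ →
          CopiedCells (s₀.reg 0) M (j * s₀.reg 0) s) (by norm_num) (by norm_num) (by norm_num)
        (by norm_num) (by norm_num) ?_ ?_ ?_ ?_) (by simp)) (by simp)) (by simp)).conseq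
    (fun _ h => h) ?_
  · rintro s₀ j s a b ⟨h1, hk, h4⟩
    exact ⟨by simpa using h1, by simpa using hk, fun M hM => ((h4 M hM).setReg (by norm_num)).setReg (by norm_num)⟩
  · exact fun s _ => ⟨rfl, rfl, fun M h => by rwa [zero_mul]⟩
  · rintro s₀ j s - h0 - hx hj
    omega
  · rintro s₀ j s s' - h0 ⟨h1, hk, h2⟩ hx hj ⟨h3, hk', h4, h5, h6⟩
    rw [h0, hx, ← Nat.succ_mul] at h6
    exact ⟨⟨h3.trans h1, hk'.trans hk, fun M hM => h6 M (h2 M hM)⟩, h4, h5⟩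
  · rintro s s' - - ⟨s₁, -, -, rfl, s₂, -, -, rfl, s₃, -, -, rfl, h1, hk, h2⟩
    simp only [State.setReg_reg] at h1 hk h2
    norm_num at h1 hk h2
    exact ⟨h1, hk, (h2 s.mem ⟨by simp, by simp, fun b hb => by omega, fun b _ => rfl⟩).done⟩

/-- Count the vertices in register `22`. -/
def countAlive : Prog :=
  .seq (.const 22 0) (forN 10 11 (.seq (readDec 10 10) (.cond 4 .skip (.add 22 22 2))))

theorem Spec.countAlive :
    Spec countAlive (fun _ => True) fun s s' =>
      s'.reg 1 = s.reg 1 ∧ s'.mem = s.mem ∧ s'.reg 22 = rank (s.reg 0) s.mem (s.reg 0) := by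
  have hbody : Spec (.seq (readDec 10 10) (.cond 4 .skip (.add 22 22 2)))
      (fun s => s.reg 10 < s.reg 0) fun s s' => s'.mem = s.mem ∧
        (∀ r, r = 1 ∨ r = 10 ∨ r = 11 → s'.reg r = s.reg r) ∧
        (s.reg 22 = rank (s.reg 0) s.mem (s.reg 10) →
          s'.reg 22 = rank (s.reg 0) s.mem (s.reg 10 + 1)) := by
    refine (Spec.seq (Dec.readDec (i := 10) (j := 10) (by norm_num) fun s hs => le_of_lt hs)
      (Spec.cond (pre := fun _ => True) Spec.skip (Spec.add (by norm_num) (by norm_num)))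
      (by simp)).conseq (fun _ h => h) ?_
    rintro s s'' - - ⟨s', h0, h2, ⟨h1, -, h3⟩, ⟨h4, rfl⟩ | ⟨h4, rfl⟩⟩
    · refine ⟨h1.1, fun r hr => h1.2 r (by omega), fun h => ?_⟩
      rw [h1.2 22 (by norm_num), h, rank_succ_of_ne (h3.1 h4)]
    · refine ⟨h1.1, fun r hr => ?_, fun h => ?_⟩
      · rw [State.setReg_reg, if_neg (by omega), h1.2 r (by omega)]
      · rw [State.setReg_reg, if_pos rfl, h1.2 22 (by norm_num), h2, h,
          rank_succ (not_not.1 fun h => h3.2 h h4)]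
  refine (Spec.seq (Spec.const (by norm_num) (by norm_num)) (Spec.forN (x := 10) (c := 11)
    (pre := fun _ => True) hbody (fun s₀ j s => s.reg 1 = s₀.reg 1 ∧ s.mem = s₀.mem ∧
      (s₀.reg 22 = 0 → s.reg 22 = rank (s₀.reg 0) s₀.mem j)) (by norm_num) (by norm_num)
    (by norm_num) (by norm_num) (by norm_num) ?_ ?_ ?_ ?_) (by simp)).conseq (fun _ h => h) ?_
  · rintro s₀ j s a b ⟨h1, h2, h3⟩
    exact ⟨by simpa using h1, h2, by simpa using h3⟩
  · exact fun s _ => ⟨rfl, rfl, fun h => by rw [h, rank_zero]⟩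
  · rintro s₀ j s - h0 - hx hj
    omega
  · rintro s₀ j s s' - h0 ⟨h1, h2, h3⟩ hx hj ⟨h4, h5, h6⟩
    rw [h0, hx, h2] at h6
    exact ⟨⟨(h5 1 (by norm_num)).trans h1, h4.trans h2, fun h => h6 (h3 h)⟩,
      h5 10 (by norm_num), h5 11 (by norm_num)⟩
  · rintro s s' - - ⟨s₁, -, -, rfl, h1, h2, h3⟩
    simp only [State.setReg_reg] at h1 h3
    norm_num at h1 h3
    exact ⟨h1, h2, h3⟩

/-- Close the gaps of the deleted vertices in the matrix, and count the vertices in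
register `22`. -/
def compact : Prog := .seq packAll (.seq countAlive copyBack)

/-- Vertices are counted between the phases, because packing preserves the matrix and copying back
overwrites it. The packed matrix has at most `n * n` cells, so `copyBack` moves all of it. -/
theorem Spec.compact :
    Spec compact (fun _ => True) fun s s' => s'.reg 1 = s.reg 1 ∧
      s'.reg 22 = rank (s.reg 0) s.mem (s.reg 0) ∧
      ∀ u v, u < s.reg 0 → v < s.reg 0 → s.mem (u * s.reg 0 + u) = 0 →
        s.mem (v * s.reg 0 + v) = 0 →
        s'.mem (rank (s.reg 0) s.mem u * s'.reg 22 + rank (s.reg 0) s.mem v) =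
          s.mem (u * s.reg 0 + v) := by
  refine (Spec.seq Spec.packAll (Spec.seq (pre := fun _ => True) Spec.countAlive
    Spec.copyBack (by simp)) (by simp)).conseq (fun _ h => h) ?_
  rintro s s' - - ⟨s₁, h0, -, ⟨h1, h2⟩, s₂, h0', -, ⟨h3, h4, h5⟩, h6, h7, h8⟩
  have hr : s₂.reg 22 = rank (s.reg 0) s.mem (s.reg 0) := by
    rw [h5, h0]
    exact rank_congr fun u hu => h2.keep _ (addr_lt hu hu)
  refine ⟨h6.trans (h3.trans h1), h7.trans hr, fun u v hu hv hu' hv' => ?_⟩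
  rw [h7, hr]
  have hlt := addr_lt (rank_lt hu' hu) (rank_lt hv' hv)
  have hle := Nat.mul_le_mul (rank_le (s.reg 0) s.mem (s.reg 0)) (rank_le (s.reg 0) s.mem (s.reg 0))
  rw [h0', h0] at h8
  rw [h8 _ (by omega), h4, ← add_assoc]
  exact h2.entry u v hv (Or.inl hu) hu' hv'

end Output

end RAM

/-! ## The kernelization algorithm -/

namespace RAM

section Kernel

variable {𝒢 : Set FinGraph} {Q : ParamGraphProblem 𝒢}

theorem ncard_aliveSet (n : ℕ) (M : ℕ → ℕ) : (aliveSet n M).ncard = rank n M n := by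
  classical
  rw [rank, Nat.count_eq_card_filter_range, ← Set.ncard_coe_finset,
    ← Set.ncard_image_of_injective _ Fin.val_injective]
  congr 1
  ext v
  simp only [Set.mem_image, Finset.coe_filter, Finset.mem_range, Set.mem_ofPred_eq]
  exact ⟨fun ⟨i, hi, h⟩ => h ▸ ⟨i.2, hi⟩, fun h => ⟨⟨v, h.1⟩, h.2, rfl⟩⟩

theorem rank_inj {n : ℕ} {M : ℕ → ℕ} {u v : Fin n} (hu : u ∈ aliveSet n M) (hv : v ∈ aliveSet n M)
    (h : rank n M u = rank n M v) : u = v := by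
  rcases lt_trichotomy u.1 v.1 with h' | h' | h'
  · exact absurd h (rank_lt hu h').ne
  · exact Fin.ext h'
  · exact absurd h (rank_lt hv h').ne'

theorem bijective_rank (n : ℕ) (M : ℕ → ℕ) : Function.Bijective fun u : aliveSet n M =>
    (⟨rank n M u, rank_lt u.2 u.1.2⟩ : Fin (rank n M n)) := by
  have hcard : Nat.card (aliveSet n M) = Nat.card (Fin (rank n M n)) := by
    rw [Nat.card_coe_set_eq, ncard_aliveSet, Nat.card_fin]
  exact (Nat.bijective_iff_injective_and_card _).2 ⟨fun u v huv =>
    Subtype.ext (rank_inj u.2 v.2 (congrArg Fin.val huv)), hcard⟩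

/-- The matrix `M'` arises from `M` by closing the gaps of the deleted vertices. -/
def Compacted (n : ℕ) (M M' : ℕ → ℕ) : Prop :=
  ∀ u ∈ aliveSet n M, ∀ v ∈ aliveSet n M,
    M' (rank n M u * rank n M n + rank n M v) = M (u * n + v)

theorem Compacted.iso {n : ℕ} {M M' : ℕ → ℕ} (h : Compacted n M M') :
    Nonempty ((memFinGraph n M).graph ≃g (FinGraph.ofFin (memGraph (rank n M n) M')).graph) := by
  refine ⟨⟨Equiv.ofBijective _ (bijective_rank n M), ?_⟩⟩
  intro (u : aliveSet n M) (v : aliveSet n M)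
  change ((⟨rank n M u, _⟩ : Fin (rank n M n)) ≠ ⟨rank n M v, _⟩ ∧
    M' (rank n M u * rank n M n + rank n M v) ≠ 0 ∧
    M' (rank n M v * rank n M n + rank n M u) ≠ 0) ↔
    (u.1 ≠ v.1 ∧ M (u.1 * n + v.1) ≠ 0 ∧ M (v.1 * n + u.1) ≠ 0)
  rw [h u u.2 v v.2, h v v.2 u u.2, ne_eq, Fin.mk.injEq]
  exact and_congr_left' (not_congr ⟨rank_inj u.2 v.2, fun h => h ▸ rfl⟩)

theorem Compacted.holds {n k : ℕ} {M : ℕ → ℕ} {s : State} (h : Compacted n M s.mem)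
    (hv : Valid n M) (h0 : s.reg 0 = rank n M n) (h1 : s.reg 1 = k) :
    s.Holds (memGraph (rank n M n) s.mem) k := by
  refine ⟨h0, h1, fun a b => ?_⟩
  change ((a ≠ b ∧ s.mem _ ≠ 0 ∧ s.mem _ ≠ 0) → _) ∧ (¬ (a ≠ b ∧ s.mem _ ≠ 0 ∧ s.mem _ ≠ 0) → _)
  obtain ⟨⟨u, hu⟩, rfl⟩ := (bijective_rank n M).2 a
  obtain ⟨⟨v, hv'⟩, rfl⟩ := (bijective_rank n M).2 b
  rw [h u hu v hv', h v hv' u hu]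
  obtain ⟨h2, h3⟩ := hv u hu v hv'
  refine ⟨fun h => by omega, fun h => ?_⟩
  by_contra hne
  refine h ⟨fun he => ?_, hne, h2 ▸ hne⟩
  obtain rfl : u = v := rank_inj hu hv' (congrArg Fin.val he)
  exact hne hu

theorem State.Holds.valid {s : State} {n k : ℕ} {G : SimpleGraph (Fin n)} (h : s.Holds G k) :
    Valid n s.mem := by
  intro i _ j _
  obtain ⟨h1, h2⟩ := h.2.2 i j
  obtain ⟨h3, h4⟩ := h.2.2 j i
  by_cases hij : G.Adj i j
  · rw [h1 hij, h3 hij.symm]; exact ⟨rfl, le_rfl⟩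
  · rw [h2 hij, h4 fun h => hij h.symm]; exact ⟨rfl, zero_le_one⟩

theorem State.Holds.iso {s : State} {n k : ℕ} {G : SimpleGraph (Fin n)} (h : s.Holds G k) :
    Nonempty ((FinGraph.ofFin G).graph ≃g (memFinGraph n s.mem).graph) := by
  have hadj : ∀ i j, G.Adj i j ↔ (memGraph n s.mem).Adj i j := by
    intro i j
    refine ⟨fun hij => ⟨hij.ne, ?_, ?_⟩, fun hij => ?_⟩
    · rw [(h.2.2 i j).1 hij]; exact one_ne_zero
    · rw [(h.2.2 j i).1 hij.symm]; exact one_ne_zero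
    · by_contra hcon
      exact hij.2.1 ((h.2.2 i j).2 hcon)
  have hal : ∀ i : Fin n, i ∈ aliveSet n s.mem := fun i => (h.2.2 i i).2 (G.loopless.irrefl i)
  exact ⟨⟨⟨fun i => ⟨i, hal i⟩, fun i => i.1, fun _ => rfl, fun _ => rfl⟩,
    fun {i j} => (hadj i j).symm⟩⟩

/-- Write constants into memory cells. -/
def writeCells (f : ℕ → ℕ) (l : List ℕ) : Prog :=
  seqs (l.map fun a => .seq (.const 3 a) (.seq (.const 4 (f a)) (.store 3 4)))

theorem run_writeCells (f : ℕ → ℕ) (l : List ℕ) (s : State) :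
    ∃ s', Run (writeCells f l) s (3 * l.length + 1) s' ∧ s'.reg 0 = s.reg 0 ∧
      s'.reg 1 = s.reg 1 ∧ (∀ a ∈ l, s'.mem a = f a) ∧ ∀ a, s.mem a = f a → s'.mem a = f a := by
  induction l generalizing s with
  | nil => exact ⟨s, Run.skip s, rfl, rfl, by simp, fun _ h => h⟩
  | cons a l ih =>
    have hrun := (Run.const 3 a s).seq ((Run.const 4 (f a) _).seq (Run.store 3 4 _))
    obtain ⟨s', hrun', h0, h1, h2, h3⟩ := ih
      ((((s.setReg 3 a).setReg 4 (f a)).setMem _ _))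
    have hmem : (((s.setReg 3 a).setReg 4 (f a)).setMem
        (((s.setReg 3 a).setReg 4 (f a)).reg 3) (((s.setReg 3 a).setReg 4 (f a)).reg 4)).mem =
        Function.update s.mem a (f a) := by
      simp [State.setMem, State.setReg]
    have hlen : 3 * (a :: l).length + 1 = 1 + (1 + 1) + (3 * l.length + 1) := by
      rw [List.length_cons]; ring
    rw [hmem] at h3
    rw [hlen]
    refine ⟨s', hrun.seq hrun', by simpa using h0, by simpa using h1, fun b hb => ?_, fun b hb => ?_⟩
    · rcases List.mem_cons.1 hb with rfl | hb
      · exact h3 b (Function.update_self _ _ _)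
      · exact h2 b hb
    · refine h3 b ?_
      rw [Function.update_apply]
      split_ifs with h
      · rw [h]
      · exact hb

/-- The instance is wired into the program, so the number of steps does not depend on the start
state. -/
theorem exists_run_holds {n : ℕ} (G : SimpleGraph (Fin n)) (k : ℕ) :
    ∃ (P : Prog) (C : ℕ), ∀ s, ∃ s', Run P s C s' ∧ s'.Holds G k := by
  classical
  let f : ℕ → ℕ := fun a => if ∃ i j : Fin n, a = i * n + j ∧ G.Adj i j then 1 else 0
  refine ⟨.seq (.const 0 n) (.seq (.const 1 k) (writeCells f (List.range (n * n)))),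
    1 + (1 + (3 * (List.range (n * n)).length + 1)), fun s => ?_⟩
  obtain ⟨s', hrun, h0, h1, h2, -⟩ := run_writeCells f (List.range (n * n))
    ((s.setReg 0 n).setReg 1 k)
  refine ⟨s', (Run.const 0 n s).seq ((Run.const 1 k _).seq hrun), by simpa using h0,
    by simpa using h1, fun i j => ?_⟩
  rw [h2 _ (List.mem_range.2 (addr_lt i.2 j.2))]
  refine ⟨fun h => if_pos ⟨i, j, rfl, h⟩, fun h => if_neg ?_⟩
  rintro ⟨i', j', he, h'⟩
  obtain ⟨h3, h4⟩ := addr_inj j.2 j'.2 he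
  rw [Fin.ext h3, Fin.ext h4] at h
  exact h h'

/-- A program that writes some no-instance, if there is one. -/
theorem exists_run_noInstance (Q : ParamGraphProblem 𝒢) :
    ∃ (P : Prog) (C B : ℕ), ∀ (n : ℕ) (G : SimpleGraph (Fin n)) (k : ℕ), FinGraph.ofFin G ∈ 𝒢 →
      ¬ Q.Yes (FinGraph.ofFin G) k → ∀ s, ∃ (s' : State) (n' : ℕ) (G' : SimpleGraph (Fin n'))
        (k' : ℕ), Run P s C s' ∧ s'.Holds G' k' ∧ FinGraph.ofFin G' ∈ 𝒢 ∧
          ¬ Q.Yes (FinGraph.ofFin G') k' ∧ n' + G'.edgeSet.ncard ≤ B ∧ k' ≤ B := by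
  by_cases hno : ∃ (n : ℕ) (G : SimpleGraph (Fin n)) (k : ℕ), FinGraph.ofFin G ∈ 𝒢 ∧
      ¬ Q.Yes (FinGraph.ofFin G) k
  · obtain ⟨n, G, k, hG, hk⟩ := hno
    obtain ⟨P, C, hP⟩ := exists_run_holds G k
    refine ⟨P, C, n + G.edgeSet.ncard + k, fun _ _ _ _ _ s => ?_⟩
    obtain ⟨s', hrun, h⟩ := hP s
    exact ⟨s', n, G, k, hrun, h, hG, hk, by omega, by omega⟩
  · exact ⟨.skip, 0, 0, fun n G k hG hk => absurd ⟨n, G, k, hG, hk⟩ hno⟩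

/-- Compute in register `24` by how much register `22` exceeds `a * reg 1 + b`. -/
def excess (a b : ℕ) : Prog :=
  .seq (.const 23 b) (.seq (seqs (List.replicate a (.add 23 23 1))) (.sub 24 22 23))

theorem Spec.excess (a b : ℕ) :
    Spec (excess a b) (fun _ => True) fun s s' => s'.reg 1 = s.reg 1 ∧ s'.reg 22 = s.reg 22 ∧
      s'.mem = s.mem ∧ (s'.reg 24 = 0 ↔ s.reg 22 ≤ a * s.reg 1 + b) := by
  have hadd : Spec (seqs (List.replicate a (.add 23 23 1))) (fun _ => True)
      fun s s' => s' = s.setReg 23 (a * s.reg 1 + s.reg 23) := by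
    clear b
    induction a with
    | zero =>
      refine Spec.skip.conseq (fun _ h => h) ?_
      rintro s s' - - rfl
      exact State.ext_of (fun r => by simp only [State.setReg_reg]; split_ifs <;> simp_all) rfl
    | succ a ih =>
      refine (Spec.seq (Spec.add (pre := fun _ => True) (by norm_num) (by norm_num)) ih
        (by simp)).conseq (fun _ h => h) ?_
      rintro s s' - - ⟨s₁, -, -, rfl, rfl⟩
      refine State.ext_of (fun r => ?_) rfl
      simp only [State.setReg_reg]
      norm_num
      split_ifs <;> ring
  refine (Spec.seq (Spec.const (by norm_num) (by norm_num)) (Spec.seq (pre := fun _ => True) hadd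
    (Spec.sub (pre := fun _ => True) (by norm_num) (by norm_num)) (by simp)) (by simp)).conseq
    (fun _ h => h) ?_
  rintro s s' - - ⟨s₁, -, -, rfl, s₂, -, -, rfl, rfl⟩
  refine ⟨by simp, by simp, rfl, ?_⟩
  simp
  omega

/-- Apply the rules exhaustively, close the gaps, and compare the number of vertices with the
bound for yes-instances. -/
noncomputable def shrink (L : List (Rule Q)) (a b : ℕ) : Prog :=
  .seq (reduce L) (.seq compact (excess a b))

theorem Spec.shrink (h𝒢 : IsoClosed 𝒢) (L : List (Rule Q)) (a b : ℕ) :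
    Spec (shrink L a b) (fun s => Valid (s.reg 0) s.mem) fun s s' => ∃ M,
      Progress L (s.reg 0) s.mem (s.reg 1) M (s'.reg 1) ∧ ¬ Reducible L (s.reg 0) M ∧
      Compacted (s.reg 0) M s'.mem ∧ s'.reg 22 = rank (s.reg 0) M (s.reg 0) ∧
      (s'.reg 24 = 0 ↔ s'.reg 22 ≤ a * s'.reg 1 + b) := by
  refine (Spec.seq (Spec.reduce h𝒢 L) (Spec.seq Spec.compact (Spec.excess a b) (by simp))
    (by simp)).conseq (fun _ h => h) ?_
  rintro s s' - - ⟨s₁, h0, -, ⟨h1, h2⟩, s₂, -, -, ⟨h3, h4, h5⟩, h6, h7, h8, h9⟩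
  rw [h0] at h4 h5
  refine ⟨s₁.mem, ?_, h2, fun u hu v hv => ?_, h7.trans h4, ?_⟩
  · rw [h6, h3]; exact h1
  · rw [h8, ← h5 u v u.2 v.2 hu hv, h4]
  · rw [h7, h6]; exact h9

/-- Register `1` holds the parameter plus one during the reduction, so that zero can stand for a
negative parameter. If it ends at zero, or the vertex count exceeds the bound of `hirr`, the input
was a no-instance and `P` writes a fixed one. -/
theorem hasLinearKernel_of_rules (h𝒢 : IsoClosed 𝒢) (L : List (Rule Q)) (a b α : ℕ)
    (hirr : ∀ n mem K, Valid n mem → memFinGraph n mem ∈ 𝒢 → ¬ Reducible L n mem →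
      YesSucc Q (memFinGraph n mem) K → (aliveSet n mem).ncard ≤ a * K + b)
    (hα : ∀ G ∈ 𝒢, G.graph.edgeSet.ncard ≤ α * Nat.card G.V) : Q.HasLinearKernel := by
  obtain ⟨P, C, B, hP⟩ := exists_run_noInstance Q
  obtain ⟨p, hp⟩ := Spec.shrink h𝒢 L a b
  -- At most `a * (k + 1) + b` vertices remain, with at most `α` times as many edges. The extra `1`
  -- makes room for the parameter, and `B` for the fixed no-instance.
  refine ⟨(1 + α) * a + 1, (1 + α) * (a + b) + B,
    .seq (.const 2 1) (.seq (.add 1 1 2) (.seq (shrink L a b)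
      (.cond 1 (.cond 24 P (.seq (.copy 0 22) (.sub 1 1 2))) P))), p + Polynomial.C (C + 6),
    fun n G k hG s hin => ?_⟩
  have hs := hin.1
  have hs0 := hs.1
  have hs1 := hs.2.1
  obtain ⟨m, s₁, hrun, hm, h0, h2, M, hprog, hred, hcomp, h22, h24⟩ :=
    hp (n + k) ((s.setReg 2 1).setReg 1 (s.reg 1 + 1)) (by simp [hs0]) (by simp)
      (by simpa [hs0] using hs.valid)
  simp only [State.setReg_reg, State.setReg_mem] at hprog hred hcomp h22
  norm_num at hprog hred hcomp h22
  rw [hs0] at hprog hred hcomp h22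
  rw [hs1] at hprog
  have hrun₁ : ∀ {R : Prog} {m' : ℕ} {s'' : State}, Run R s₁ m' s'' →
      Run (.seq (.const 2 1) (.seq (.add 1 1 2) (.seq (shrink L a b) R))) s (1 + (1 + (m + m'))) s'' :=
    fun h => (Run.const 2 1 s).seq ((Run.add 1 1 2 _).seq (Run.seq (by simpa using hrun) h))
  have hiso := hs.iso
  have hmem : memFinGraph n M ∈ 𝒢 := hprog.mem_iff.1 (h𝒢 _ _ hiso hG)
  have hyes : Q.Yes (FinGraph.ofFin G) k ↔ YesSucc Q (memFinGraph n M) (s₁.reg 1) := by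
    rw [← hprog.yes_iff]
    refine ⟨fun h => ⟨k, rfl, Q.iso hiso h⟩, ?_⟩
    rintro ⟨k', hk, h⟩
    obtain rfl : k = k' := by omega
    exact Q.iso (hiso.map RelIso.symm) h
  have hle := hprog.le
  have heval : (p + Polynomial.C (C + 6)).eval (n + k) = p.eval (n + k) + (C + 6) := by
    rw [Polynomial.eval_add, Polynomial.eval_C]
  by_cases hgood : s₁.reg 1 ≠ 0 ∧ s₁.reg 24 = 0
  · have hbound := h24.1 hgood.2
    have hiso' := hcomp.iso
    have hholds : (((s₁.setReg 0 (s₁.reg 22)).setReg 1 (s₁.reg 1 - 1))).Holds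
        (memGraph (rank n M n) s₁.mem) (s₁.reg 1 - 1) :=
      Compacted.holds (s := (s₁.setReg 0 (s₁.reg 22)).setReg 1 (s₁.reg 1 - 1)) hcomp hprog.valid
        (by simpa using h22) (by simp)
    have hmem' := h𝒢 _ _ hiso' hmem
    have hE := hα _ hmem'
    refine ⟨_, _, rank n M n, memGraph (rank n M n) s₁.mem, s₁.reg 1 - 1,
      hrun₁ (.condPos hgood.1 (.condZero hgood.2 ((Run.copy 0 22 s₁).seq (Run.sub 1 1 2 _)))),
      by rw [heval]; omega, ?_, hmem', ?_, ?_, ?_⟩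
    · simpa [h2] using hholds
    · rw [hyes]
      constructor
      · rintro ⟨k', hk, h⟩
        rw [hk]
        exact Q.iso hiso' h
      · exact fun h => ⟨s₁.reg 1 - 1, by omega, Q.iso (hiso'.map RelIso.symm) h⟩
    · have hcard : Nat.card (FinGraph.ofFin (memGraph (rank n M n) s₁.mem)).V = rank n M n :=
        Nat.card_fin _
      rw [hcard] at hE
      change (memGraph (rank n M n) s₁.mem).edgeSet.ncard ≤ _ at hE
      have h3 : rank n M n ≤ a * (k + 1) + b := by
        rw [← h22]
        exact hbound.trans (Nat.add_le_add_right (Nat.mul_le_mul_left a hle) b)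
      have h4 := Nat.mul_le_mul_left (1 + α) h3
      nlinarith
    · beta_reduce
      have : k ≤ ((1 + α) * a + 1) * k := Nat.le_mul_of_pos_left k (by omega)
      omega
  · have hno : ¬ Q.Yes (FinGraph.ofFin G) k := by
      rw [hyes]
      intro h
      have hb := hirr n M _ hprog.valid hmem hred h
      obtain ⟨k', hk, -⟩ := h
      rw [ncard_aliveSet, ← h22] at hb
      exact hgood ⟨by omega, h24.2 hb⟩
    obtain ⟨s₂, n', G', k', hrun₂, hholds, hG', hno', hsize, hk'⟩ := hP n G k hG hno s₁
    have hrun₃ : ∃ m' ≤ C + 2, Run (.cond 1 (.cond 24 P (.seq (.copy 0 22) (.sub 1 1 2))) P)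
        s₁ m' s₂ := by
      by_cases h1 : s₁.reg 1 = 0
      · exact ⟨C + 1, by omega, .condZero h1 hrun₂⟩
      · exact ⟨C + 1 + 1, by omega, .condPos h1 (.condPos (fun h => hgood ⟨h1, h⟩) hrun₂)⟩
    obtain ⟨m', hm', hrun₃⟩ := hrun₃
    exact ⟨_, s₂, n', G', k', hrun₁ hrun₃, by rw [heval]; omega, hholds, hG', by tauto,
      by beta_reduce; omega, by beta_reduce; omega⟩

end Kernel

end RAM

/-! ## The main theorem -/

theorem mem_topologicalMinorFree_of_hom {W : Type*} {H : SimpleGraph W} (G G' : FinGraph)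
    (h : ∃ f : G'.graph →g G.graph, Function.Injective f) (hG : G ∈ topologicalMinorFree H) :
    G' ∈ topologicalMinorFree H := by
  obtain ⟨f, hf⟩ := h
  exact fun h => hG (h.map f hf)

theorem not_hasModel_of_mem {W : Type*} {H : SimpleGraph W} {G : FinGraph}
    (hG : G ∈ topologicalMinorFree H) : ¬ HasModel (Set.univ : Set (Sym2 W)) G.graph Set.univ :=
  fun h => hG (h.isTopologicalMinor H)

theorem mainTheorem1 {W : Type*} [Finite W] (H : SimpleGraph W)
    (Q : ParamGraphProblem (topologicalMinorFree H))
    (hfii : Q.HasFiniteIntegerIndex) (htw : Q.TreewidthBounding) :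
    Q.HasLinearKernel := by
  obtain ⟨c, t, htw⟩ := htw
  obtain ⟨r, hr⟩ := exists_card_le_of_noProtrusion W t
  obtain ⟨s, hs⟩ := hfii.exists_representatives_le r
  obtain ⟨N, a, hN⟩ := hr s
  obtain ⟨α, hα⟩ := exists_arcs_le W
  obtain ⟨L, hL⟩ := Q.exists_rules N
  refine RAM.hasLinearKernel_of_rules (fun G G' ⟨e⟩ =>
    mem_topologicalMinorFree_of_hom G G' ⟨e.symm.toHom, e.symm.injective⟩) L (a * c) a α
    (fun n mem K hv hG hred hyes => ?_) fun G hG => ?_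
  · obtain ⟨k, rfl, hyes⟩ := hyes
    obtain ⟨X, hX, hXt⟩ := htw _ _ hyes
    have := Fintype.ofFinite (RAM.memFinGraph n mem).V
    have hirr := ParamGraphProblem.noProtrusion_of_not_occurs mem_topologicalMinorFree_of_hom hs hL
      hG (fun ρ hρ φ h => hred ⟨ρ, hρ, _, fun i => (φ i).2, (RAM.occursMem_iff hv φ).2 h⟩)
    have hbound := hN _ _ (not_hasModel_of_mem hG) X.toFinite.toFinset
      (by rwa [Set.Finite.coe_toFinset]) hirr
    rw [← Set.ncard_eq_toFinset_card, ← Nat.card_eq_fintype_card] at hbound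
    calc (RAM.aliveSet n mem).ncard = Nat.card (RAM.memFinGraph n mem).V :=
          (Nat.card_coe_set_eq _).symm
      _ ≤ a * X.ncard + a := hbound
      -- The bound is needed in terms of the shifted parameter `K = k + 1`.
      _ ≤ a * (c * (k + 1)) + a := by
          gcongr
          exact hX.trans (Nat.mul_le_mul_left c k.le_succ)
      _ = a * c * (k + 1) + a := by rw [mul_assoc]
  · have := Fintype.ofFinite G.V
    rw [Nat.card_eq_fintype_card]
    exact hα _ _ (not_hasModel_of_mem hG)
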